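/- Let $(U_k)_{k\ge 0}$ be i.i.d. random variables, uniform on $[-1,1]$, on a probability space $(\Omega,P)$. Let $Y_t=\sum_{k\ge0}\mathbf 1_{[2k+1+U_k,\infty)}(t)$, $\mathcal F_t=\sigma(Y_s:0\le s\le t)$, and $\tilde{\mathcal F}_t=\mathcal F_{2k}$ for $2k\le t<2k+2$, $k\in\mathbb N$. For $X=f(U_0,\dots,U_n)$ with $f\in\mathcal C^1_b([-1,1]^{n+1})$ put $$D_tX=\sum_{k=0}^n\partial_kf(U_0,\dots,U_n)\big((1-U_k)\mathbf 1_{(2k,2k+1+U_k]}(t)-(1+U_k)\mathbf 1_{(2k+1+U_k,2k+2]}(t)\big),$$ and let $D:\mathrm{Dom}(D)\subset L^2(\Omega)\to L^2(\Omega\times\mathbb R_+)$ also denote the closure of this operator. For $X\in\mathrm{Dom}(D)$ the process $t\mapsto E[D_tX\mid\tilde{\mathcal F}_t]$ has a jointly measurable version, and the random variable $$G_X=\langle D_\cdot X,E[D_\cdot X\mid\tilde{\mathcal F}_\cdot]\rangle_{L^2(\mathbb R_+)}=\int_0^\infty D_tX\,E[D_tX\mid\tilde{\mathcal F}_t]\,dt$$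 is well defined a.s. and integrable. Let $d_W(X,Y)=\sup_h|E[h(X)]-E[h(Y)]|$ over the $1$-Lipschitz functions $h:\mathbb R\to\mathbb R$, let $d_{TV}(X,Y)=\sup_A|P(X\in A)-P(Y\in A)|$ over the Borel sets $A\subset\mathbb R$, and let $d_{\mathcal H}(X,Y)=\sup_h|E[h(X)]-E[h(Y)]|$ over the $h\in\mathcal C^2_b(\mathbb R)$ with $\max(\|h\|_\infty,\|h'\|_\infty,\|h''\|_\infty)\le1$. Let $\mathcal N$ be a standard normal random variable and, for $\nu>0$, let $\Gamma_\nu=2\Gamma(\nu/2)-\nu$, where $\Gamma(\nu/2)$ has the gamma law with shape $\nu/2$ and rate $1$. Norms may take the value $+\infty$. **Proposition.** For every $X\in\mathrm{Dom}(D)$ with $E[X]=0$, $$d_W(X,\mathcal N)\le\tfrac12\|2-G_X\|_{L^2(\Omega)}\le|1-E[X^2]|+\tfrac12\|G_X-E[G_X]\|_{L^2(\Omega)},$$ $$d_{TV}(X,\mathcal N)\le\|2-G_X\|_{L^2(\Omega)}\le2|1-E[X^2]|+\|G_X-E[G_X]\|_{L^2(\Omega)}.$$ If moreover $\nu>0$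 and $X>-\nu$ a.s., then $$d_{\mathcal H}(X,\Gamma_\nu)\le\big\|2(X+\nu)-\tfrac12G_X\big\|_{L^2(\Omega)}\le\big\|2(X+\nu)-E[X^2]\big\|_{L^2(\Omega)}+\tfrac12\|G_X-E[G_X]\|_{L^2(\Omega)}.$$ -/

import Mathlib

open MeasureTheory ProbabilityTheory Filter Topology
open scoped ENNReal

noncomputable section

namespace UniformMalliavin

/-! ### Distances between laws on the real line (with values in `[0, ∞]`) -/

/-- Total variation distance: supremum over Borel sets of the difference of probabilities. -/
def dTV (μ ν : Measure ℝ) : ℝ≥0∞ :=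
  ⨆ (A : Set ℝ) (_ : MeasurableSet A), ENNReal.ofReal |μ.real A - ν.real A|

/-- Wasserstein distance: supremum over test functions with Lipschitz constant at most `1`. -/
def dW (μ ν : Measure ℝ) : ℝ≥0∞ :=
  ⨆ (h : ℝ → ℝ) (_ : LipschitzWith 1 h), ENNReal.ofReal |(∫ x, h x ∂μ) - ∫ x, h x ∂ν|

/-- The class of `C²` functions that are bounded by `1` together with their first two
derivatives. -/
def classH : Set (ℝ → ℝ) :=
  {h | ContDiff ℝ 2 h ∧ ∀ x, |h x| ≤ 1 ∧ |deriv h x| ≤ 1 ∧ |iteratedDeriv 2 h x| ≤ 1}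

/-- The distance given by the test functions in `classH`. -/
def dH (μ ν : Measure ℝ) : ℝ≥0∞ :=
  ⨆ (h : ℝ → ℝ) (_ : h ∈ classH), ENNReal.ofReal |(∫ x, h x ∂μ) - ∫ x, h x ∂ν|

/-- The centered gamma law: the law of `2 Γ(ν/2) - ν`, where `Γ(ν/2)` has the gamma law with
shape `ν/2` and rate `1`. -/
def centeredGamma (ν : ℝ) : Measure ℝ :=
  (gammaMeasure (ν / 2) 1).map (fun x => 2 * x - ν)

/-- Lebesgue measure on the half line `[0, ∞)`. -/
def halfLine : Measure ℝ := volume.restrict (Set.Ici 0)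

variable {Ω : Type*} [MeasurableSpace Ω]

/-! ### The jump process and its filtration -/

/-- `Y_t = ∑ₖ 1_{[2k+1+Uₖ, ∞)}(t)`. -/
def jumpProcess (U : ℕ → Ω → ℝ) (t : ℝ) (ω : Ω) : ℝ≥0∞ :=
  ∑' k : ℕ, (Set.Ici (2 * (k : ℝ) + 1 + U k ω)).indicator (fun _ => (1 : ℝ≥0∞)) t

/-- `ℱ_t = σ(Y_s : 0 ≤ s ≤ t)`. -/
abbrev jumpSigma (U : ℕ → Ω → ℝ) (t : ℝ) : MeasurableSpace Ω :=
  ⨆ s ∈ Set.Icc (0 : ℝ) t, MeasurableSpace.comap (jumpProcess U s) inferInstance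

/-- `ℱ̃_t = ℱ_{2k}` for `2k ≤ t < 2k + 2`. -/
abbrev blockSigma (U : ℕ → Ω → ℝ) (t : ℝ) : MeasurableSpace Ω :=
  jumpSigma U (2 * (⌊t / 2⌋₊ : ℝ))

/-! ### The gradient -/

/-- A cylindrical functional `f(U₀, …, Uₙ)` with `f` of class `C¹`. Only the values of `f` on the
cube `[-1,1]^{n+1}` matter; there a `C¹` function and its derivatives are bounded, and the `C¹`
functions on the closed cube are the restrictions of the `C¹` functions on `ℝ^{n+1}`. -/
structure SmoothFunctional where
  n : ℕ
  f : (Fin (n + 1) → ℝ) → ℝ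
  smooth : ContDiff ℝ 1 f

/-- The random variable `f(U₀, …, Uₙ)`. -/
def SmoothFunctional.eval (F : SmoothFunctional) (U : ℕ → Ω → ℝ) (ω : Ω) : ℝ :=
  F.f (fun i => U i ω)

/-- The gradient
`D_t f(U₀, …, Uₙ) = ∑ₖ ∂ₖf(U₀, …, Uₙ) ((1 - Uₖ) 1_{(2k, 2k+1+Uₖ]}(t) - (1 + Uₖ) 1_{(2k+1+Uₖ, 2k+2]}(t))`
of a cylindrical functional, as a function of `(ω, t)`. -/
def SmoothFunctional.grad (F : SmoothFunctional) (U : ℕ → Ω → ℝ) (p : Ω × ℝ) : ℝ :=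
  ∑ k : Fin (F.n + 1),
    fderiv ℝ F.f (fun i => U i p.1) (Pi.single k 1) *
      ((Set.Ioc (2 * (k : ℝ)) (2 * (k : ℝ) + 1 + U k p.1)).indicator
          (fun _ => 1 - U k p.1) p.2
        - (Set.Ioc (2 * (k : ℝ) + 1 + U k p.1) (2 * (k : ℝ) + 2)).indicator
          (fun _ => 1 + U k p.1) p.2)

/-- `X` lies in the domain of the closed gradient `D : Dom(D) ⊆ L²(Ω) → L²(Ω × ℝ₊)`, and `Z` is
(a version of) `DX`: the pair `(X, Z)` is in the closure of the graph of the gradient on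
cylindrical functionals. -/
structure HasGradient (U : ℕ → Ω → ℝ) (P : Measure Ω) (X : Ω → ℝ) (Z : Ω × ℝ → ℝ) : Prop where
  memLp : MemLp X 2 P
  memLp_grad : MemLp Z 2 (P.prod halfLine)
  exists_approx : ∃ F : ℕ → SmoothFunctional,
    Tendsto (fun n => eLpNorm (fun ω => (F n).eval U ω - X ω) 2 P) atTop (𝓝 0) ∧
    Tendsto (fun n => eLpNorm (fun p => (F n).grad U p - Z p) 2 (P.prod halfLine)) atTop (𝓝 0)

/-- `V` is a jointly measurable version of the process `t ↦ E[Z_t | ℱ̃_t]`. -/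
structure IsCondExpProcess (U : ℕ → Ω → ℝ) (P : Measure Ω) (Z V : Ω × ℝ → ℝ) : Prop where
  aestronglyMeasurable : AEStronglyMeasurable V (P.prod halfLine)
  ae_eq_condExp : ∀ᵐ t ∂halfLine,
    (fun ω => V (ω, t)) =ᵐ[P] P[fun ω => Z (ω, t) | blockSigma U t]

/-- The inner product `⟨Z, V⟩_{L²(ℝ₊)}` of two processes, as a random variable. -/
def pairing (Z V : Ω × ℝ → ℝ) (ω : Ω) : ℝ :=
  ∫ t, Z (ω, t) * V (ω, t) ∂halfLine

end UniformMalliavin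

end

namespace UniformMalliavin

/-! ### Stein's equation for the standard normal law -/

/-! Half of `G_X` is a Stein kernel of `X`: for `φ` with bounded continuous derivative, `E[φ'(X)
G_X] = 2 E[φ(X) X]`. All the distance bounds follow from this identity and estimates on solutions of
Stein equations.

The identity is a covariance formula of Clark–Ocone type. For a cylindrical `f`, fix a time `2k+1+s`
in the `k`-th block and average the gradient over the coordinates from the `k`-th on. A one-variable
integration by parts in `U_k` (`integral_deriv_mul_blockKernel`) turns this conditional expectation
into a martingale increment of `f` with its `k`-th coordinate set to `s` (`avg_blockGrad`).
Integrating over the block makes `s` a fresh copy of `U_k`, the factor 2 being the length of a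
block. Orthogonality of martingale increments and telescoping over the blocks give twice the
covariance (`integral_gradProcess_mul_projProcess`). The gradient is a derivation, so taking `φ(f)`
against `f` brings out `φ'(f)`. The σ-algebra `ℱ_{2k}` agrees up to null sets with the one generated
by the first `k` variables. The identity passes to the closure because the projection is a
contraction of `L²` (`HasGradient.integral_deriv_mul`).

For a kernel `τ`, Stein's equation gives `E[h(X)] - E[h(N)] = E[f'(X)(1 - τ)]`. It remains to bound
`f'`: by 2 if `h` takes values in `[0,1]`, by 1 if `h` is smooth and 1-Lipschitz. For the gamma law
the solution is differentiated twice and a maximum principle bounds its derivative by half of the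
supremum of `|g''|` (`exists_gamma_stein_solution`). The centred forms are the triangle inequality
together with `E[G_X] = 2 E[X²]`, which is the Stein identity for `φ(x) = x`. -/

theorem integral_gaussianReal_eq (h : ℝ → ℝ) :
    ∫ x, h x ∂(gaussianReal 0 1) =
      (√(2 * Real.pi))⁻¹ * ∫ x, h x * Real.exp (-x ^ 2 / 2) := by
  rw [integral_gaussianReal_eq_integral_smul (by norm_num), ← integral_const_mul]
  refine integral_congr_ae (Eventually.of_forall fun x => ?_)
  simp [gaussianPDFReal]
  ring

theorem integrable_gauss_weight : Integrable (fun t : ℝ => Real.exp (-t ^ 2 / 2)) := by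
  have := integrable_exp_neg_mul_sq (b := 1 / 2) (by norm_num)
  refine this.congr (Eventually.of_forall fun x => ?_)
  simp only
  congr 1
  ring

theorem integrable_id_mul_gauss_weight :
    Integrable (fun t : ℝ => t * Real.exp (-t ^ 2 / 2)) := by
  have := integrable_mul_exp_neg_mul_sq (b := 1 / 2) (by norm_num)
  refine this.congr (Eventually.of_forall fun x => ?_)
  simp only
  congr 2
  ring

theorem hasDerivAt_neg_gauss_weight (t : ℝ) :
    HasDerivAt (fun t : ℝ => -Real.exp (-t ^ 2 / 2)) (t * Real.exp (-t ^ 2 / 2)) t := by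
  have h1 : HasDerivAt (fun t : ℝ => -t ^ 2 / 2) (-t) t :=
    ((hasDerivAt_pow 2 t).fun_neg.div_const 2).congr_deriv (by simp; ring)
  exact h1.exp.fun_neg.congr_deriv (by ring)

theorem tendsto_gauss_weight_cocompact :
    Tendsto (fun t : ℝ => Real.exp (-t ^ 2 / 2)) (cocompact ℝ) (𝓝 0) := by
  apply Real.tendsto_exp_atBot.comp
  have h2 : Tendsto (fun t : ℝ => ‖t‖ ^ 2 / 2) (cocompact ℝ) atTop :=
    ((tendsto_pow_atTop two_ne_zero).comp (tendsto_norm_cocompact_atTop (E := ℝ))).atTop_div_const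
      (by norm_num)
  refine (tendsto_neg_atTop_atBot.comp h2).congr fun t => ?_
  simp
  ring

theorem integral_Ioi_id_mul_gauss_weight (x : ℝ) :
    ∫ t in Set.Ioi x, t * Real.exp (-t ^ 2 / 2) = Real.exp (-x ^ 2 / 2) := by
  have := integral_Ioi_of_hasDerivAt_of_tendsto' (a := x)
    (fun t _ => hasDerivAt_neg_gauss_weight t) integrable_id_mul_gauss_weight.integrableOn
    (tendsto_gauss_weight_cocompact.mono_left atTop_le_cocompact).neg
  simpa using this

theorem integral_Iic_id_mul_gauss_weight (x : ℝ) :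
    ∫ t in Set.Iic x, t * Real.exp (-t ^ 2 / 2) = -Real.exp (-x ^ 2 / 2) := by
  have := integral_Iic_of_hasDerivAt_of_tendsto' (a := x)
    (fun t _ => hasDerivAt_neg_gauss_weight t) integrable_id_mul_gauss_weight.integrableOn
    (tendsto_gauss_weight_cocompact.mono_left atBot_le_cocompact).neg
  simpa using this

/-- Derivative of a cumulative integral. -/
theorem hasDerivAt_integral_Iic {k : ℝ → ℝ} (hk : Integrable k) (hc : Continuous k) (x : ℝ) :
    HasDerivAt (fun y => ∫ t in Set.Iic y, k t) (k x) x := by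
  have h1 : (fun y => ∫ t in Set.Iic y, k t)
      = fun y => (∫ t in Set.Iic (0 : ℝ), k t) + ∫ t in (0 : ℝ)..y, k t := by
    funext y
    rw [← intervalIntegral.integral_Iic_sub_Iic hk.integrableOn hk.integrableOn]
    ring
  rw [h1]
  exact (intervalIntegral.integral_hasDerivAt_right (hc.intervalIntegrable _ _)
    (hc.stronglyMeasurableAtFilter _ _) hc.continuousAt).const_add _

/-- The solution is `e^{x²/2}` times the integral of `(h - m) e^{-t²/2}` up to `x`. As `h` and `m`
both lie in `[0,1]`, `|h - m| ≤ 1`; the Mills ratio estimate gives `|x f(x)| ≤ 1`, and `f' = x f +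
(h - m)` is then at most `1 + 1`. -/
theorem exists_stein_solution_of_bounded {h : ℝ → ℝ} (hc : Continuous h)
    (h0 : ∀ x, 0 ≤ h x) (h1 : ∀ x, h x ≤ 1) :
    ∃ f f' : ℝ → ℝ, (∀ x, HasDerivAt f (f' x) x) ∧ Continuous f' ∧ (∀ x, |f' x| ≤ 2) ∧
      ∀ x, f' x - x * f x = h x - ∫ y, h y ∂(gaussianReal 0 1) := by
  set m := ∫ y, h y ∂(gaussianReal 0 1) with hm
  have hint : Integrable h (gaussianReal 0 1) :=
    Integrable.of_bound hc.aestronglyMeasurable 1 (Eventually.of_forall fun x => by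
      rw [Real.norm_eq_abs, abs_le]; constructor <;> linarith [h0 x, h1 x])
  have hm0 : 0 ≤ m := integral_nonneg h0
  have hm1 : m ≤ 1 := by
    have := integral_mono hint (integrable_const (1 : ℝ)) h1
    simpa using this
  have hg : ∀ x, |h x - m| ≤ 1 := fun x => by
    rw [abs_le]; constructor <;> linarith [h0 x, h1 x]
  set k : ℝ → ℝ := fun t => (h t - m) * Real.exp (-t ^ 2 / 2) with hkdef
  have hkc : Continuous k := by fun_prop
  have hkle : ∀ t, ‖k t‖ ≤ Real.exp (-t ^ 2 / 2) := fun t => by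
    rw [hkdef]
    simp only [Real.norm_eq_abs, abs_mul, Real.abs_exp]
    exact mul_le_of_le_one_left (Real.exp_pos _).le (hg t)
  have hk : Integrable k :=
    integrable_gauss_weight.mono' hkc.aestronglyMeasurable (Eventually.of_forall hkle)
  have hk0 : ∫ t, k t = 0 := by
    have e1 : ∫ y, (h y - m) ∂(gaussianReal 0 1) = 0 := by
      rw [integral_sub hint (integrable_const _)]
      simp [hm]
    rw [integral_gaussianReal_eq] at e1
    have : (√(2 * Real.pi))⁻¹ ≠ 0 := by positivity
    exact (mul_eq_zero.mp e1).resolve_left this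
  set F : ℝ → ℝ := fun y => ∫ t in Set.Iic y, k t with hF
  have hbound : ∀ x, |x * F x| ≤ Real.exp (-x ^ 2 / 2) := by
    intro x
    rcases le_total 0 x with hx | hx
    -- The integrand has total mass zero, so for `x ≥ 0` the right tail can replace the left one;
    -- there `x ≤ t`, and `t e^{-t²/2}` integrates explicitly.
    · have e : F x = -∫ t in Set.Ioi x, k t := by
        have := intervalIntegral.integral_Iic_add_Ioi (b := x) hk.integrableOn hk.integrableOn
        simp only [hF]; linarith
      rw [e, mul_neg, abs_neg, abs_mul, abs_of_nonneg hx, ← integral_Ioi_id_mul_gauss_weight x]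
      calc x * |∫ t in Set.Ioi x, k t|
          ≤ x * ∫ t in Set.Ioi x, Real.exp (-t ^ 2 / 2) := by
            gcongr
            exact norm_integral_le_of_norm_le integrable_gauss_weight.integrableOn
              (Eventually.of_forall hkle)
        _ = ∫ t in Set.Ioi x, x * Real.exp (-t ^ 2 / 2) := by rw [integral_const_mul]
        _ ≤ _ := by
            refine setIntegral_mono_on (integrable_gauss_weight.integrableOn.const_mul _)
              integrable_id_mul_gauss_weight.integrableOn measurableSet_Ioi fun t ht => ?_
            gcongr
            exact le_of_lt ht
    · rw [abs_mul, abs_of_nonpos hx,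
        show Real.exp (-x ^ 2 / 2) = - ∫ t in Set.Iic x, t * Real.exp (-t ^ 2 / 2) by
          rw [integral_Iic_id_mul_gauss_weight, neg_neg]]
      calc -x * |∫ t in Set.Iic x, k t|
          ≤ -x * ∫ t in Set.Iic x, Real.exp (-t ^ 2 / 2) := by
            have : 0 ≤ -x := by linarith
            gcongr
            exact norm_integral_le_of_norm_le integrable_gauss_weight.integrableOn
              (Eventually.of_forall hkle)
        _ = -∫ t in Set.Iic x, x * Real.exp (-t ^ 2 / 2) := by rw [integral_const_mul]; ring
        _ ≤ _ := by
            refine neg_le_neg (setIntegral_mono_on integrable_id_mul_gauss_weight.integrableOn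
              (integrable_gauss_weight.integrableOn.const_mul _) measurableSet_Iic fun t ht => ?_)
            gcongr
            exact ht
  set f : ℝ → ℝ := fun x => Real.exp (x ^ 2 / 2) * F x with hf
  have hexp : ∀ x : ℝ, Real.exp (x ^ 2 / 2) * Real.exp (-x ^ 2 / 2) = 1 := fun x => by
    rw [← Real.exp_add, neg_div, add_neg_cancel, Real.exp_zero]
  have hd : ∀ x, HasDerivAt f (x * f x + (h x - m)) x := fun x => by
    have e1 : HasDerivAt (fun x : ℝ => x ^ 2 / 2) x x :=
      ((hasDerivAt_pow 2 x).div_const 2).congr_deriv (by simp)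
    refine (e1.exp.fun_mul (hasDerivAt_integral_Iic hk hkc x)).congr_deriv ?_
    simp only [hf, hkdef, hF]
    linear_combination (h x - m) * hexp x
  have hfc : Continuous f := continuous_iff_continuousAt.mpr fun x => (hd x).continuousAt
  refine ⟨f, fun x => x * f x + (h x - m), hd, by fun_prop, fun x => ?_, fun x => by ring⟩
  have : |x * f x| ≤ 1 := by
    have e : x * f x = Real.exp (x ^ 2 / 2) * (x * F x) := by simp only [hf]; ring
    rw [e, abs_mul, Real.abs_exp, ← hexp x]
    gcongr
    exact hbound x
  calc |x * f x + (h x - m)| ≤ |x * f x| + |h x - m| := abs_add_le _ _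
    _ ≤ 2 := by linarith [hg x]

/-- The total variation distance is controlled by continuous test functions with values
in `[0, 1]`. -/
theorem dTV_le_of_continuous {μ ν : Measure ℝ} [IsFiniteMeasure μ] [IsFiniteMeasure ν]
    {C : ℝ} (hC : ∀ h : ℝ → ℝ, Continuous h → (∀ x, 0 ≤ h x) → (∀ x, h x ≤ 1) →
      |(∫ x, h x ∂μ) - ∫ x, h x ∂ν| ≤ C) :
    dTV μ ν ≤ ENNReal.ofReal C := by
  have closed_le : ∀ K : Set ℝ, IsClosed K → |μ.real K - ν.real K| ≤ C := by
    intro K hK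
    -- The indicator of a closed set is the pointwise limit of its continuous thickened indicators.
    obtain ⟨δ, -, hpos, hlim⟩ := exists_seq_strictAnti_tendsto (0 : ℝ)
    have key : ∀ ρ : Measure ℝ, IsFiniteMeasure ρ →
        Tendsto (fun n => ∫ x, (thickenedIndicator (hpos n) K x : ℝ) ∂ρ) atTop
          (𝓝 (ρ.real K)) := by
      intro ρ _
      have := tendsto_integral_of_dominated_convergence (μ := ρ)
        (F := fun n x => (thickenedIndicator (hpos n) K x : ℝ))
        (f := fun x => K.indicator (fun _ => (1 : ℝ)) x) (fun _ => 1)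
        (fun n => by
          have : Continuous fun x => ((thickenedIndicator (hpos n) K x : NNReal) : ℝ) := by
            fun_prop
          exact this.aestronglyMeasurable) (integrable_const _)
        (fun n => Eventually.of_forall fun x => by
          simpa using thickenedIndicator_le_one (hpos n) K x)
        (Eventually.of_forall fun x => by
          have h1 := (tendsto_pi_nhds.mp
            (thickenedIndicator_tendsto_indicator_closure (fun n => (hpos n)) hlim K)) x
          rw [hK.closure_eq] at h1
          have h2 := (NNReal.continuous_coe.tendsto _).comp h1
          refine h2.congr' ?_ |>.trans ?_
          · exact Eventually.of_forall fun n => rfl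
          · by_cases hx : x ∈ K <;> simp [hx])
      rwa [integral_indicator_const _ hK.measurableSet, smul_eq_mul, mul_one] at this
    refine le_of_tendsto ((key μ inferInstance).sub (key ν inferInstance)).abs
      (Eventually.of_forall fun n => hC _ ?_ ?_ ?_)
    · fun_prop
    · exact fun x => NNReal.coe_nonneg _
    · exact fun x => by exact_mod_cast thickenedIndicator_le_one (hpos n) K x
  refine iSup₂_le fun A hA => ENNReal.ofReal_le_ofReal ?_
  refine le_of_forall_pos_le_add fun ε hε => ?_
  -- Regularity is applied to `μ + ν` so that one closed set approximates `A` for both measures.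
  obtain ⟨K, hKA, hK, hlt⟩ := hA.exists_isClosed_sdiff_lt (μ := μ + ν) (ε := ENNReal.ofReal ε)
    (measure_ne_top _ _) (by simpa using hε)
  have hr : (μ + ν).real (A \ K) ≤ ε := by
    rw [measureReal_def]
    exact ENNReal.toReal_le_of_le_ofReal hε.le hlt.le
  rw [measureReal_add_apply] at hr
  have eμ := measureReal_sdiff_add_inter (μ := μ) (s := A) hK.measurableSet
  have eν := measureReal_sdiff_add_inter (μ := ν) (s := A) hK.measurableSet
  rw [Set.inter_eq_right.mpr hKA] at eμ eν
  have := closed_le K hK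
  have p1 : 0 ≤ μ.real (A \ K) := measureReal_nonneg
  have p2 : 0 ≤ ν.real (A \ K) := measureReal_nonneg
  rw [abs_le] at this ⊢
  constructor <;> linarith

end UniformMalliavin

namespace UniformMalliavin

/-! ### Stein's equation for smooth Lipschitz test functions -/

theorem integrable_id_gaussianReal : Integrable (fun z : ℝ => z) (gaussianReal 0 1) :=
  (memLp_id_gaussianReal' 1 (by simp)).integrable le_rfl

theorem integral_abs_gaussianReal_le_one : ∫ z, |z| ∂(gaussianReal 0 1) ≤ 1 := by
  have h1 : MemLp (fun z : ℝ => z) 2 (gaussianReal 0 1) := memLp_id_gaussianReal' 2 (by simp)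
  have h2 := variance_fun_id_gaussianReal (μ := 0) (v := 1)
  rw [variance_of_integral_eq_zero (by fun_prop) (by simp)] at h2
  have h3 : ∫ z, |z| ∂(gaussianReal 0 1) ≤ ∫ z, (z ^ 2 + 1) / 2 ∂(gaussianReal 0 1) := by
    refine integral_mono integrable_id_gaussianReal.abs
      ((h1.integrable_sq.add (integrable_const _)).div_const _) fun z => ?_
    nlinarith [sq_nonneg (|z| - 1), sq_abs z]
  rw [integral_div, integral_add h1.integrable_sq (integrable_const _), h2] at h3
  simpa using h3

/-- Gaussian integration by parts. -/
theorem integral_deriv_gaussianReal {k k' : ℝ → ℝ} (hk : ∀ x, HasDerivAt k (k' x) x)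
    (hk' : Continuous k') {A B : ℝ} (hA : ∀ x, |k x| ≤ A) (hB : ∀ x, |k' x| ≤ B) :
    ∫ z, k' z ∂(gaussianReal 0 1) = ∫ z, z * k z ∂(gaussianReal 0 1) := by
  have hkc : Continuous k := continuous_iff_continuousAt.mpr fun x => (hk x).continuousAt
  have i1 : Integrable (fun z => k' z * Real.exp (-z ^ 2 / 2)) :=
    integrable_gauss_weight.bdd_mul hk'.aestronglyMeasurable (Eventually.of_forall hB)
  have i2 : Integrable (fun z => k z * (z * Real.exp (-z ^ 2 / 2))) :=
    integrable_id_mul_gauss_weight.bdd_mul hkc.aestronglyMeasurable (Eventually.of_forall hA)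
  have i3 : Integrable (fun z => k z * -Real.exp (-z ^ 2 / 2)) :=
    integrable_gauss_weight.neg.bdd_mul hkc.aestronglyMeasurable (Eventually.of_forall hA)
  have key := integral_mul_deriv_eq_deriv_mul_of_integrable (u := k)
    (v := fun t : ℝ => -Real.exp (-t ^ 2 / 2)) (fun x _ => hk x)
    (fun x _ => hasDerivAt_neg_gauss_weight x) i2
    (i1.neg.congr (Eventually.of_forall fun z => by simp)) i3
  rw [integral_gaussianReal_eq, integral_gaussianReal_eq]
  congr 1
  simp only [mul_neg, integral_neg, neg_neg] at key
  rw [← key]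
  exact integral_congr_ae (Eventually.of_forall fun z => by ring)

/-- The Ornstein–Uhlenbeck representation of the solution, with `sin θ` in the role of `e^{-t}`:
`f(x) = -E ∫ cos θ h'(x sin θ + Z cos θ) dθ` over `(0, π/2]`. Gaussian integration by parts removes
`h''` from `f'`, leaving `|f'| ≤ E|Z| ∫ sin θ dθ ≤ 1`. The bound `B` only justifies differentiation
under the integral and the integration by parts. -/
theorem exists_stein_solution_of_deriv_le {h h' h'' : ℝ → ℝ} (hd : ∀ x, HasDerivAt h (h' x) x)
    (hd' : ∀ x, HasDerivAt h' (h'' x) x) (hc : Continuous h'') (h1 : ∀ x, |h' x| ≤ 1)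
    {B : ℝ} (hB : ∀ x, |h'' x| ≤ B) :
    ∃ f f' : ℝ → ℝ, (∀ x, HasDerivAt f (f' x) x) ∧ Continuous f' ∧ (∀ x, |f' x| ≤ 1) ∧
      ∀ x, f' x - x * f x = h x - ∫ y, h y ∂(gaussianReal 0 1) := by
  have hhc : Continuous h := continuous_iff_continuousAt.mpr fun x => (hd x).continuousAt
  have hc' : Continuous h' := continuous_iff_continuousAt.mpr fun x => (hd' x).continuousAt
  set γ := gaussianReal 0 1 with hγ
  set τ : Measure ℝ := volume.restrict (Set.Ioc 0 (Real.pi / 2)) with hτ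
  set μ := γ.prod τ with hμ
  have hB0 : 0 ≤ B := (abs_nonneg _).trans (hB 0)
  have hsin : ∀ᵐ θ ∂τ, 0 ≤ Real.sin θ := by
    filter_upwards [ae_restrict_mem measurableSet_Ioc] with θ hθ
    exact Real.sin_nonneg_of_nonneg_of_le_pi hθ.1.le (by linarith [hθ.2, Real.pi_pos])
  have trig : ∀ θ, |Real.cos θ| ≤ 1 ∧ |Real.sin θ| ≤ 1 := fun θ =>
    ⟨Real.abs_cos_le_one θ, Real.abs_sin_le_one θ⟩
  have hz : Integrable (fun p : ℝ × ℝ => |p.1|) μ := by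
    have := (integrable_id_gaussianReal.abs).mul_prod (integrable_const (μ := τ) (1 : ℝ))
    simpa using this
  have bdd1 : ∀ (x : ℝ) (p : ℝ × ℝ),
      |Real.cos p.2 * h' (x * Real.sin p.2 + p.1 * Real.cos p.2)| ≤ 1 := fun x p => by
    rw [abs_mul]; exact mul_le_one₀ (trig _).1 (abs_nonneg _) (h1 _)
  have bdd2 : ∀ (x : ℝ) (p : ℝ × ℝ), |Real.cos p.2 *
      (h'' (x * Real.sin p.2 + p.1 * Real.cos p.2) * Real.sin p.2)| ≤ B := fun x p => by
    rw [abs_mul, abs_mul]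
    have := mul_le_mul (hB (x * Real.sin p.2 + p.1 * Real.cos p.2)) (trig p.2).2
      (abs_nonneg _) hB0
    nlinarith [(trig p.2).1, abs_nonneg (Real.cos p.2),
      mul_nonneg (abs_nonneg (h'' (x * Real.sin p.2 + p.1 * Real.cos p.2)))
        (abs_nonneg (Real.sin p.2))]
  have I1 : ∀ x, Integrable (fun p : ℝ × ℝ =>
      Real.cos p.2 * h' (x * Real.sin p.2 + p.1 * Real.cos p.2)) μ := fun x =>
    Integrable.of_bound (by fun_prop) 1 (Eventually.of_forall (bdd1 x))
  have I2 : ∀ x, Integrable (fun p : ℝ × ℝ => Real.cos p.2 *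
      (h'' (x * Real.sin p.2 + p.1 * Real.cos p.2) * Real.sin p.2)) μ := fun x =>
    Integrable.of_bound (by fun_prop) B (Eventually.of_forall (bdd2 x))
  have I3 : ∀ x, Integrable (fun p : ℝ × ℝ =>
      Real.sin p.2 * (p.1 * h' (x * Real.sin p.2 + p.1 * Real.cos p.2))) μ := fun x => by
    refine hz.mono' (by fun_prop) (Eventually.of_forall fun p => ?_)
    rw [Real.norm_eq_abs, abs_mul, abs_mul]
    have := mul_le_mul_of_nonneg_left (h1 (x * Real.sin p.2 + p.1 * Real.cos p.2))
      (abs_nonneg p.1)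
    nlinarith [(trig p.2).2, abs_nonneg (Real.sin p.2), abs_nonneg p.1,
      mul_nonneg (abs_nonneg p.1) (abs_nonneg (h' (x * Real.sin p.2 + p.1 * Real.cos p.2)))]
  set f : ℝ → ℝ := fun x =>
    -∫ p : ℝ × ℝ, Real.cos p.2 * h' (x * Real.sin p.2 + p.1 * Real.cos p.2) ∂μ with hf
  set f' : ℝ → ℝ := fun x => -∫ p : ℝ × ℝ,
    Real.sin p.2 * (p.1 * h' (x * Real.sin p.2 + p.1 * Real.cos p.2)) ∂μ with hf'
  have hder : ∀ x, HasDerivAt f (f' x) x := by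
    intro x
    have e := (hasDerivAt_integral_of_dominated_loc_of_deriv_le (μ := μ) (x₀ := x)
      (s := Set.univ) (bound := fun _ => B) univ_mem
      (F := fun x p => Real.cos p.2 * h' (x * Real.sin p.2 + p.1 * Real.cos p.2))
      (F' := fun x p => Real.cos p.2 *
        (h'' (x * Real.sin p.2 + p.1 * Real.cos p.2) * Real.sin p.2))
      (Eventually.of_forall fun y => (I1 y).1) (I1 x) (I2 x).1
      (Eventually.of_forall fun p y _ => bdd2 y p) (integrable_const _)
      (Eventually.of_forall fun p y _ => by
        have i : HasDerivAt (fun y => y * Real.sin p.2 + p.1 * Real.cos p.2)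
            (Real.sin p.2) y :=
          (((hasDerivAt_id y).mul_const _).add_const _).congr_deriv (by simp)
        exact ((hd' _).comp y i).const_mul _)).2.fun_neg
    refine e.congr_deriv ?_
    rw [hf']
    simp only
    rw [integral_prod_symm _ (I2 x), integral_prod_symm _ (I3 x)]
    congr 1
    refine integral_congr_ae (Eventually.of_forall fun θ => ?_)
    simp only
    -- For fixed `θ`, a factor `cos θ` and one derivative on `h'` are traded for a factor `z`.
    have ibp := integral_deriv_gaussianReal
      (k := fun z => h' (x * Real.sin θ + z * Real.cos θ))
      (k' := fun z => h'' (x * Real.sin θ + z * Real.cos θ) * Real.cos θ) (A := 1) (B := B)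
      (fun z => by
        have i : HasDerivAt (fun z => x * Real.sin θ + z * Real.cos θ) (Real.cos θ) z :=
          (((hasDerivAt_id z).mul_const _).const_add _).congr_deriv (by simp)
        exact (hd' _).comp z i) (by fun_prop) (fun z => h1 _) (fun z => by
        rw [abs_mul]
        have := hB (x * Real.sin θ + z * Real.cos θ)
        nlinarith [(trig θ).1, abs_nonneg (Real.cos θ),
          abs_nonneg (h'' (x * Real.sin θ + z * Real.cos θ))])
    rw [integral_const_mul (Real.sin θ), ← ibp, ← integral_const_mul]
    exact integral_congr_ae (Eventually.of_forall fun z => by simp only; ring)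
  have hfc : Continuous f := continuous_iff_continuousAt.mpr fun x => (hder x).continuousAt
  have hstein : ∀ x, f' x - x * f x = h x - ∫ y, h y ∂γ := by
    intro x
    have hhi : Integrable h γ := by
      refine (((integrable_const |h 0|).add integrable_id_gaussianReal.abs)).mono'
        hhc.aestronglyMeasurable (Eventually.of_forall fun z => ?_)
      have := Convex.norm_image_sub_le_of_norm_hasDerivWithin_le (f := h) (f' := h') (s := Set.univ)
        (C := 1) (x := 0) (y := z) (fun x _ => (hd x).hasDerivWithinAt) (fun x _ => h1 x)
        convex_univ trivial trivial
      simp only [Real.norm_eq_abs, sub_zero, one_mul] at this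
      have t := abs_add_le (h z - h 0) (h 0)
      rw [sub_add_cancel] at t
      simp only [Real.norm_eq_abs, Pi.add_apply]
      linarith
    have e1 : f' x - x * f x = ∫ p : ℝ × ℝ, (x * (Real.cos p.2 *
        h' (x * Real.sin p.2 + p.1 * Real.cos p.2)) - Real.sin p.2 *
          (p.1 * h' (x * Real.sin p.2 + p.1 * Real.cos p.2))) ∂μ := by
      rw [integral_sub ((I1 x).const_mul x) (I3 x), integral_const_mul]
      simp only [hf, hf']
      ring
    have I4 : Integrable (fun p : ℝ × ℝ => x * (Real.cos p.2 *
        h' (x * Real.sin p.2 + p.1 * Real.cos p.2)) - Real.sin p.2 *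
          (p.1 * h' (x * Real.sin p.2 + p.1 * Real.cos p.2))) μ :=
      ((I1 x).const_mul x).sub (I3 x)
    rw [e1, integral_prod _ I4]
    -- The integrand is the `θ`-derivative of `h(x sin θ + z cos θ)`, which runs from `h z` at `0`
    -- to `h x` at `π/2`.
    have e2 : ∀ z : ℝ, ∫ θ, (x * (Real.cos θ *
        h' (x * Real.sin θ + z * Real.cos θ)) - Real.sin θ *
          (z * h' (x * Real.sin θ + z * Real.cos θ))) ∂τ = h x - h z := by
      intro z
      rw [hτ, ← intervalIntegral.integral_of_le (by positivity)]
      rw [intervalIntegral.integral_eq_sub_of_hasDerivAt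
        (f := fun θ => h (x * Real.sin θ + z * Real.cos θ))]
      · simp
      · intro θ _
        have i : HasDerivAt (fun θ => x * Real.sin θ + z * Real.cos θ)
            (x * Real.cos θ + z * -Real.sin θ) θ :=
          ((Real.hasDerivAt_sin θ).const_mul x).add ((Real.hasDerivAt_cos θ).const_mul z)
        refine ((hd _).comp θ i).congr_deriv ?_
        ring
      · exact Continuous.intervalIntegrable (by fun_prop) _ _
    simp only [e2]
    rw [integral_sub (integrable_const _) hhi]
    simp [hγ]
  refine ⟨f, f', hder, ?_, fun x => ?_, hstein⟩
  -- Continuity of `f'` is read off from the Stein equation itself.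
  · have : f' = fun x => x * f x + (h x - ∫ y, h y ∂γ) := by
      funext x; linarith [hstein x]
    rw [this]
    fun_prop
  · simp only [hf', abs_neg]
    rw [← Real.norm_eq_abs]
    have i1 : Integrable (fun p : ℝ × ℝ => |p.1| * Real.sin p.2) μ :=
      (integrable_id_gaussianReal.abs).mul_prod
        ((Real.continuous_sin.intervalIntegrable 0 (Real.pi / 2)).1)
    refine (norm_integral_le_of_norm_le i1 ?_).trans ?_
    · have : ∀ᵐ p ∂μ, 0 ≤ Real.sin p.2 := Measure.quasiMeasurePreserving_snd.ae hsin
      filter_upwards [this] with p hp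
      rw [Real.norm_eq_abs, abs_mul, abs_mul, abs_of_nonneg hp]
      have := mul_le_mul_of_nonneg_left (h1 (x * Real.sin p.2 + p.1 * Real.cos p.2))
        (abs_nonneg p.1)
      nlinarith
    · rw [integral_prod_mul (fun z : ℝ => |z|) Real.sin]
      have : ∫ θ, Real.sin θ ∂τ = 1 := by
        rw [hτ, ← intervalIntegral.integral_of_le (by positivity), integral_sin]
        simp
      rw [this, mul_one]
      exact integral_abs_gaussianReal_le_one

/-- A `1`-Lipschitz function is uniformly close to `C²` functions with derivative bounded by `1`
and bounded second derivative. -/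
theorem exists_smooth_approx_of_lipschitz {h : ℝ → ℝ} (hh : LipschitzWith 1 h) {ε : ℝ}
    (hε : 0 < ε) :
    ∃ g g' g'' : ℝ → ℝ, ∃ B : ℝ, (∀ x, HasDerivAt g (g' x) x) ∧ (∀ x, HasDerivAt g' (g'' x) x) ∧
      Continuous g'' ∧ (∀ x, |g' x| ≤ 1) ∧ (∀ x, |g'' x| ≤ B) ∧ ∀ x, |g x - h x| ≤ 2 * ε := by
  -- Averaging over `[x, x + ε]` gains one derivative, namely the difference quotient, keeps the
  -- Lipschitz constant and moves the function by at most `ε`. Doing it twice gives a `C²` function.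
  have step : ∀ k : ℝ → ℝ, LipschitzWith 1 k → ∃ g : ℝ → ℝ,
      (∀ x, HasDerivAt g ((k (x + ε) - k x) / ε) x) ∧ LipschitzWith 1 g ∧
        ∀ x, |g x - k x| ≤ ε := by
    intro k hk
    have hkc := hk.continuous
    have hk1 : ∀ x y, |k x - k y| ≤ |x - y| := fun x y => by
      simpa [Real.dist_eq] using hk.dist_le_mul x y
    have hder : ∀ x, HasDerivAt (fun x => (∫ t in x..x + ε, k t) / ε)
        ((k (x + ε) - k x) / ε) x := by
      intro x
      have e : (fun x => ∫ t in x..x + ε, k t)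
          = fun x => (∫ t in (0 : ℝ)..x + ε, k t) - ∫ t in (0 : ℝ)..x, k t := by
        funext y
        rw [intervalIntegral.integral_interval_sub_left] <;>
          exact hkc.intervalIntegrable _ _
      have p : ∀ y, HasDerivAt (fun y => ∫ t in (0 : ℝ)..y, k t) (k y) y := fun y =>
        intervalIntegral.integral_hasDerivAt_right (hkc.intervalIntegrable _ _)
          (hkc.stronglyMeasurableAtFilter _ _) hkc.continuousAt
      have := ((p (x + ε)).comp_add_const x ε).fun_sub (p x)
      rw [← e] at this
      exact this.div_const ε
    refine ⟨_, hder, ?_, fun x => ?_⟩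
    · refine lipschitzWith_of_nnnorm_deriv_le (fun x => (hder x).differentiableAt) fun x => ?_
      rw [(hder x).deriv]
      have := hk1 (x + ε) x
      rw [add_sub_cancel_left, abs_of_pos hε] at this
      rw [← NNReal.coe_le_coe]
      simp only [coe_nnnorm, Real.norm_eq_abs, NNReal.coe_one]
      rw [abs_div, abs_of_pos hε, div_le_one hε]
      exact this
    · have e : (∫ t in x..x + ε, k t) / ε - k x = (∫ t in x..x + ε, (k t - k x)) / ε := by
        rw [intervalIntegral.integral_sub (hkc.intervalIntegrable _ _) (by simp)]
        simp
        field_simp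
      rw [e, abs_div, abs_of_pos hε, div_le_iff₀ hε]
      have := intervalIntegral.norm_integral_le_of_norm_le_const (a := x) (b := x + ε) (C := ε)
        (f := fun t => k t - k x) (fun t ht => by
          rw [Set.uIoc_of_le (by linarith)] at ht
          refine (hk1 t x).trans ?_
          rw [abs_of_pos (by linarith [ht.1])]
          linarith [ht.2])
      rwa [add_sub_cancel_left, abs_of_pos hε, Real.norm_eq_abs] at this
  obtain ⟨k, hk, hkl, hkh⟩ := step h hh
  obtain ⟨g, hg, hgl, hgk⟩ := step k hkl
  have hhc := hh.continuous
  have bd : ∀ k : ℝ → ℝ, LipschitzWith 1 k → ∀ x, |(k (x + ε) - k x) / ε| ≤ 1 := by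
    intro k hk x
    have := hk.dist_le_mul (x + ε) x
    simp only [Real.dist_eq, NNReal.coe_one, one_mul, add_sub_cancel_left, abs_of_pos hε] at this
    rwa [abs_div, abs_of_pos hε, div_le_one hε]
  refine ⟨g, _, fun x => ((h (x + ε + ε) - h (x + ε)) / ε - (h (x + ε) - h x) / ε) / ε, 2 / ε,
    hg, fun x => ?_, by fun_prop, bd k hkl, fun x => ?_, fun x => ?_⟩
  · exact (((hk (x + ε)).comp_add_const x ε).fun_sub (hk x)).div_const ε
  · rw [abs_div, abs_of_pos hε]
    gcongr
    refine (abs_sub _ _).trans ?_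
    linarith [bd h hh x, bd h hh (x + ε)]
  · have := abs_add_le (g x - k x) (k x - h x)
    rw [sub_add_sub_cancel] at this
    linarith [hgk x, hkh x]

end UniformMalliavin

namespace UniformMalliavin

/-! ### Stein's equation for the gamma law -/

theorem integral_gammaMeasure_one {r : ℝ} (hr : 0 < r) (h : ℝ → ℝ) :
    ∫ x, h x ∂(gammaMeasure r 1) =
      (Real.Gamma r)⁻¹ * ∫ x in Set.Ioi 0, h x * (Real.exp (-x) * x ^ (r - 1)) := by
  rw [gammaMeasure, integral_withDensity_eq_integral_toReal_smul (by
      exact (measurable_gammaPDFReal r 1).ennreal_ofReal)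
    (Eventually.of_forall fun x => by simp [gammaPDF]), ← integral_const_mul]
  rw [← integral_indicator measurableSet_Ioi]
  have : ∀ᵐ x : ℝ, x ≠ 0 := by simp [ae_iff]
  refine integral_congr_ae ?_
  filter_upwards [this] with x hx0
  rcases lt_or_gt_of_ne hx0 with hx | hx
  · rw [Set.indicator_of_notMem (by simp [hx.le]), gammaPDF_of_neg hx]
    simp
  · rw [Set.indicator_of_mem (by simpa using hx), gammaPDF_of_nonneg hx.le,
      ENNReal.toReal_ofReal]
    · simp; ring
    · have := Real.Gamma_pos_of_pos hr
      positivity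

/-- If the second derivative were positive, `y` would also be a local minimum; then `ψ` would be
locally constant and its second derivative zero. -/
theorem nonpos_of_isMax_of_hasDerivAt {ψ ψ' : ℝ → ℝ} {ψ'' y : ℝ} (hmax : IsLocalMax ψ y)
    (h1 : ∀ᶠ x in 𝓝 y, HasDerivAt ψ (ψ' x) x) (h2 : HasDerivAt ψ' ψ'' y) : ψ'' ≤ 0 := by
  by_contra! hpos
  have e1 : deriv ψ =ᶠ[𝓝 y] ψ' := h1.mono fun x hx => hx.deriv
  have e2 : deriv (deriv ψ) y = ψ'' := by rw [e1.deriv_eq, h2.deriv]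
  have hmin := isLocalMin_of_deriv_deriv_pos (f := ψ) (x₀ := y) (by rw [e2]; exact hpos)
    hmax.deriv_eq_zero h1.self_of_nhds.continuousAt
  have hconst : ψ =ᶠ[𝓝 y] fun _ => ψ y := by
    filter_upwards [hmax, hmin] with x a b using le_antisymm a b
  have e3 : deriv ψ =ᶠ[𝓝 y] fun _ => 0 := by
    refine hconst.deriv.trans ?_
    simp
  rw [e3.deriv_eq] at e2
  simp at e2
  linarith

/-- A maximum principle for `x χ'' + (r + 2 - x) χ' - 2 χ` on the half line. -/
theorem le_of_gamma_generator {r M : ℝ} (hr : 0 < r) (hM : 0 ≤ M) {χ χ' χ'' : ℝ → ℝ}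
    (h1 : ∀ x, 0 < x → HasDerivAt χ (χ' x) x) (h2 : ∀ x, 0 < x → HasDerivAt χ' (χ'' x) x)
    (heq : ∀ x, 0 < x → -M ≤ x * χ'' x + (r + 2 - x) * χ' x - 2 * χ x)
    (hzero : Tendsto (fun x => x * χ x) (𝓝[>] 0) (𝓝 0)) (htop : Tendsto χ atTop (𝓝 0)) :
    ∀ x, 0 < x → χ x ≤ M / 2 := by
  -- The barrier `ε (x + 1/x)` forces an interior maximum: `ε/x` beats `χ = o(1/x)` at the origin,
  -- and `ε x` beats `χ → 0` at infinity. Then `ε` tends to zero.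
  have key : ∀ ε : ℝ, 0 < ε → ∀ x, 0 < x →
      χ x - ε * (x + x⁻¹) ≤ M / 2 + ε * (r + 2) / 2 := by
    intro ε hε x₀ hx₀
    by_contra! hc
    set ψ : ℝ → ℝ := fun x => χ x - ε * (x + x⁻¹) with hψ
    have hc0 : 0 < ψ x₀ := lt_of_le_of_lt (by positivity) hc
    have n1 : ∀ᶠ x in 𝓝[>] (0 : ℝ), x * χ x < ε := hzero.eventually (gt_mem_nhds hε)
    have n2 : ∀ᶠ x in atTop, χ x < ε := htop.eventually (gt_mem_nhds hε)
    obtain ⟨a, ha, haI⟩ := mem_nhdsGT_iff_exists_Ioo_subset.mp n1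
    obtain ⟨b, hb⟩ := eventually_atTop.mp n2
    have ha0 : (0 : ℝ) < a := ha
    have out1 : ∀ x, 0 < x → x < a → ψ x ≤ 0 := fun x hx hxa => by
      have : x * χ x < ε := haI ⟨hx, hxa⟩
      have e : χ x < ε * x⁻¹ := by
        rw [← div_eq_mul_inv, lt_div_iff₀ hx]; linarith
      simp only [hψ]
      nlinarith [mul_pos hε hx]
    have out2 : ∀ x, 1 ≤ x → b ≤ x → ψ x ≤ 0 := fun x hx hxb => by
      have := hb x hxb
      have : 0 < x⁻¹ := by positivity
      simp only [hψ]
      nlinarith [mul_pos hε this]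
    have hder : ∀ x, 0 < x → HasDerivAt ψ (χ' x - ε * (1 + -(x ^ 2)⁻¹)) x := fun x hx =>
      (h1 x hx).fun_sub (((hasDerivAt_id x).fun_add (hasDerivAt_inv hx.ne')).const_mul ε)
    have hder2 : ∀ x, 0 < x → HasDerivAt (fun x => χ' x - ε * (1 + -(x ^ 2)⁻¹))
        (χ'' x - ε * (2 / x ^ 3)) x := fun x hx => by
      have i1 : HasDerivAt (fun x : ℝ => (x ^ 2)⁻¹) (-(2 / x ^ 3)) x :=
        ((hasDerivAt_pow 2 x).fun_inv (by positivity)).congr_deriv (by field_simp; norm_num [mul_comm])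
      exact ((h2 x hx).fun_sub ((i1.fun_neg.const_add 1).const_mul ε)).congr_deriv (by ring)
    set A := min (a / 2) x₀
    set B := max (max b 1) x₀
    have hA0 : 0 < A := by positivity
    have hx0mem : x₀ ∈ Set.Icc A B := ⟨min_le_right _ _, le_max_right _ _⟩
    obtain ⟨y, hy, hmax⟩ := (isCompact_Icc (a := A) (b := B)).exists_isMaxOn ⟨x₀, hx0mem⟩
      (fun x hx => (hder x (hA0.trans_le hx.1)).continuousAt.continuousWithinAt)
    have hy0 : 0 < y := hA0.trans_le hy.1
    have hyx : ψ x₀ ≤ ψ y := hmax hx0mem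
    have hglob : ∀ x, 0 < x → ψ x ≤ ψ y := fun x hx => by
      by_cases hxA : x < A
      · have : A ≤ a / 2 := min_le_left _ _
        linarith [out1 x hx (by linarith)]
      by_cases hxB : B < x
      · have : max b 1 ≤ B := le_max_left _ _
        linarith [out2 x (by linarith [le_max_right b 1]) (by linarith [le_max_left b 1])]
      exact hmax ⟨not_lt.mp hxA, not_lt.mp hxB⟩
    have hloc : IsLocalMax ψ y := by
      filter_upwards [lt_mem_nhds hy0] with x hx using hglob x hx
    have d1 := hloc.hasDerivAt_eq_zero (hder y hy0)
    have d2 := nonpos_of_isMax_of_hasDerivAt hloc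
      ((lt_mem_nhds hy0).mono fun x hx => hder x hx) (hder2 y hy0)
    have e := heq y hy0
    have i1 : y * χ'' y ≤ ε * (2 / y ^ 2) := by
      have : y * (χ'' y - ε * (2 / y ^ 3)) ≤ 0 := mul_nonpos_of_nonneg_of_nonpos hy0.le d2
      have e3 : y * (ε * (2 / y ^ 3)) = ε * (2 / y ^ 2) := by field_simp
      linarith
    have i2 : χ' y = ε * (1 + -(y ^ 2)⁻¹) := by linarith
    have i3 : 2 * ψ y = 2 * χ y - 2 * ε * (y + y⁻¹) := by simp only [hψ]; ring
    -- Applied to the barrier, the operator gives `ε (r + 2)` minus a positive quantity, so the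
    -- barrier costs only `O(ε)`.
    have i4 : ε * (2 / y ^ 2) + (r + 2 - y) * (ε * (1 + -(y ^ 2)⁻¹)) - 2 * ε * (y + y⁻¹)
        = ε * (r + 2) - ε * (3 * y + r * (y ^ 2)⁻¹ + y⁻¹) := by
      field_simp
      ring
    have i5 : 0 ≤ ε * (3 * y + r * (y ^ 2)⁻¹ + y⁻¹) := by positivity
    rw [i2] at e
    linarith
  intro x hx
  have lim : Tendsto (fun ε : ℝ => M / 2 + ε * (r + 2) / 2 + ε * (x + x⁻¹)) (𝓝[>] 0)
      (𝓝 (M / 2)) := by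
    have : Continuous fun ε : ℝ => M / 2 + ε * (r + 2) / 2 + ε * (x + x⁻¹) := by fun_prop
    have := this.tendsto 0
    simp only [zero_mul, zero_div, add_zero] at this
    exact this.mono_left nhdsWithin_le_nhds
  refine ge_of_tendsto lim ?_
  filter_upwards [self_mem_nhdsWithin] with ε hε
  linarith [key ε hε x hx]

/-- With `w = e^{-x} x^{r-1}`, the solution is the integral of `(g - m) w` from `0` divided by `x
w`. Differentiating the equation twice shows that `χ = φ'` solves `x χ'' + (r + 2 - x) χ' - 2 χ =
g''`; the maximum principle for `χ` and `-χ` gives the bound `M / 2`. -/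
theorem exists_gamma_stein_solution {r : ℝ} (hr : 0 < r) {g g' g'' : ℝ → ℝ}
    (hg : ∀ x, HasDerivAt g (g' x) x) (hg' : ∀ x, HasDerivAt g' (g'' x) x)
    {M C : ℝ} (hC : ∀ x, |g x| ≤ C) (hM : ∀ x, |g'' x| ≤ M) :
    ∃ φ φ' : ℝ → ℝ, (∀ x, 0 < x → HasDerivAt φ (φ' x) x) ∧ ContinuousOn φ' (Set.Ioi 0) ∧
      (∀ x, 0 < x → |φ' x| ≤ M / 2) ∧
      ∀ x, 0 < x → x * φ' x + (r - x) * φ x = g x - ∫ y, g y ∂(gammaMeasure r 1) := by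
  have hM0 : 0 ≤ M := (abs_nonneg _).trans (hM 0)
  have hgc : Continuous g := continuous_iff_continuousAt.mpr fun x => (hg x).continuousAt
  set m := ∫ y, g y ∂(gammaMeasure r 1) with hm
  have := isProbabilityMeasure_gammaMeasure hr one_pos
  set w : ℝ → ℝ := fun x => Real.exp (-x) * x ^ (r - 1) with hw
  have hwi : IntegrableOn w (Set.Ioi 0) := Real.GammaIntegral_convergent hr
  set k : ℝ → ℝ := fun x => (g x - m) * w x with hk
  have hki : IntegrableOn k (Set.Ioi 0) := by
    refine Integrable.bdd_mul (c := C + |m|) hwi (by fun_prop) (Eventually.of_forall fun x => ?_)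
    exact (abs_sub _ _).trans (by linarith [hC x])
  have hwc : ∀ x, 0 < x → ContinuousAt w x := fun x hx => by
    have : ContinuousAt (fun x : ℝ => x ^ (r - 1)) x :=
      Real.continuousAt_rpow_const x (r - 1) (Or.inl hx.ne')
    exact ContinuousAt.mul (by fun_prop) this
  have hkc : ∀ x, 0 < x → ContinuousAt k x := fun x hx =>
    ContinuousAt.mul (by fun_prop) (hwc x hx)
  have hk0 : ∫ x in Set.Ioi 0, k x = 0 := by
    have e1 : ∫ y, (g y - m) ∂(gammaMeasure r 1) = 0 := by
      rw [integral_sub (Integrable.of_bound (by fun_prop) C (Eventually.of_forall hC))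
        (integrable_const _)]
      simp [hm]
    rw [integral_gammaMeasure_one hr] at e1
    exact (mul_eq_zero.mp e1).resolve_left (inv_ne_zero (Real.Gamma_pos_of_pos hr).ne')
  set F : ℝ → ℝ := fun x => ∫ t in (0 : ℝ)..x, k t with hF
  have hFd : ∀ x, 0 < x → HasDerivAt F (k x) x := fun x hx => by
    refine intervalIntegral.integral_hasDerivAt_right ?_ ?_ (hkc x hx)
    · rw [intervalIntegrable_iff_integrableOn_Ioc_of_le hx.le]
      exact hki.mono_set Set.Ioc_subset_Ioi_self
    · exact ContinuousAt.stronglyMeasurableAtFilter isOpen_Ioi hkc x hx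
  have hF0 : Tendsto F (𝓝[>] 0) (𝓝 0) := by
    have hcont : ContinuousOn F (Set.Icc 0 1) := by
      have h01 : IntegrableOn k (Set.uIcc 0 1) := by
        rw [Set.uIcc_of_le zero_le_one, integrableOn_Icc_iff_integrableOn_Ioc]
        exact hki.mono_set Set.Ioc_subset_Ioi_self
      have := intervalIntegral.continuousOn_primitive_interval h01
      rwa [Set.uIcc_of_le zero_le_one] at this
    have := hcont 0 (by simp)
    simp only [ContinuousWithinAt] at this
    have e : F 0 = 0 := by simp [hF]
    rw [e] at this
    exact this.mono_left (by
      rw [← nhdsWithin_Ioc_eq_nhdsGT zero_lt_one]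
      exact nhdsWithin_mono _ Set.Ioc_subset_Icc_self)
  have hFtop : Tendsto F atTop (𝓝 0) := by
    rw [← hk0]
    exact intervalIntegral_tendsto_integral_Ioi 0 hki tendsto_id
  set D : ℝ → ℝ := fun x => Real.exp (-x) * x ^ r with hD
  have hDpos : ∀ x, 0 < x → 0 < D x := fun x hx => by positivity
  have hDw : ∀ x, 0 < x → D x = x * w x := fun x hx => by
    simp only [hD, hw]
    rw [Real.rpow_sub_one hx.ne']
    field_simp
  have hDd : ∀ x, 0 < x → HasDerivAt D ((r - x) * w x) x := fun x hx => by
    have i1 : HasDerivAt (fun x : ℝ => Real.exp (-x)) (-Real.exp (-x)) x :=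
      (hasDerivAt_neg x).exp.congr_deriv (by ring)
    refine (i1.fun_mul (Real.hasDerivAt_rpow_const (p := r) (Or.inl hx.ne'))).congr_deriv ?_
    have := hDw x hx
    simp only [hD, hw] at this ⊢
    linear_combination -this
  have hwpos : ∀ x, 0 < x → 0 < w x := fun x hx => by positivity
  have hD0 : Tendsto D (𝓝[>] 0) (𝓝 0) := by
    have i1 : Tendsto (fun x : ℝ => x ^ r) (𝓝 0) (𝓝 0) := by
      have := (Real.continuousAt_rpow_const 0 r (Or.inr hr.le)).tendsto
      rwa [Real.zero_rpow hr.ne'] at this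
    have i2 : Tendsto (fun x : ℝ => Real.exp (-x)) (𝓝 0) (𝓝 1) := by
      have : Continuous fun x : ℝ => Real.exp (-x) := by fun_prop
      simpa using this.tendsto 0
    simpa using (i2.mul i1).mono_left nhdsWithin_le_nhds
  have hDtop : Tendsto D atTop (𝓝 0) := by
    refine (tendsto_rpow_mul_exp_neg_mul_atTop_nhds_zero r 1 one_pos).congr fun x => ?_
    simp only [hD, neg_mul, one_mul]
    ring
  set φ : ℝ → ℝ := fun x => F x / D x with hφ
  have hratio : ∀ x, 0 < x → k x / ((r - x) * w x) = (g x - m) / (r - x) := fun x hx => by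
    simp only [hk]
    exact mul_div_mul_right _ _ (hwpos x hx).ne'
  -- Numerator and denominator both vanish at `0`, and their derivatives have quotient `(g - m) / (r
  -- - x)`. The same quotient gives the limit `0` at infinity.
  have hφ0 : Tendsto φ (𝓝[>] 0) (𝓝 ((g 0 - m) / r)) := by
    have hlt : ∀ᶠ x in 𝓝[>] (0 : ℝ), x < r := nhdsWithin_le_nhds (gt_mem_nhds hr)
    refine HasDerivAt.lhopital_zero_nhdsGT (f' := k) (g' := fun x => (r - x) * w x) ?_ ?_ ?_
      hF0 hD0 ?_
    · filter_upwards [self_mem_nhdsWithin] with x hx using hFd x hx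
    · filter_upwards [self_mem_nhdsWithin] with x hx using hDd x hx
    · filter_upwards [self_mem_nhdsWithin, hlt] with x hx hxr
      exact mul_ne_zero (by linarith) (hwpos x hx).ne'
    · have : Tendsto (fun x => (g x - m) / (r - x)) (𝓝[>] 0) (𝓝 ((g 0 - m) / (r - 0))) := by
        refine Tendsto.mono_left ?_ nhdsWithin_le_nhds
        refine Tendsto.div ?_ ?_ (by simpa using hr.ne')
        · exact (Continuous.tendsto (by fun_prop) 0)
        · exact (Continuous.tendsto (by fun_prop) 0)
      rw [sub_zero] at this
      refine this.congr' ?_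
      filter_upwards [self_mem_nhdsWithin] with x hx using (hratio x hx).symm
  have hbdd : ∀ x, |g x - m| ≤ C + |m| := fun x => (abs_sub _ _).trans (by linarith [hC x])
  have hdivtop : ∀ u : ℝ → ℝ, Tendsto u atTop atTop →
      Tendsto (fun x => (g x - m) / u x) atTop (𝓝 0) := fun u hu => by
    simp only [div_eq_mul_inv]
    refine bdd_le_mul_tendsto_zero' (C + |m|) (Eventually.of_forall fun x => hbdd x)
      (tendsto_inv_atTop_zero.comp hu)
  have hφtop : Tendsto φ atTop (𝓝 0) := by
    have hlt : ∀ᶠ x in atTop, r < x := eventually_gt_atTop r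
    have hgt : ∀ᶠ x in atTop, (0 : ℝ) < x := eventually_gt_atTop 0
    refine HasDerivAt.lhopital_zero_atTop (f' := k) (g' := fun x => (r - x) * w x) ?_ ?_ ?_
      hFtop hDtop ?_
    · filter_upwards [hgt] with x hx using hFd x hx
    · filter_upwards [hgt] with x hx using hDd x hx
    · filter_upwards [hgt, hlt] with x hx hxr
      exact mul_ne_zero (by linarith) (hwpos x hx).ne'
    · have := (hdivtop (fun x => x - r) (tendsto_atTop_add_const_right _ _ tendsto_id)).neg
      rw [neg_zero] at this
      refine this.congr' ?_
      filter_upwards [hgt] with x hx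
      rw [hratio x hx, ← neg_sub x r, div_neg]
  set χ : ℝ → ℝ := fun x => (g x - m - (r - x) * φ x) / x with hχ
  have hφd : ∀ x, 0 < x → HasDerivAt φ (χ x) x := fun x hx => by
    refine ((hFd x hx).fun_div (hDd x hx) (hDpos x hx).ne').congr_deriv ?_
    simp only [hχ, hφ, hk]
    have h1 := (hwpos x hx).ne'
    rw [hDw x hx]
    field_simp
  set χ' : ℝ → ℝ := fun x => (g' x + φ x - (r + 1 - x) * χ x) / x with hχ'
  have hχd : ∀ x, 0 < x → HasDerivAt χ (χ' x) x := fun x hx => by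
    have i1 : HasDerivAt (fun x : ℝ => r - x) (-1) x := (hasDerivAt_id x).const_sub r
    refine ((((hg x).sub_const m).fun_sub (i1.fun_mul (hφd x hx))).fun_div
      (hasDerivAt_id x) hx.ne').congr_deriv ?_
    have e : χ x * x = g x - m - (r - x) * φ x := by simp only [hχ]; field_simp
    simp only [hχ', id, ← e]
    field_simp
    ring
  set χ'' : ℝ → ℝ := fun x => (g'' x + 2 * χ x - (r + 2 - x) * χ' x) / x with hχ''
  have hχd' : ∀ x, 0 < x → HasDerivAt χ' (χ'' x) x := fun x hx => by
    have i1 : HasDerivAt (fun x : ℝ => r + 1 - x) (-1) x := (hasDerivAt_id x).const_sub (r + 1)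
    refine ((((hg' x).fun_add (hφd x hx)).fun_sub (i1.fun_mul (hχd x hx))).fun_div
      (hasDerivAt_id x) hx.ne').congr_deriv ?_
    have e : χ' x * x = g' x + φ x - (r + 1 - x) * χ x := by simp only [hχ']; field_simp
    simp only [hχ'', id, ← e]
    field_simp
    ring
  -- The limit `(g 0 - m) / r` of `φ` is exactly the value at which `g - m - (r - x) φ` vanishes at
  -- the origin, which rules out a singularity of order `1/x` in `χ`.
  have hchi0 : Tendsto (fun x => x * χ x) (𝓝[>] 0) (𝓝 0) := by
    have i1 : Tendsto (fun x => g x - m) (𝓝[>] 0) (𝓝 (g 0 - m)) :=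
      (Continuous.tendsto (by fun_prop) 0).mono_left nhdsWithin_le_nhds
    have i2 : Tendsto (fun x => r - x) (𝓝[>] 0) (𝓝 (r - 0)) :=
      (Continuous.tendsto (by fun_prop) 0).mono_left nhdsWithin_le_nhds
    have := i1.sub (i2.mul hφ0)
    rw [show g 0 - m - (r - 0) * ((g 0 - m) / r) = 0 by field_simp; ring] at this
    refine this.congr' ?_
    filter_upwards [self_mem_nhdsWithin] with x hx
    have : x ≠ 0 := ne_of_gt hx
    simp only [hχ]
    field_simp
  have hchitop : Tendsto χ atTop (𝓝 0) := by
    have i1 := hdivtop id tendsto_id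
    have i2 := (tendsto_inv_atTop_zero (𝕜 := ℝ)).const_mul r
    have := (i1.sub (i2.mul hφtop)).add hφtop
    simp only [mul_zero, sub_zero, add_zero] at this
    refine this.congr' ?_
    filter_upwards [eventually_gt_atTop 0] with x hx
    simp only [hχ, id]
    field_simp
    ring
  have hgen : ∀ x, 0 < x → x * χ'' x + (r + 2 - x) * χ' x - 2 * χ x = g'' x := fun x hx => by
    simp only [hχ'']
    field_simp
    ring
  refine ⟨φ, χ, hφd, fun x hx => (hχd x hx).continuousAt.continuousWithinAt, fun x hx => ?_,
    fun x hx => ?_⟩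
  · rw [abs_le']
    constructor
    · exact le_of_gamma_generator hr hM0 hχd hχd'
        (fun y hy => by rw [hgen y hy]; exact (abs_le.mp (hM y)).1) hchi0 hchitop x hx
    · refine le_of_gamma_generator (χ := fun x => -χ x) (χ' := fun x => -χ' x)
        (χ'' := fun x => -χ'' x) hr hM0 (fun y hy => (hχd y hy).fun_neg)
        (fun y hy => (hχd' y hy).fun_neg) (fun y hy => ?_) ?_ ?_ x hx
      · have := hgen y hy
        linarith [(abs_le.mp (hM y)).2]
      · simpa using hchi0.neg
      · simpa using hchitop.neg
  · simp only [hχ]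
    field_simp
    ring

end UniformMalliavin

namespace UniformMalliavin

/-! ### The uniform law on a cube and averaging over the last coordinates -/

/-- The uniform law on `[-1, 1]`. -/
noncomputable def unif : Measure ℝ := (2 : ℝ≥0∞)⁻¹ • volume.restrict (Set.Icc (-1) 1)

instance : IsProbabilityMeasure unif where
  measure_univ := by
    simp only [unif, Measure.smul_apply, Measure.restrict_apply MeasurableSet.univ, Set.univ_inter,
      Real.volume_Icc, smul_eq_mul]
    norm_num
    exact ENNReal.inv_mul_cancel (by simp) (by simp)

theorem integral_unif (g : ℝ → ℝ) : ∫ x, g x ∂unif = 2⁻¹ * ∫ x in (-1 : ℝ)..1, g x := by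
  rw [unif, integral_smul_measure, intervalIntegral.integral_of_le (by norm_num),
    integral_Icc_eq_integral_Ioc]
  simp

/-- The uniform law on the cube `[-1, 1]^N`. -/
noncomputable def cube (N : ℕ) : Measure (Fin N → ℝ) := Measure.pi fun _ => unif

instance (N : ℕ) : IsProbabilityMeasure (cube N) := by unfold cube; infer_instance

theorem integral_comp_measurePreserving {α β : Type*} [MeasurableSpace α] [MeasurableSpace β]
    {μ : Measure α} {ν : Measure β} {T : α → β} (hT : MeasurePreserving T μ ν) {f : β → ℝ}
    (hf : AEStronglyMeasurable f ν) : ∫ x, f (T x) ∂μ = ∫ y, f y ∂ν := by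
  have := integral_map (f := f) hT.measurable.aemeasurable (by rwa [hT.map_eq])
  rw [hT.map_eq] at this
  exact this.symm

variable {N : ℕ}

/-- The first `k` coordinates of `u` and the others of `v`. -/
def merge (k : ℕ) (u v : Fin N → ℝ) : Fin N → ℝ := fun i => if (i : ℕ) < k then u i else v i

theorem measurable_merge (k : ℕ) :
    Measurable fun p : (Fin N → ℝ) × (Fin N → ℝ) => merge k p.1 p.2 := by
  refine measurable_pi_lambda _ fun i => ?_
  by_cases h : (i : ℕ) < k <;> simp only [merge, h, if_true, if_false] <;> fun_prop

theorem measurePreserving_merge (k : ℕ) :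
    MeasurePreserving (fun p : (Fin N → ℝ) × (Fin N → ℝ) => merge k p.1 p.2)
      ((cube N).prod (cube N)) (cube N) := by
  refine ⟨measurable_merge k, ?_⟩
  refine (Measure.pi_eq fun s hs => ?_).symm
  rw [Measure.map_apply (measurable_merge k) (MeasurableSet.univ_pi hs)]
  have : (fun p : (Fin N → ℝ) × (Fin N → ℝ) => merge k p.1 p.2) ⁻¹' Set.univ.pi s
      = (Set.univ.pi fun i : Fin N => if (i : ℕ) < k then s i else Set.univ) ×ˢ
        (Set.univ.pi fun i : Fin N => if (i : ℕ) < k then Set.univ else s i) := by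
    ext p
    simp only [Set.mem_preimage, Set.mem_univ_pi, Set.mem_prod, merge, ← forall_and]
    refine forall_congr' fun i => ?_
    by_cases h : (i : ℕ) < k <;> simp [h]
  rw [this, Measure.prod_prod, cube, Measure.pi_pi, Measure.pi_pi, ← Finset.prod_mul_distrib]
  refine Finset.prod_congr rfl fun i _ => ?_
  by_cases h : (i : ℕ) < k <;> simp [h]

theorem measurePreserving_update (k : Fin N) :
    MeasurePreserving (fun p : (Fin N → ℝ) × ℝ => Function.update p.1 k p.2)
      ((cube N).prod unif) (cube N) := by
  refine ⟨measurable_update', ?_⟩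
  refine (Measure.pi_eq fun s hs => ?_).symm
  rw [Measure.map_apply measurable_update' (MeasurableSet.univ_pi hs)]
  have : (fun p : (Fin N → ℝ) × ℝ => Function.update p.1 k p.2) ⁻¹' Set.univ.pi s
      = (Set.univ.pi fun i => if i = k then Set.univ else s i) ×ˢ s k := by
    ext p
    simp only [Set.mem_preimage, Set.mem_univ_pi, Set.mem_prod, Function.update_apply]
    constructor
    · intro h
      refine ⟨fun i => ?_, by simpa using h k⟩
      by_cases hi : i = k
      · simp [hi]
      · simpa [hi] using h i
    · rintro ⟨h, h'⟩ i
      by_cases hi : i = k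
      · subst hi; simpa using h'
      · simpa [hi] using h i
  rw [this, Measure.prod_prod, cube, Measure.pi_pi, ← Finset.mul_prod_erase _ _ (Finset.mem_univ k),
    ← Finset.mul_prod_erase _ (fun i => unif (s i)) (Finset.mem_univ k)]
  simp only [if_true, measure_univ, one_mul]
  rw [mul_comm]
  congr 1
  refine Finset.prod_congr rfl fun i hi => ?_
  simp [Finset.ne_of_mem_erase hi]

/-- The average of `f` over the coordinates from the `k`-th on. -/
noncomputable def avg (k : ℕ) (f : (Fin N → ℝ) → ℝ) (u : Fin N → ℝ) : ℝ :=
  ∫ v, f (merge k u v) ∂(cube N)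

theorem measurable_avg (k : ℕ) {f : (Fin N → ℝ) → ℝ} (hf : Measurable f) :
    Measurable (avg k f) :=
  (StronglyMeasurable.integral_prod_right' (ν := cube N)
    (f := fun p : (Fin N → ℝ) × (Fin N → ℝ) => f (merge k p.1 p.2))
    (hf.comp (measurable_merge k)).stronglyMeasurable).measurable

theorem abs_avg_le (k : ℕ) {f : (Fin N → ℝ) → ℝ} {C : ℝ} (hC : ∀ u, |f u| ≤ C)
    (u : Fin N → ℝ) : |avg k f u| ≤ C := by
  have := norm_integral_le_of_norm_le_const (μ := cube N) (f := fun v => f (merge k u v))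
    (C := C) (Eventually.of_forall fun v => hC _)
  simpa [avg] using this

theorem avg_congr_left {k : ℕ} (f : (Fin N → ℝ) → ℝ) {u u' : Fin N → ℝ}
    (h : ∀ i : Fin N, (i : ℕ) < k → u i = u' i) : avg k f u = avg k f u' := by
  have : ∀ v, merge k u v = merge k u' v := fun v => by
    funext i
    by_cases hi : (i : ℕ) < k <;> simp [merge, hi]
    exact h i hi
  simp [avg, this]

theorem avg_merge {k l : ℕ} (hkl : k ≤ l) (f : (Fin N → ℝ) → ℝ) (u v : Fin N → ℝ) :
    avg k f (merge l u v) = avg k f u :=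
  avg_congr_left f fun i hi => by simp [merge, hi.trans_le hkl]

theorem avg_all (f : (Fin N → ℝ) → ℝ) (u : Fin N → ℝ) : avg N f u = f u := by
  have : ∀ v, merge N u v = u := fun v => by funext i; simp [merge]
  simp [avg, this]

theorem avg_zero (f : (Fin N → ℝ) → ℝ) (u : Fin N → ℝ) : avg 0 f u = ∫ v, f v ∂(cube N) := by
  have : ∀ v, merge 0 u v = v := fun v => by funext i; simp [merge]
  simp [avg, this]

/-- `avg k` is the conditional expectation given the first `k` coordinates. -/
theorem integral_mul_eq_integral_avg_mul {k : ℕ} {ψ W : (Fin N → ℝ) → ℝ} {A B : ℝ}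
    (hψ : Measurable ψ) (hA : ∀ u, |ψ u| ≤ A) (hW : Measurable W) (hB : ∀ u, |W u| ≤ B)
    (hinv : ∀ u v, W (merge k u v) = W u) :
    ∫ u, ψ u * W u ∂(cube N) = ∫ u, avg k ψ u * W u ∂(cube N) := by
  have hbd : ∀ u, |ψ u * W u| ≤ A * B := fun u => by
    rw [abs_mul]
    exact mul_le_mul (hA u) (hB u) (abs_nonneg _) ((abs_nonneg _).trans (hA u))
  have hint : Integrable (fun u => ψ u * W u) (cube N) :=
    Integrable.of_bound (hψ.mul hW).aestronglyMeasurable (A * B) (Eventually.of_forall hbd)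
  have hp := measurePreserving_merge (N := N) k
  rw [← integral_comp_measurePreserving hp hint.1, integral_prod]
  · refine integral_congr_ae (Eventually.of_forall fun u => ?_)
    simp only [hinv, avg]
    rw [integral_mul_const]
  · exact hp.integrable_comp_of_integrable hint

/-! ### The gradient on one block -/

/-- The gradient kernel on one block: `(1 - x)` for `s ≤ x` and `-(1 + x)` for `x < s`. -/
noncomputable def blockKernel (s x : ℝ) : ℝ := (if s ≤ x then 2 else 0) - (1 + x)

theorem measurable_blockKernel : Measurable fun p : ℝ × ℝ => blockKernel p.1 p.2 :=
  (Measurable.ite (measurableSet_le measurable_fst measurable_snd) measurable_const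
    measurable_const).sub (by fun_prop)

theorem abs_blockKernel_le {s x : ℝ} (hx : x ∈ Set.Icc (-1 : ℝ) 1) : |blockKernel s x| ≤ 2 := by
  rw [abs_le, blockKernel]
  split_ifs <;> constructor <;> linarith [hx.1, hx.2]

/-- The step part of the kernel contributes `2 (g 1 - g s)` and the linear part, by parts, `2 g 1 -
∫ g`. The boundary value `g 1` cancels, and the density `1/2` normalises the rest. This is the point
where the special form of the gradient is used. -/
theorem integral_deriv_mul_blockKernel {g g' : ℝ → ℝ} (hg : ∀ x, HasDerivAt g (g' x) x)
    (hc : Continuous g') {s : ℝ} (hs : s ∈ Set.Icc (-1 : ℝ) 1) :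
    ∫ x, g' x * blockKernel s x ∂unif = (∫ x, g x ∂unif) - g s := by
  have hgc : Continuous g := continuous_iff_continuousAt.mpr fun x => (hg x).continuousAt
  rw [integral_unif, integral_unif]
  have ii : ∀ a b, IntervalIntegrable (fun x => g' x * (1 + x)) volume a b := fun a b =>
    (by fun_prop : Continuous fun x => g' x * (1 + x)).intervalIntegrable _ _
  have e1 : ∫ x in (-1 : ℝ)..1, g' x * (1 + x) = 2 * g 1 - ∫ x in (-1 : ℝ)..1, g x := by
    have := intervalIntegral.integral_mul_deriv_eq_deriv_mul (a := -1) (b := 1)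
      (u := fun x => 1 + x) (v := g) (u' := fun _ => 1) (v' := g')
      (fun x _ => (hasDerivAt_id x).const_add 1) (fun x _ => hg x)
      (by simp) (hc.intervalIntegrable _ _)
    simp only [one_mul] at this
    rw [show (∫ x in (-1 : ℝ)..1, g' x * (1 + x)) = ∫ x in (-1 : ℝ)..1, (1 + x) * g' x by
      simp only [mul_comm], this]
    ring
  have e2 : ∀ x, g' x * blockKernel s x
      = (Set.Ici s).indicator (fun x => 2 * g' x) x - g' x * (1 + x) := fun x => by
    by_cases h : s ≤ x <;> simp only [blockKernel, h, if_true, if_false,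
      Set.mem_Ici, Set.indicator_of_mem, Set.indicator_of_notMem, not_false_iff] <;> ring
  have i1 : IntervalIntegrable ((Set.Ici s).indicator fun x => 2 * g' x) volume (-1) 1 := by
    rw [intervalIntegrable_iff_integrableOn_Ioc_of_le (by norm_num)]
    refine IntegrableOn.indicator ?_ measurableSet_Ici
    exact ((by fun_prop : Continuous fun x => 2 * g' x).intervalIntegrable (-1) 1).1
  simp only [e2]
  rw [intervalIntegral.integral_sub i1 (ii _ _), e1]
  have e3 : ∫ x in (-1 : ℝ)..1, (Set.Ici s).indicator (fun x => 2 * g' x) x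
      = 2 * (g 1 - g s) := by
    rw [intervalIntegral.integral_of_le (by norm_num), ← integral_Icc_eq_integral_Ioc,
      setIntegral_indicator measurableSet_Ici]
    have : Set.Icc (-1 : ℝ) 1 ∩ Set.Ici s = Set.Icc s 1 := by
      ext x
      simp only [Set.mem_inter_iff, Set.mem_Icc, Set.mem_Ici]
      constructor
      · rintro ⟨⟨_, h⟩, h'⟩; exact ⟨h', h⟩
      · rintro ⟨h, h'⟩; exact ⟨⟨hs.1.trans h, h'⟩, h⟩
    rw [this, integral_Icc_eq_integral_Ioc, ← intervalIntegral.integral_of_le hs.2,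
      intervalIntegral.integral_const_mul,
      intervalIntegral.integral_eq_sub_of_hasDerivAt (fun x _ => hg x)
        (hc.intervalIntegrable _ _)]
  rw [e3]
  ring

/-- A `C¹` function which is bounded together with its derivative. -/
structure IsBoundedSmooth (f : (Fin N → ℝ) → ℝ) : Prop where
  smooth : ContDiff ℝ 1 f
  exists_bound : ∃ C, ∀ u, |f u| ≤ C
  exists_deriv_bound : ∃ C, ∀ u (k : Fin N), |fderiv ℝ f u (Pi.single k 1)| ≤ C

/-- The partial derivative in the direction of the `k`-th coordinate. -/
noncomputable def partialDeriv (k : Fin N) (f : (Fin N → ℝ) → ℝ) (u : Fin N → ℝ) : ℝ :=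
  fderiv ℝ f u (Pi.single k 1)

theorem IsBoundedSmooth.continuous_partialDeriv {f : (Fin N → ℝ) → ℝ} (hf : IsBoundedSmooth f)
    (k : Fin N) : Continuous (partialDeriv k f) :=
  (hf.smooth.continuous_fderiv one_ne_zero).clm_apply continuous_const

theorem IsBoundedSmooth.hasDerivAt_update {f : (Fin N → ℝ) → ℝ} (hf : IsBoundedSmooth f)
    (k : Fin N) (w : Fin N → ℝ) (x : ℝ) :
    HasDerivAt (fun x => f (Function.update w k x))
      (partialDeriv k f (Function.update w k x)) x :=
  ((hf.smooth.differentiable one_ne_zero).differentiableAt.hasFDerivAt).comp_hasDerivAt x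
    (_root_.hasDerivAt_update w k x)

/-- The conditional expectation, given the first `k` coordinates, of the gradient in the `k`-th
block at the time `2 k + 1 + s`. -/
noncomputable def blockProj (k : Fin N) (f : (Fin N → ℝ) → ℝ) (s : ℝ) (u : Fin N → ℝ) : ℝ :=
  avg k f u - avg (k + 1) f (Function.update u k s)

theorem measurable_blockProj (k : Fin N) {f : (Fin N → ℝ) → ℝ} (hf : Measurable f) :
    Measurable fun p : (Fin N → ℝ) × ℝ => blockProj k f p.2 p.1 :=
  ((measurable_avg k hf).comp measurable_fst).sub
    ((measurable_avg (k + 1) hf).comp measurable_update')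

theorem abs_blockProj_le (k : Fin N) {f : (Fin N → ℝ) → ℝ} {C : ℝ} (hC : ∀ u, |f u| ≤ C)
    (s : ℝ) (u : Fin N → ℝ) : |blockProj k f s u| ≤ 2 * C := by
  refine (abs_sub _ _).trans ?_
  linarith [abs_avg_le k hC u, abs_avg_le (k + 1) hC (Function.update u k s)]

/-- Predictability: the coordinate `k` is overwritten by `s` before it is read. -/
theorem blockProj_congr (k : Fin N) (f : (Fin N → ℝ) → ℝ) (s : ℝ) {u u' : Fin N → ℝ}
    (h : ∀ i : Fin N, (i : ℕ) < k → u i = u' i) : blockProj k f s u = blockProj k f s u' := by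
  rw [blockProj, blockProj, avg_congr_left f h, avg_congr_left f (u := Function.update u k s)
    (u' := Function.update u' k s)]
  intro i hi
  by_cases hik : i = k
  · subst hik; simp
  · have : (i : ℕ) ≠ k := fun h => hik (Fin.ext h)
    simpa [hik] using h i (by omega)

/-- The gradient in the `k`-th block at the time `2 k + 1 + s`. -/
noncomputable def blockGrad (k : Fin N) (f : (Fin N → ℝ) → ℝ) (s : ℝ) (u : Fin N → ℝ) : ℝ :=
  partialDeriv k f u * blockKernel s (max (-1) (min 1 (u k)))

theorem ae_mem_Icc_unif : ∀ᵐ x ∂unif, x ∈ Set.Icc (-1 : ℝ) 1 :=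
  Measure.ae_smul_measure (ae_restrict_mem measurableSet_Icc) _

theorem ae_unif_of_forall_mem {p : ℝ → Prop} (h : ∀ x ∈ Set.Icc (-1 : ℝ) 1, p x) :
    ∀ᵐ x ∂unif, p x := ae_mem_Icc_unif.mono h

/-- The clip in `blockGrad` makes its bound hold at every point instead of almost everywhere; on the
cube it has no effect. -/
theorem clip_eq {x : ℝ} (hx : x ∈ Set.Icc (-1 : ℝ) 1) : max (-1) (min 1 x) = x := by
  rw [min_eq_right hx.2, max_eq_right hx.1]

theorem measurable_blockGrad (k : Fin N) {f : (Fin N → ℝ) → ℝ} (hf : IsBoundedSmooth f) :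
    Measurable fun p : (Fin N → ℝ) × ℝ => blockGrad k f p.2 p.1 :=
  ((hf.continuous_partialDeriv k).measurable.comp measurable_fst).mul
    (measurable_blockKernel.comp (measurable_snd.prodMk (by fun_prop)))

theorem abs_blockGrad_le (k : Fin N) {f : (Fin N → ℝ) → ℝ} {C : ℝ}
    (hC : ∀ u, |fderiv ℝ f u (Pi.single k 1)| ≤ C) (s : ℝ) (u : Fin N → ℝ) :
    |blockGrad k f s u| ≤ C * 2 := by
  rw [blockGrad, abs_mul]
  refine mul_le_mul (hC u) (abs_blockKernel_le ⟨le_max_left _ _, ?_⟩) (abs_nonneg _)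
    ((abs_nonneg _).trans (hC u))
  exact max_le (by norm_num) (min_le_left _ _)

theorem merge_update_self (k : Fin N) (u v : Fin N → ℝ) (x : ℝ) :
    merge k u (Function.update v k x) = Function.update (merge k u v) k x := by
  funext i
  by_cases hi : i = k
  · subst hi; simp [merge]
  · simp [merge, hi]

theorem update_merge (k : Fin N) (u v : Fin N → ℝ) (x : ℝ) :
    Function.update (merge k u v) k x = merge (k + 1) (Function.update u k x) v := by
  funext i
  by_cases hi : i = k
  · subst hi; simp [merge]
  · have h1 : (i : ℕ) ≠ k := fun h => hi (Fin.ext h)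
    have h2 : (i : ℕ) < k + 1 ↔ (i : ℕ) < k := by omega
    simp [merge, hi, h2]

/-- Resampling the `k`-th of the averaged coordinates isolates it in an inner integral, where the
one-variable integration by parts applies. -/
theorem avg_eq_integral_update (k : Fin N) {ψ : (Fin N → ℝ) → ℝ} {A : ℝ} (hψ : Measurable ψ)
    (hA : ∀ u, |ψ u| ≤ A) (u : Fin N → ℝ) :
    avg k ψ u = ∫ v, ∫ x, ψ (Function.update (merge k u v) k x) ∂unif ∂(cube N) := by
  have hm : Measurable fun v => ψ (merge k u v) :=
    hψ.comp ((measurable_merge k).comp measurable_prodMk_left)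
  rw [avg, ← integral_comp_measurePreserving (measurePreserving_update k)
    hm.aestronglyMeasurable, integral_prod]
  · simp only [merge_update_self]
  · exact Integrable.of_bound (hm.comp measurable_update').aestronglyMeasurable A
      (Eventually.of_forall fun p => hA _)

/-- The conditional expectation of the gradient given the previous coordinates. -/
theorem avg_blockGrad (k : Fin N) {f : (Fin N → ℝ) → ℝ} (hf : IsBoundedSmooth f) {s : ℝ}
    (hs : s ∈ Set.Icc (-1 : ℝ) 1) (u : Fin N → ℝ) :
    avg k (blockGrad k f s) u = blockProj k f s u := by
  obtain ⟨C, hC⟩ := hf.exists_bound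
  obtain ⟨C', hC'⟩ := hf.exists_deriv_bound
  have hfm := hf.smooth.continuous.measurable
  rw [avg_eq_integral_update k (ψ := blockGrad k f s) ((measurable_blockGrad k hf).comp measurable_prodMk_right)
    (abs_blockGrad_le k (fun u => hC' u k) s)]
  have e : ∀ v, ∫ x, blockGrad k f s (Function.update (merge k u v) k x) ∂unif
      = (∫ x, f (Function.update (merge k u v) k x) ∂unif)
        - f (Function.update (merge k u v) k s) := fun v => by
    rw [← integral_deriv_mul_blockKernel (fun x => hf.hasDerivAt_update k (merge k u v) x)
      ((hf.continuous_partialDeriv k).comp (by fun_prop)) hs]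
    refine integral_congr_ae (ae_unif_of_forall_mem fun x hx => ?_)
    simp [blockGrad, max_eq_right hx.1, min_eq_right hx.2]
  have hp : Measurable fun p : (Fin N → ℝ) × ℝ => f (Function.update (merge k u p.1) k p.2) :=
    hfm.comp (measurable_update'.comp
      (((measurable_merge k).comp (measurable_const.prodMk measurable_fst)).prodMk measurable_snd))
  simp only [e]
  rw [integral_sub, ← avg_eq_integral_update k hfm hC, blockProj]
  · simp only [update_merge]
    rfl
  · refine Integrable.of_bound
      (StronglyMeasurable.integral_prod_right' (ν := unif)
        hp.stronglyMeasurable).aestronglyMeasurable C (Eventually.of_forall fun v => ?_)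
    simpa using norm_integral_le_of_norm_le_const (μ := unif) (C := C)
      (f := fun x => f (Function.update (merge k u v) k x)) (Eventually.of_forall fun x => hC (Function.update (merge k u v) k x))
  · exact Integrable.of_bound
      (hp.comp (measurable_id.prodMk measurable_const)).aestronglyMeasurable C
      (Eventually.of_forall fun v => hC _)

/-! ### The covariance formula on the cube -/

/-- The tower property: `avg k h` depends only on coordinates that `avg l` leaves fixed. -/
theorem integral_mul_avg_of_le {k l : ℕ} (hkl : k ≤ l) {f h : (Fin N → ℝ) → ℝ} {A B : ℝ}
    (hf : Measurable f) (hA : ∀ u, |f u| ≤ A) (hh : Measurable h) (hB : ∀ u, |h u| ≤ B) :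
    ∫ u, avg l f u * avg k h u ∂(cube N) = ∫ u, f u * avg k h u ∂(cube N) :=
  (integral_mul_eq_integral_avg_mul hf hA (measurable_avg k hh) (abs_avg_le k hB)
    fun u v => avg_merge hkl h u v).symm

/-- Since `blockProj` is predictable, the gradient of `h` may be replaced by its own projection.
This leaves the expected product of the `k`-th martingale increments of `h` and `f`, which collapses
by the tower property. -/
theorem integral_blockGrad_mul_blockProj (k : Fin N) {f h : (Fin N → ℝ) → ℝ}
    (hf : IsBoundedSmooth f) (hh : IsBoundedSmooth h) :
    ∫ s, ∫ u, blockGrad k h s u * blockProj k f s u ∂(cube N) ∂unif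
      = (∫ u, h u * avg (k + 1) f u ∂(cube N)) - ∫ u, h u * avg k f u ∂(cube N) := by
  obtain ⟨A, hA⟩ := hf.exists_bound
  obtain ⟨B, hB⟩ := hh.exists_bound
  obtain ⟨B', hB'⟩ := hh.exists_deriv_bound
  have hfm := hf.smooth.continuous.measurable
  have hhm := hh.smooth.continuous.measurable
  set W : (Fin N → ℝ) → ℝ := fun u => (avg k h u - avg (k + 1) h u) * (avg k f u - avg (k + 1) f u)
    with hW
  have hWm : Measurable W := ((measurable_avg k hhm).sub (measurable_avg _ hhm)).mul
    ((measurable_avg k hfm).sub (measurable_avg _ hfm))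
  have hWb : ∀ u, |W u| ≤ (B + B) * (A + A) := fun u => by
    rw [abs_mul]
    refine mul_le_mul ((abs_sub _ _).trans (add_le_add (abs_avg_le _ hB u) (abs_avg_le _ hB u)))
      ((abs_sub _ _).trans (add_le_add (abs_avg_le _ hA u) (abs_avg_le _ hA u)))
      (abs_nonneg _) ?_
    linarith [(abs_nonneg _).trans (hB u)]
  -- After projection both factors are increments evaluated with the `k`-th coordinate equal to `s`;
  -- integrating over `s` restores the uniform law on the cube.
  have e1 : ∀ s ∈ Set.Icc (-1 : ℝ) 1, ∫ u, blockGrad k h s u * blockProj k f s u ∂(cube N)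
      = ∫ u, W (Function.update u k s) ∂(cube N) := fun s hs => by
    rw [integral_mul_eq_integral_avg_mul (k := k) (ψ := blockGrad k h s) (W := blockProj k f s)
      ((measurable_blockGrad k hh).comp measurable_prodMk_right)
      (abs_blockGrad_le k (fun u => hB' u k) s)
      ((measurable_blockProj k hfm).comp measurable_prodMk_right) (abs_blockProj_le k hA s)
      (fun u v => blockProj_congr k f s fun i hi => by simp [merge, hi])]
    refine integral_congr_ae (Eventually.of_forall fun u => ?_)
    have e : ∀ g : (Fin N → ℝ) → ℝ, avg k g (Function.update u k s) = avg k g u := fun g =>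
      avg_congr_left g fun i hi => by
        rw [Function.update_of_ne]
        rintro rfl
        exact lt_irrefl _ hi
    simp only [avg_blockGrad k hh hs, hW, e, blockProj]
  rw [integral_congr_ae (ae_unif_of_forall_mem e1)]
  have hup := measurePreserving_update (N := N) k
  have hWi : Integrable W (cube N) :=
    Integrable.of_bound hWm.aestronglyMeasurable _ (Eventually.of_forall hWb)
  rw [← integral_prod_symm (f := fun p : (Fin N → ℝ) × ℝ => W (Function.update p.1 k p.2))
    (hup.integrable_comp_of_integrable hWi), integral_comp_measurePreserving hup hWi.1]
  have I : ∀ (i j : ℕ), Integrable (fun u => avg i h u * avg j f u) (cube N) := fun i j =>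
    Integrable.of_bound ((measurable_avg i hhm).mul (measurable_avg j hfm)).aestronglyMeasurable
      (B * A) (Eventually.of_forall fun u => by
        rw [norm_mul]
        exact mul_le_mul (abs_avg_le _ hB u) (abs_avg_le _ hA u) (abs_nonneg _)
          ((abs_nonneg _).trans (hB u)))
  have e2 : ∀ u, W u = avg k h u * avg k f u - avg k h u * avg (k + 1) f u
      - avg (k + 1) h u * avg k f u + avg (k + 1) h u * avg (k + 1) f u := fun u => by
    simp only [hW]; ring
  simp only [e2]
  have c1 := integral_mul_avg_of_le (N := N) (le_refl (k : ℕ)) hhm hB hfm hA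
  have c2 := integral_mul_avg_of_le (N := N) (Nat.le_succ (k : ℕ)) hhm hB hfm hA
  have c3 := integral_mul_avg_of_le (N := N) (le_refl ((k : ℕ) + 1)) hhm hB hfm hA
  have c4 : ∫ u, avg k h u * avg (k + 1) f u ∂(cube N) = ∫ u, h u * avg k f u ∂(cube N) := by
    have d1 := integral_mul_avg_of_le (N := N) (Nat.le_succ (k : ℕ)) hfm hA hhm hB
    have d2 := integral_mul_avg_of_le (N := N) (le_refl (k : ℕ)) hfm hA hhm hB
    simp only [mul_comm (avg k h _)] at c1 ⊢
    rw [d1, ← d2, c1]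
  rw [integral_add, integral_sub, integral_sub, c1, c2, c3, c4]
  · ring
  all_goals
    first
    | exact I _ _
    | exact (I _ _).sub (I _ _)
    | exact ((I _ _).sub (I _ _)).sub (I _ _)

/-- The block contributions telescope between `avg 0 f`, the mean, and `avg N f = f`. -/
theorem sum_integral_blockGrad_mul_blockProj {f h : (Fin N → ℝ) → ℝ}
    (hf : IsBoundedSmooth f) (hh : IsBoundedSmooth h) :
    ∑ k : Fin N, ∫ s, ∫ u, blockGrad k h s u * blockProj k f s u ∂(cube N) ∂unif
      = (∫ u, h u * f u ∂(cube N)) - (∫ u, h u ∂(cube N)) * ∫ u, f u ∂(cube N) := by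
  simp only [integral_blockGrad_mul_blockProj _ hf hh]
  rw [Fin.sum_univ_eq_sum_range (fun k => (∫ u, h u * avg (k + 1) f u ∂(cube N))
    - ∫ u, h u * avg k f u ∂(cube N)) N,
    Finset.sum_range_sub (fun k => ∫ u, h u * avg k f u ∂(cube N))]
  simp only [avg_all, avg_zero, integral_mul_const]

end UniformMalliavin

namespace UniformMalliavin

/-! ### The filtration of the jump process -/

theorem setIntegral_eq_of_eventuallyEq_set {Ω : Type*} {m : MeasurableSpace Ω}
    {mΩ : MeasurableSpace Ω} {P : Measure Ω} {f g : Ω → ℝ}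
    (h : ∀ t, MeasurableSet[m] t → ∫ ω in t, g ω ∂P = ∫ ω in t, f ω ∂P) {s : Set Ω}
    (hs : MeasurableSet[eventuallyMeasurableSpace m (ae P)] s) :
    ∫ ω in s, g ω ∂P = ∫ ω in s, f ω ∂P := by
  obtain ⟨t, ht, hst⟩ := hs
  rw [setIntegral_congr_set hst, setIntegral_congr_set hst, h t ht]

/-- Every set of `m ⊔ m'` is almost surely equal to a set of `m`, so the conditional expectation
given `m` already has the right integrals over it. -/
theorem condExp_eq_sup_of_le_eventually {Ω : Type*} {m m' : MeasurableSpace Ω}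
    {mΩ : MeasurableSpace Ω} {P : Measure Ω} [IsProbabilityMeasure P] (hm : m ≤ mΩ) (hm' : m' ≤ mΩ)
    (h : m' ≤ eventuallyMeasurableSpace m (ae P)) {f : Ω → ℝ} (hf : Integrable f P) :
    P[f | m] =ᵐ[P] P[f | m ⊔ m'] := by
  refine ae_eq_condExp_of_forall_setIntegral_eq (sup_le hm hm') hf
    (fun s _ _ => integrable_condExp.integrableOn) (fun s hs _ => ?_)
    ⟨_, stronglyMeasurable_condExp.mono le_sup_left, ae_eq_rfl⟩
  exact setIntegral_eq_of_eventuallyEq_set (m := m)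
    (fun t ht => setIntegral_condExp hm hf ht)
    (sup_le le_eventuallyMeasurableSpace h s hs)

/-- σ-algebras which agree up to null sets give the same conditional expectations. -/
theorem condExp_congr_sigma {Ω : Type*} {m m' : MeasurableSpace Ω}
    {mΩ : MeasurableSpace Ω} {P : Measure Ω} [IsProbabilityMeasure P] (hm : m ≤ mΩ) (hm' : m' ≤ mΩ)
    (h : m' ≤ eventuallyMeasurableSpace m (ae P)) (h' : m ≤ eventuallyMeasurableSpace m' (ae P))
    {f : Ω → ℝ} (hf : Integrable f P) : P[f | m] =ᵐ[P] P[f | m'] := by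
  have e1 := condExp_eq_sup_of_le_eventually hm hm' h hf
  have e2 := condExp_eq_sup_of_le_eventually hm' hm h' hf
  rw [sup_comm] at e2
  exact e1.trans e2.symm

section Filtration

set_option linter.unusedSectionVars false

variable {Ω : Type*} [mΩ : MeasurableSpace Ω] {P : Measure Ω} [IsProbabilityMeasure P]
  {U : ℕ → Ω → ℝ}

theorem map_eq_unif (hu : ∀ k, pdf.IsUniform (U k) (Set.Icc (-1) 1) P volume) (k : ℕ) :
    P.map (U k) = unif := by
  have := hu k
  rw [pdf.IsUniform, ProbabilityTheory.cond] at this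
  rw [this, unif, Real.volume_Icc]
  norm_num

/-- Excluding the endpoints puts each jump strictly inside its own block, so jumps are ordered and
separated by the times `2k`. -/
theorem ae_mem_Ioo (hU : ∀ k, Measurable (U k))
    (hu : ∀ k, pdf.IsUniform (U k) (Set.Icc (-1) 1) P volume) :
    ∀ᵐ ω ∂P, ∀ k, U k ω ∈ Set.Ioo (-1 : ℝ) 1 := by
  rw [ae_all_iff]
  intro k
  have : ∀ᵐ x ∂(P.map (U k)), x ∈ Set.Ioo (-1 : ℝ) 1 := by
    rw [map_eq_unif hu, unif]
    refine Measure.ae_smul_measure ?_ _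
    rw [← restrict_Ioo_eq_restrict_Icc]
    exact ae_restrict_mem measurableSet_Ioo
  exact ae_of_ae_map (hU k).aemeasurable this

/-- The vector of the first `N` variables. -/
def firstVars (U : ℕ → Ω → ℝ) (N : ℕ) (ω : Ω) : Fin N → ℝ := fun i => U i ω

theorem measurable_firstVars (hU : ∀ k, Measurable (U k)) (N : ℕ) :
    Measurable (firstVars U N) := measurable_pi_lambda _ fun i => hU i

theorem measurePreserving_firstVars (hU : ∀ k, Measurable (U k)) (hi : iIndepFun U P)
    (hu : ∀ k, pdf.IsUniform (U k) (Set.Icc (-1) 1) P volume) (N : ℕ) :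
    MeasurePreserving (firstVars U N) P (cube N) := by
  refine ⟨measurable_firstVars hU N, ?_⟩
  have h1 : iIndepFun (fun i : Fin N => U i) P := hi.precomp Fin.val_injective
  have := (iIndepFun_iff_map_fun_eq_pi_map fun i : Fin N => (hU i).aemeasurable).mp h1
  simp only [map_eq_unif hu] at this
  exact this

/-- The σ-algebra generated by the first `k` variables. -/
abbrev pastSigma (U : ℕ → Ω → ℝ) (k : ℕ) : MeasurableSpace Ω :=
  MeasurableSpace.comap (firstVars U k) inferInstance

theorem pastSigma_le (hU : ∀ k, Measurable (U k)) (k : ℕ) : pastSigma U k ≤ mΩ :=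
  (measurable_firstVars hU k).comap_le

theorem measurable_jumpProcess_term {m : MeasurableSpace Ω} {j : ℕ} (hU : Measurable[m] (U j))
    (s : ℝ) : Measurable[m] fun ω =>
      (Set.Ici (2 * (j : ℝ) + 1 + U j ω)).indicator (fun _ => (1 : ℝ≥0∞)) s := by
  have : (fun ω => (Set.Ici (2 * (j : ℝ) + 1 + U j ω)).indicator (fun _ => (1 : ℝ≥0∞)) s)
      = {ω | 2 * (j : ℝ) + 1 + U j ω ≤ s}.indicator fun _ => 1 := by
    funext ω
    simp [Set.indicator]
  rw [this]
  exact measurable_const.indicator (measurableSet_le (by fun_prop) measurable_const)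

theorem jumpSigma_le (hU : ∀ k, Measurable (U k)) (t : ℝ) : jumpSigma U t ≤ mΩ := by
  refine iSup₂_le fun s _ => Measurable.comap_le ?_
  exact Measurable.tsum fun j => measurable_jumpProcess_term (hU j) s

theorem jumpProcess_eq_sum {ω : Ω} (hω : ∀ k, U k ω ∈ Set.Ioo (-1 : ℝ) 1) {s : ℝ} {k : ℕ}
    (hs : s ≤ 2 * (k : ℝ)) :
    jumpProcess U s ω = ∑ j ∈ Finset.range k,
      (Set.Ici (2 * (j : ℝ) + 1 + U j ω)).indicator (fun _ => (1 : ℝ≥0∞)) s := by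
  refine tsum_eq_sum fun j hj => ?_
  have hkj : (k : ℝ) ≤ j := by
    simp only [Finset.mem_range, not_lt] at hj
    exact_mod_cast hj
  have := (hω j).1
  rw [Set.indicator_of_notMem]
  simp only [Set.mem_Ici, not_le]
  linarith

theorem measurable_pastSigma {j k : ℕ} (hj : j < k) : Measurable[pastSigma U k] (U j) :=
  (measurable_pi_apply (⟨j, hj⟩ : Fin k)).comp (comap_measurable (firstVars U k))

theorem jumpSigma_le_pastSigma (hω : ∀ᵐ ω ∂P, ∀ k, U k ω ∈ Set.Ioo (-1 : ℝ) 1) (k : ℕ) :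
    jumpSigma U (2 * (k : ℝ)) ≤ eventuallyMeasurableSpace (pastSigma U k) (ae P) := by
  refine iSup₂_le fun s hs => Measurable.comap_le ?_
  have h1 : Measurable[pastSigma U k] fun ω => ∑ j ∈ Finset.range k,
      (Set.Ici (2 * (j : ℝ) + 1 + U j ω)).indicator (fun _ => (1 : ℝ≥0∞)) s :=
    Finset.measurable_fun_sum _ fun j hj =>
      measurable_jumpProcess_term (measurable_pastSigma (Finset.mem_range.mp hj)) s
  exact h1.eventuallyMeasurable_of_eventuallyEq
    (hω.mono fun ω h => jumpProcess_eq_sum h hs.2)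

/-- For `-1 < q < 1`, the event `U_j ≤ q` says that the `j`-th jump has occurred by time `2j+1+q`.
All earlier jumps have then occurred and no later one has, so this event is `Y ≥ j + 1` at that
time. For other `q` the event is trivial almost surely. -/
theorem pastSigma_le_jumpSigma (hω : ∀ᵐ ω ∂P, ∀ k, U k ω ∈ Set.Ioo (-1 : ℝ) 1) (k : ℕ) :
    pastSigma U k ≤ eventuallyMeasurableSpace (jumpSigma U (2 * (k : ℝ))) (ae P) := by
  refine Measurable.comap_le ?_
  refine @measurable_pi_lambda Ω (Fin k) (fun _ => ℝ)
    (eventuallyMeasurableSpace (jumpSigma U (2 * (k : ℝ))) (ae P)) _ _ fun j => ?_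
  refine @measurable_of_Iic ℝ Ω _ _ _ (eventuallyMeasurableSpace (jumpSigma U (2 * (k : ℝ))) (ae P))
    _ _ _ _ fun q => ?_
  rcases le_or_gt q (-1) with hq | hq
  · refine ⟨∅, @MeasurableSet.empty _ (jumpSigma U (2 * (k : ℝ))), ?_⟩
    rw [eventuallyEq_set]
    filter_upwards [hω] with ω h
    have := (h j).1
    simp only [Set.mem_preimage, firstVars, Set.mem_Iic, Set.mem_empty_iff_false, iff_false, not_le]
    linarith
  rcases le_or_gt 1 q with hq' | hq'
  · refine ⟨Set.univ, @MeasurableSet.univ _ (jumpSigma U (2 * (k : ℝ))), ?_⟩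
    rw [eventuallyEq_set]
    filter_upwards [hω] with ω h
    have := (h j).2
    simp only [Set.mem_preimage, firstVars, Set.mem_Iic, Set.mem_univ, iff_true]
    linarith
  have hjk : ((j : ℕ) : ℝ) + 1 ≤ k := by exact_mod_cast j.2
  have hj0 : (0 : ℝ) ≤ ((j : ℕ) : ℝ) := Nat.cast_nonneg _
  set s : ℝ := 2 * ((j : ℕ) : ℝ) + 1 + q with hs
  have hmem : s ∈ Set.Icc 0 (2 * (k : ℝ)) := ⟨by linarith, by linarith⟩
  refine ⟨jumpProcess U s ⁻¹' Set.Ici ((j : ℕ) + 1 : ℝ≥0∞), ?_, ?_⟩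
  · have hm : Measurable[jumpSigma U (2 * (k : ℝ))] (jumpProcess U s) := by
      refine (comap_measurable (jumpProcess U s)).mono ?_ le_rfl
      exact le_iSup₂ (f := fun s (_ : s ∈ Set.Icc (0 : ℝ) (2 * (k : ℝ))) =>
        MeasurableSpace.comap (jumpProcess U s) inferInstance) s hmem
    exact hm measurableSet_Ici
  · rw [eventuallyEq_set]
    filter_upwards [hω] with ω h
    have hsum : jumpProcess U s ω = (j : ℕ) +
        (Set.Ici (2 * ((j : ℕ) : ℝ) + 1 + U j ω)).indicator (fun _ => (1 : ℝ≥0∞)) s := by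
      rw [jumpProcess_eq_sum h (k := (j : ℕ) + 1) (by push_cast; linarith), Finset.sum_range_succ]
      congr 1
      rw [Finset.sum_congr rfl (g := fun _ => (1 : ℝ≥0∞))]
      · simp
      · intro i hi
        have hij : (i : ℝ) + 1 ≤ (j : ℕ) := by exact_mod_cast Finset.mem_range.mp hi
        have := (h i).2
        rw [Set.indicator_of_mem]
        simp only [Set.mem_Ici]
        linarith
    simp only [Set.mem_preimage, firstVars, Set.mem_Iic, Set.mem_Ici, hsum]
    by_cases hu : U j ω ≤ q
    · rw [Set.indicator_of_mem (by simp only [Set.mem_Ici]; linarith)]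
      simp [hu]
    · rw [Set.indicator_of_notMem (by simp only [Set.mem_Ici]; linarith)]
      simp only [hu, false_iff, add_zero, not_le]
      exact ENNReal.lt_add_right (by simp) one_ne_zero

/-- Independence gives the vector of variables the product law of the cube, where integrating out
the last coordinates is conditioning on the first `k`. -/
theorem condExp_pastSigma (hU : ∀ k, Measurable (U k)) (hi : iIndepFun U P)
    (hu : ∀ k, pdf.IsUniform (U k) (Set.Icc (-1) 1) P volume) {N k : ℕ} (hk : k ≤ N)
    {ψ : (Fin N → ℝ) → ℝ} {A : ℝ} (hψ : Measurable ψ) (hA : ∀ u, |ψ u| ≤ A) :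
    (fun ω => avg k ψ (firstVars U N ω)) =ᵐ[P]
      P[fun ω => ψ (firstVars U N ω) | pastSigma U k] := by
  have hvec := measurable_firstVars hU N
  have hint : Integrable (fun ω => ψ (firstVars U N ω)) P :=
    Integrable.of_bound (hψ.comp hvec).aestronglyMeasurable A (Eventually.of_forall fun ω => hA _)
  have hint' : Integrable (fun ω => avg k ψ (firstVars U N ω)) P :=
    Integrable.of_bound ((measurable_avg k hψ).comp hvec).aestronglyMeasurable A
      (Eventually.of_forall fun ω => abs_avg_le k hA _)
  have hp := measurePreserving_firstVars hU hi hu N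
  refine ae_eq_condExp_of_forall_setIntegral_eq (pastSigma_le hU k) hint
    (fun s _ _ => hint'.integrableOn) ?_ ?_
  · rintro s ⟨B, hB, rfl⟩ -
    have hpr : Measurable fun (u : Fin N → ℝ) (i : Fin k) => u (Fin.castLE hk i) := by fun_prop
    set W : (Fin N → ℝ) → ℝ := fun u =>
      B.indicator (fun _ => (1 : ℝ)) fun i : Fin k => u (Fin.castLE hk i) with hW
    have hWm : Measurable W := (measurable_const.indicator hB).comp hpr
    have hWb : ∀ u, |W u| ≤ 1 := fun u => by
      simp only [hW, Set.indicator]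
      split_ifs <;> simp
    have key := integral_mul_eq_integral_avg_mul hψ hA hWm hWb (k := k) fun u v => by
      simp [hW, merge]
    have tr : ∀ g : (Fin N → ℝ) → ℝ, Measurable g →
        ∫ ω in firstVars U k ⁻¹' B, g (firstVars U N ω) ∂P = ∫ u, g u * W u ∂(cube N) := by
      intro g hg
      rw [← integral_comp_measurePreserving hp (f := fun u => g u * W u)
        (hg.mul hWm).aestronglyMeasurable,
        ← integral_indicator (measurable_firstVars hU k hB)]
      refine integral_congr_ae (Eventually.of_forall fun ω => ?_)
      have e : W (firstVars U N ω) = B.indicator (fun _ => (1 : ℝ)) (firstVars U k ω) := rfl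
      simp only [e]
      by_cases h : firstVars U k ω ∈ B <;> simp [Set.indicator, h]
    rw [tr _ hψ, tr _ (measurable_avg k hψ), key]
  -- The padding value is immaterial: `avg k` does not see the coordinates from `k` on.
  · set ext : (Fin k → ℝ) → Fin N → ℝ := fun w i => if h : (i : ℕ) < k then w ⟨i, h⟩ else 0
    have hext : Measurable ext := by
      refine measurable_pi_lambda _ fun i => ?_
      by_cases h : (i : ℕ) < k <;> simp only [ext, h, dite_true, dite_false] <;> fun_prop
    have e : (fun ω => avg k ψ (firstVars U N ω)) =
        (fun w => avg k ψ (ext w)) ∘ firstVars U k := by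
      funext ω
      exact avg_congr_left ψ fun i h => by simp [ext, h, firstVars]
    rw [e]
    exact (((measurable_avg k hψ).comp hext).comp
      (comap_measurable (firstVars U k))).stronglyMeasurable.aestronglyMeasurable

theorem condExp_blockSigma (hU : ∀ k, Measurable (U k)) (hi : iIndepFun U P)
    (hu : ∀ k, pdf.IsUniform (U k) (Set.Icc (-1) 1) P volume) {N k : ℕ} (hk : k ≤ N)
    {ψ : (Fin N → ℝ) → ℝ} {A : ℝ} (hψ : Measurable ψ) (hA : ∀ u, |ψ u| ≤ A) :
    (fun ω => avg k ψ (firstVars U N ω)) =ᵐ[P]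
      P[fun ω => ψ (firstVars U N ω) | jumpSigma U (2 * (k : ℝ))] := by
  have hω := ae_mem_Ioo hU hu
  refine (condExp_pastSigma hU hi hu hk hψ hA).trans (condExp_congr_sigma (pastSigma_le hU k)
    (jumpSigma_le hU _) (jumpSigma_le_pastSigma hω k) (pastSigma_le_jumpSigma hω k) ?_)
  exact Integrable.of_bound (hψ.comp (measurable_firstVars hU N)).aestronglyMeasurable A
    (Eventually.of_forall fun ω => hA _)

end Filtration

end UniformMalliavin

namespace UniformMalliavin

/-! ### Processes given by functions on the blocks -/

instance : SigmaFinite halfLine := by unfold halfLine; infer_instance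

/-- The process which is `a k (t - 2 k - 1) (U₀, …, U_{N-1})` for `t` in the `k`-th block. -/
noncomputable def blockProcess {Ω : Type*} (U : ℕ → Ω → ℝ) {N : ℕ}
    (a : Fin N → ℝ → (Fin N → ℝ) → ℝ) (p : Ω × ℝ) : ℝ :=
  ∑ k : Fin N, (Set.Ioo (2 * ((k : ℕ) : ℝ)) (2 * ((k : ℕ) : ℝ) + 2)).indicator
    (fun t => a k (t - 2 * ((k : ℕ) : ℝ) - 1) (firstVars U N p.1)) p.2

theorem ae_halfLine_ne : ∀ᵐ t ∂halfLine, ∀ k : ℕ, t ≠ 2 * (k : ℝ) := by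
  rw [ae_all_iff]
  intro k
  refine ae_restrict_of_ae ?_
  simp [ae_iff]

theorem ae_halfLine_nonneg : ∀ᵐ t ∂halfLine, 0 ≤ t := ae_restrict_mem measurableSet_Ici

theorem mem_block {t : ℝ} (h0 : 0 ≤ t) (hne : ∀ k : ℕ, t ≠ 2 * (k : ℝ)) :
    t ∈ Set.Ioo (2 * (⌊t / 2⌋₊ : ℝ)) (2 * (⌊t / 2⌋₊ : ℝ) + 2) := by
  have h1 := Nat.floor_le (show 0 ≤ t / 2 by linarith)
  have h2 := Nat.lt_floor_add_one (t / 2)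
  refine ⟨lt_of_le_of_ne (by linarith) (hne _).symm, by linarith⟩

theorem block_unique {t : ℝ} {j k : ℕ} (hj : t ∈ Set.Ioo (2 * (j : ℝ)) (2 * (j : ℝ) + 2))
    (hk : t ∈ Set.Ioo (2 * (k : ℝ)) (2 * (k : ℝ) + 2)) : j = k := by
  have h1 : (j : ℝ) < (k : ℝ) + 1 := by linarith [hj.1, hk.2]
  have h2 : (k : ℝ) < (j : ℝ) + 1 := by linarith [hj.2, hk.1]
  have h1' : j < k + 1 := by exact_mod_cast h1
  have h2' : k < j + 1 := by exact_mod_cast h2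
  omega

section

set_option linter.unusedSectionVars false

variable {Ω : Type*} {U : ℕ → Ω → ℝ} {N : ℕ}

theorem blockProcess_of_mem (a : Fin N → ℝ → (Fin N → ℝ) → ℝ) {ω : Ω} {t : ℝ} {k : Fin N}
    (ht : t ∈ Set.Ioo (2 * ((k : ℕ) : ℝ)) (2 * ((k : ℕ) : ℝ) + 2)) :
    blockProcess U a (ω, t) = a k (t - 2 * ((k : ℕ) : ℝ) - 1) (firstVars U N ω) := by
  rw [blockProcess, Finset.sum_eq_single k]
  · rw [Set.indicator_of_mem ht]
  · intro j _ hj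
    refine Set.indicator_of_notMem (fun h => hj (Fin.ext (block_unique h ht))) _
  · simp

theorem blockProcess_of_notMem (a : Fin N → ℝ → (Fin N → ℝ) → ℝ) {ω : Ω} {t : ℝ}
    (ht : ∀ k : Fin N, t ∉ Set.Ioo (2 * ((k : ℕ) : ℝ)) (2 * ((k : ℕ) : ℝ) + 2)) :
    blockProcess U a (ω, t) = 0 :=
  Finset.sum_eq_zero fun k _ => Set.indicator_of_notMem (ht k) _

theorem blockProcess_mul (a b : Fin N → ℝ → (Fin N → ℝ) → ℝ) (p : Ω × ℝ) :
    blockProcess U a p * blockProcess U b p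
      = blockProcess U (fun k s u => a k s u * b k s u) p := by
  obtain ⟨ω, t⟩ := p
  by_cases h : ∃ k : Fin N, t ∈ Set.Ioo (2 * ((k : ℕ) : ℝ)) (2 * ((k : ℕ) : ℝ) + 2)
  · obtain ⟨k, hk⟩ := h
    simp only [blockProcess_of_mem _ hk]
  · push Not at h
    simp only [blockProcess_of_notMem _ h, mul_zero]

variable [MeasurableSpace Ω] {P : Measure Ω} [IsProbabilityMeasure P]

theorem memLp_blockProcess (hU : ∀ k, Measurable (U k)) {a : Fin N → ℝ → (Fin N → ℝ) → ℝ}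
    {C : Fin N → ℝ} (ha : ∀ k, Measurable fun p : (Fin N → ℝ) × ℝ => a k p.2 p.1)
    (hC : ∀ k s u, |a k s u| ≤ C k) (q : ℝ≥0∞) :
    MemLp (blockProcess U a) q (P.prod halfLine) := by
  refine memLp_finsetSum _ fun k _ => ?_
  set I : Set ℝ := Set.Ioo (2 * ((k : ℕ) : ℝ)) (2 * ((k : ℕ) : ℝ) + 2)
  have e : (fun p : Ω × ℝ => I.indicator
      (fun t => a k (t - 2 * ((k : ℕ) : ℝ) - 1) (firstVars U N p.1)) p.2)
      = (Set.univ ×ˢ I).indicator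
        fun p => a k (p.2 - 2 * ((k : ℕ) : ℝ) - 1) (firstVars U N p.1) := by
    funext p
    by_cases h : p.2 ∈ I
    · rw [Set.indicator_of_mem h, Set.indicator_of_mem (by exact ⟨trivial, h⟩)]
    · rw [Set.indicator_of_notMem h, Set.indicator_of_notMem (fun h' => h h'.2)]
  rw [e, memLp_indicator_iff_restrict (MeasurableSet.univ.prod measurableSet_Ioo)]
  have hfin : IsFiniteMeasure ((P.prod halfLine).restrict (Set.univ ×ˢ I)) := by
    refine ⟨?_⟩
    rw [Measure.restrict_apply_univ, Measure.prod_prod, measure_univ, one_mul, halfLine]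
    exact (Measure.restrict_apply_le _ _).trans_lt (by simp [I])
  refine MemLp.of_bound ?_ (C k) (Eventually.of_forall fun p => hC k _ _)
  exact ((ha k).comp (((measurable_firstVars hU N).comp measurable_fst).prodMk
    (by fun_prop))).aestronglyMeasurable

/-- The factor 2 is the length of a block and the origin of the factor 2 in the covariance formula.
-/
theorem integral_block (Φ : ℝ → ℝ) (k : ℕ) :
    ∫ t, (Set.Ioo (2 * (k : ℝ)) (2 * (k : ℝ) + 2)).indicator
      (fun t => Φ (t - 2 * (k : ℝ) - 1)) t ∂halfLine = 2 * ∫ s, Φ s ∂unif := by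
  rw [integral_indicator measurableSet_Ioo, halfLine, Measure.restrict_restrict measurableSet_Ioo,
    Set.inter_eq_left.mpr, ← integral_Ioc_eq_integral_Ioo,
    ← intervalIntegral.integral_of_le (by linarith), integral_unif]
  · simp only [sub_sub]
    rw [intervalIntegral.integral_comp_sub_right]
    ring_nf
  · intro t ht
    have : (0 : ℝ) ≤ k := Nat.cast_nonneg k
    exact (by linarith [ht.1] : (0 : ℝ) ≤ t)

theorem integral_blockProcess (hU : ∀ k, Measurable (U k)) (hi : iIndepFun U P)
    (hu : ∀ k, pdf.IsUniform (U k) (Set.Icc (-1) 1) P volume)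
    {a : Fin N → ℝ → (Fin N → ℝ) → ℝ}
    {C : Fin N → ℝ} (ha : ∀ k, Measurable fun p : (Fin N → ℝ) × ℝ => a k p.2 p.1)
    (hC : ∀ k s u, |a k s u| ≤ C k) :
    ∫ p, blockProcess U a p ∂(P.prod halfLine)
      = ∑ k, 2 * ∫ s, ∫ u, a k s u ∂(cube N) ∂unif := by
  have hint : Integrable (blockProcess U a) (P.prod halfLine) :=
    memLp_one_iff_integrable.mp (memLp_blockProcess hU ha hC 1)
  have hmp := measurePreserving_firstVars hU hi hu N
  have hm : ∀ k s, Measurable (a k s) := fun k s => (ha k).comp measurable_prodMk_right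
  rw [integral_prod_symm _ hint]
  have e : ∀ t : ℝ, ∫ ω, blockProcess U a (ω, t) ∂P
      = ∑ k : Fin N, (Set.Ioo (2 * ((k : ℕ) : ℝ)) (2 * ((k : ℕ) : ℝ) + 2)).indicator
        (fun t => ∫ u, a k (t - 2 * ((k : ℕ) : ℝ) - 1) u ∂(cube N)) t := by
    intro t
    by_cases h : ∃ k : Fin N, t ∈ Set.Ioo (2 * ((k : ℕ) : ℝ)) (2 * ((k : ℕ) : ℝ) + 2)
    · obtain ⟨k, hk⟩ := h
      simp only [blockProcess_of_mem _ hk]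
      rw [Finset.sum_eq_single k, Set.indicator_of_mem hk]
      · exact integral_comp_measurePreserving hmp (hm k _).aestronglyMeasurable
      · intro j _ hj
        exact Set.indicator_of_notMem (fun h => hj (Fin.ext (block_unique h hk))) _
      · simp
    · push Not at h
      simp only [blockProcess_of_notMem _ h, integral_zero]
      exact (Finset.sum_eq_zero fun k _ => Set.indicator_of_notMem (h k) _).symm
  simp only [e]
  rw [integral_finsetSum]
  · exact Finset.sum_congr rfl fun k _ => integral_block (fun s => ∫ u, a k s u ∂(cube N)) k
  · intro k _
    rw [integrable_indicator_iff measurableSet_Ioo]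
    have hfin : IsFiniteMeasure (halfLine.restrict
        (Set.Ioo (2 * ((k : ℕ) : ℝ)) (2 * ((k : ℕ) : ℝ) + 2))) := by
      refine ⟨?_⟩
      rw [Measure.restrict_apply_univ, halfLine]
      exact (Measure.restrict_apply_le _ _).trans_lt (by simp)
    refine Integrable.of_bound (C := C k) ?_ (Eventually.of_forall fun t => ?_)
    · have : Measurable fun s => ∫ u, a k s u ∂(cube N) :=
        (StronglyMeasurable.integral_prod_left' (μ := cube N)
          (ha k).stronglyMeasurable).measurable
      exact (this.comp (by fun_prop)).aestronglyMeasurable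
    · simpa using norm_integral_le_of_norm_le_const (μ := cube N) (C := C k)
        (f := a k (t - 2 * ((k : ℕ) : ℝ) - 1)) (Eventually.of_forall fun u => hC k _ u)

/-- The gradient of `f(U₀, …, U_{N-1})`. -/
noncomputable def gradProcess (U : ℕ → Ω → ℝ) (f : (Fin N → ℝ) → ℝ) : Ω × ℝ → ℝ :=
  blockProcess U fun k => blockGrad k f

/-- The predictable projection of the gradient of `f(U₀, …, U_{N-1})`. -/
noncomputable def projProcess (U : ℕ → Ω → ℝ) (f : (Fin N → ℝ) → ℝ) : Ω × ℝ → ℝ :=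
  blockProcess U fun k => blockProj k f

theorem memLp_gradProcess (hU : ∀ k, Measurable (U k)) {f : (Fin N → ℝ) → ℝ}
    (hf : IsBoundedSmooth f) (q : ℝ≥0∞) : MemLp (gradProcess U f) q (P.prod halfLine) := by
  obtain ⟨C, hC⟩ := hf.exists_deriv_bound
  exact memLp_blockProcess hU (C := fun _ => C * 2) (fun k => measurable_blockGrad k hf)
    (fun k => abs_blockGrad_le k fun u => hC u k) q

theorem memLp_projProcess (hU : ∀ k, Measurable (U k)) {f : (Fin N → ℝ) → ℝ}
    (hf : IsBoundedSmooth f) (q : ℝ≥0∞) : MemLp (projProcess U f) q (P.prod halfLine) := by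
  obtain ⟨C, hC⟩ := hf.exists_bound
  exact memLp_blockProcess hU (C := fun _ => 2 * C)
    (fun k => measurable_blockProj k hf.smooth.continuous.measurable)
    (fun k => abs_blockProj_le k hC) q

/-- Inside block `k < N` the conditioning is on the first `k` variables up to null sets, so
`avg_blockGrad` applies. After the last block both processes vanish, and the block endpoints form a
null set of times. -/
theorem isCondExpProcess_gradProcess (hU : ∀ k, Measurable (U k)) (hi : iIndepFun U P)
    (hu : ∀ k, pdf.IsUniform (U k) (Set.Icc (-1) 1) P volume) {f : (Fin N → ℝ) → ℝ}
    (hf : IsBoundedSmooth f) : IsCondExpProcess U P (gradProcess U f) (projProcess U f) := by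
  refine ⟨(memLp_projProcess hU hf 1).1, ?_⟩
  filter_upwards [ae_halfLine_ne, ae_halfLine_nonneg] with t hne h0
  have hmem := mem_block h0 hne
  by_cases hN : ⌊t / 2⌋₊ < N
  · set k : Fin N := ⟨⌊t / 2⌋₊, hN⟩
    have hk : t ∈ Set.Ioo (2 * ((k : ℕ) : ℝ)) (2 * ((k : ℕ) : ℝ) + 2) := hmem
    obtain ⟨C, hC⟩ := hf.exists_deriv_bound
    simp only [gradProcess, projProcess, blockProcess_of_mem _ hk]
    have key := condExp_blockSigma hU hi hu (N := N) (k := k) hN.le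
      (ψ := blockGrad k f (t - 2 * ((k : ℕ) : ℝ) - 1))
      ((measurable_blockGrad k hf).comp measurable_prodMk_right)
      (abs_blockGrad_le k (fun u => hC u k) _)
    refine EventuallyEq.trans (Eventually.of_forall fun ω => ?_) key
    exact (avg_blockGrad k hf ⟨by linarith [hk.1], by linarith [hk.2]⟩ _).symm
  · have hout : ∀ k : Fin N, t ∉ Set.Ioo (2 * ((k : ℕ) : ℝ)) (2 * ((k : ℕ) : ℝ) + 2) :=
      fun k h => hN ((block_unique hmem h).symm ▸ k.2)
    simp only [gradProcess, projProcess, blockProcess_of_notMem _ hout]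
    have : (fun _ : Ω => (0 : ℝ)) = 0 := rfl
    rw [this, condExp_zero]

/-- The covariance formula. -/
theorem integral_gradProcess_mul_projProcess (hU : ∀ k, Measurable (U k)) (hi : iIndepFun U P)
    (hu : ∀ k, pdf.IsUniform (U k) (Set.Icc (-1) 1) P volume) {f h : (Fin N → ℝ) → ℝ}
    (hf : IsBoundedSmooth f) (hh : IsBoundedSmooth h) :
    ∫ p, gradProcess U h p * projProcess U f p ∂(P.prod halfLine)
      = 2 * ((∫ ω, h (firstVars U N ω) * f (firstVars U N ω) ∂P)
        - (∫ ω, h (firstVars U N ω) ∂P) * ∫ ω, f (firstVars U N ω) ∂P) := by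
  obtain ⟨A, hA⟩ := hf.exists_bound
  obtain ⟨B, hB⟩ := hh.exists_deriv_bound
  have hfm := hf.smooth.continuous.measurable
  have hhm := hh.smooth.continuous.measurable
  simp only [gradProcess, projProcess, blockProcess_mul]
  rw [integral_blockProcess hU hi hu (C := fun _ => B * 2 * (2 * A))
    (fun k => (measurable_blockGrad k hh).mul (measurable_blockProj k hfm))
    (fun k s u => by
      rw [abs_mul]
      exact mul_le_mul (abs_blockGrad_le k (fun u => hB u k) s u) (abs_blockProj_le k hA s u)
        (abs_nonneg _) ((abs_nonneg _).trans (abs_blockGrad_le k (fun u => hB u k) s u))),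
    ← Finset.mul_sum, sum_integral_blockGrad_mul_blockProj hf hh]
  have hmp := measurePreserving_firstVars hU hi hu N
  rw [← integral_comp_measurePreserving hmp (f := fun u => h u * f u)
      (hhm.mul hfm).aestronglyMeasurable,
    ← integral_comp_measurePreserving hmp hfm.aestronglyMeasurable,
    ← integral_comp_measurePreserving hmp hhm.aestronglyMeasurable]

/-- No growth condition on `φ` is needed, because `f` takes its values in a compact interval. -/
theorem IsBoundedSmooth.comp {f : (Fin N → ℝ) → ℝ} (hf : IsBoundedSmooth f) {φ φ' : ℝ → ℝ}
    (hφ : ∀ x, HasDerivAt φ (φ' x) x) (hc : Continuous φ') :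
    IsBoundedSmooth fun u => φ (f u) := by
  obtain ⟨A, hA⟩ := hf.exists_bound
  obtain ⟨B, hB⟩ := hf.exists_deriv_bound
  have hφc : Continuous φ := continuous_iff_continuousAt.mpr fun x => (hφ x).continuousAt
  obtain ⟨K, hK⟩ := (isCompact_Icc (a := -A) (b := A)).exists_bound_of_continuousOn hφc.continuousOn
  obtain ⟨K', hK'⟩ := (isCompact_Icc (a := -A) (b := A)).exists_bound_of_continuousOn hc.continuousOn
  have hmem : ∀ u, f u ∈ Set.Icc (-A) A := fun u => abs_le.mp (hA u)
  have hφs : ContDiff ℝ 1 φ := by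
    rw [contDiff_one_iff_deriv]
    refine ⟨fun x => (hφ x).differentiableAt, ?_⟩
    rwa [show deriv φ = φ' from funext fun x => (hφ x).deriv]
  refine ⟨hφs.comp hf.smooth, ⟨K, fun u => hK _ (hmem u)⟩, ⟨K' * B, fun u k => ?_⟩⟩
  have hd := (hφ (f u)).comp_hasFDerivAt u
    (hf.smooth.differentiable one_ne_zero).differentiableAt.hasFDerivAt
  have e : fderiv ℝ (fun u => φ (f u)) u = φ' (f u) • fderiv ℝ f u := hd.fderiv
  rw [e]
  simp only [_root_.smul_apply, smul_eq_mul, abs_mul]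
  exact mul_le_mul (hK' _ (hmem u)) (hB u k) (abs_nonneg _)
    ((norm_nonneg _).trans (hK' _ (hmem u)))

theorem gradProcess_comp {f : (Fin N → ℝ) → ℝ} (hf : IsBoundedSmooth f) {φ φ' : ℝ → ℝ}
    (hφ : ∀ x, HasDerivAt φ (φ' x) x) (p : Ω × ℝ) :
    gradProcess U (fun u => φ (f u)) p = φ' (f (firstVars U N p.1)) * gradProcess U f p := by
  have e : ∀ (k : Fin N) (s : ℝ) u,
      blockGrad k (fun u => φ (f u)) s u = φ' (f u) * blockGrad k f s u := by
    intro k s u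
    have hd := (hφ (f u)).comp_hasFDerivAt u
      (hf.smooth.differentiable one_ne_zero).differentiableAt.hasFDerivAt
    have e : fderiv ℝ (fun u => φ (f u)) u = φ' (f u) • fderiv ℝ f u := hd.fderiv
    simp only [blockGrad, partialDeriv, e, _root_.smul_apply, smul_eq_mul, mul_assoc]
  simp only [gradProcess, blockProcess, e, Finset.mul_sum]
  refine Finset.sum_congr rfl fun k _ => ?_
  by_cases h : p.2 ∈ Set.Ioo (2 * ((k : ℕ) : ℝ)) (2 * ((k : ℕ) : ℝ) + 2) <;> simp [Set.indicator, h]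

/-- The covariance formula for a functional and a function of it. -/
theorem integral_deriv_mul_gradProcess_mul_projProcess (hU : ∀ k, Measurable (U k))
    (hi : iIndepFun U P) (hu : ∀ k, pdf.IsUniform (U k) (Set.Icc (-1) 1) P volume)
    {f : (Fin N → ℝ) → ℝ} (hf : IsBoundedSmooth f) {φ φ' : ℝ → ℝ}
    (hφ : ∀ x, HasDerivAt φ (φ' x) x) (hc : Continuous φ') :
    ∫ p, φ' (f (firstVars U N p.1)) * (gradProcess U f p * projProcess U f p) ∂(P.prod halfLine)
      = 2 * ((∫ ω, φ (f (firstVars U N ω)) * f (firstVars U N ω) ∂P)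
        - (∫ ω, φ (f (firstVars U N ω)) ∂P) * ∫ ω, f (firstVars U N ω) ∂P) := by
  rw [← integral_gradProcess_mul_projProcess hU hi hu hf (hf.comp hφ hc)]
  simp only [gradProcess_comp hf hφ, mul_assoc]

/-- Multiply by a smooth bump equal to 1 on the unit ball, which is the cube in the sup norm.
Agreement near each interior point transfers the derivative as well as the value. -/
theorem exists_isBoundedSmooth_eqOn {f : (Fin N → ℝ) → ℝ} (hf : ContDiff ℝ 1 f) :
    ∃ g : (Fin N → ℝ) → ℝ, IsBoundedSmooth g ∧
      ∀ u, (∀ i, u i ∈ Set.Ioo (-1 : ℝ) 1) → g =ᶠ[𝓝 u] f := by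
  let b : ContDiffBump (0 : Fin N → ℝ) := ⟨1, 2, one_pos, by norm_num⟩
  have hs : ContDiff ℝ 1 fun u => b u * f u := b.contDiff.mul hf
  have hcs : HasCompactSupport fun u => b u * f u := b.hasCompactSupport.mul_right
  refine ⟨fun u => b u * f u, ⟨hs, ?_, ?_⟩, fun u hu => ?_⟩
  · obtain ⟨C, hC⟩ := hs.continuous.bounded_above_of_compact_support hcs
    exact ⟨C, hC⟩
  · obtain ⟨C, hC⟩ := (hs.continuous_fderiv one_ne_zero).bounded_above_of_compact_support
      (hcs.fderiv ℝ)
    refine ⟨C, fun u k => ?_⟩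
    have h1 := ContinuousLinearMap.le_opNorm (fderiv ℝ (fun u => b u * f u) u)
      (Pi.single k (1 : ℝ))
    rw [Pi.norm_single] at h1
    simp only [norm_one, mul_one] at h1
    exact h1.trans (hC u)
  · have hmem : u ∈ Metric.ball (0 : Fin N → ℝ) 1 := by
      rw [mem_ball_zero_iff, pi_norm_lt_iff one_pos]
      exact fun i => abs_lt.mpr (hu i)
    filter_upwards [Metric.isOpen_ball.mem_nhds hmem] with v hv
    rw [b.one_of_mem_closedBall (Metric.ball_subset_closedBall hv), one_mul]

theorem grad_term_eq {x t : ℝ} (hx : x ∈ Set.Ioo (-1 : ℝ) 1) (k : ℕ) (ht : t ≠ 2 * (k : ℝ) + 2)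
    (c : ℝ) :
    c * ((Set.Ioc (2 * (k : ℝ)) (2 * (k : ℝ) + 1 + x)).indicator (fun _ => 1 - x) t
        - (Set.Ioc (2 * (k : ℝ) + 1 + x) (2 * (k : ℝ) + 2)).indicator (fun _ => 1 + x) t)
      = (Set.Ioo (2 * (k : ℝ)) (2 * (k : ℝ) + 2)).indicator
        (fun t => c * blockKernel (t - 2 * (k : ℝ) - 1) (max (-1) (min 1 x))) t := by
  rw [clip_eq ⟨hx.1.le, hx.2.le⟩]
  by_cases h1 : 2 * (k : ℝ) < t
  · by_cases h2 : t < 2 * (k : ℝ) + 2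
    · by_cases h3 : t ≤ 2 * (k : ℝ) + 1 + x
      · have h4 : t - 2 * (k : ℝ) - 1 ≤ x := by linarith
        simp [Set.indicator, h1, h2, h3, blockKernel, not_lt.mpr h3, h4]
        left
        ring
      · have h4 : ¬ t - 2 * (k : ℝ) - 1 ≤ x := by intro h; exact h3 (by linarith)
        simp [Set.indicator, h1, h2, h3, blockKernel, not_le.mp h3, h4, h2.le]
    · have h3 : 2 * (k : ℝ) + 2 < t := lt_of_le_of_ne (not_lt.mp h2) ht.symm
      have h4 : ¬ t ≤ 2 * (k : ℝ) + 1 + x := by intro h; linarith [hx.2]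
      simp [Set.indicator, h2, h4, not_le.mpr h3]
  · have h4 : ¬ 2 * (k : ℝ) + 1 + x < t := by intro h; linarith [hx.1]
    simp [Set.indicator, h1, h4]

/-- Every cylindrical functional can be replaced by one with a bounded function. -/
theorem SmoothFunctional.exists_bounded (hU : ∀ k, Measurable (U k))
    (hu : ∀ k, pdf.IsUniform (U k) (Set.Icc (-1) 1) P volume) (F : SmoothFunctional) :
    ∃ g : (Fin (F.n + 1) → ℝ) → ℝ, IsBoundedSmooth g ∧
      F.eval U =ᵐ[P] (fun ω => g (firstVars U (F.n + 1) ω)) ∧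
      F.grad U =ᵐ[P.prod halfLine] gradProcess U g := by
  obtain ⟨g, hg, hgf⟩ := exists_isBoundedSmooth_eqOn F.smooth
  have hω := ae_mem_Ioo hU hu
  refine ⟨g, hg, ?_, ?_⟩
  · filter_upwards [hω] with ω h
    exact (hgf (firstVars U (F.n + 1) ω) fun i => h i).eq_of_nhds.symm
  · have h1 : ∀ᵐ p ∂(P.prod halfLine), ∀ k, U k p.1 ∈ Set.Ioo (-1 : ℝ) 1 :=
      Measure.quasiMeasurePreserving_fst.ae hω
    have h2 : ∀ᵐ p ∂(P.prod halfLine), ∀ k : ℕ, p.2 ≠ 2 * (k : ℝ) :=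
      Measure.quasiMeasurePreserving_snd.ae ae_halfLine_ne
    filter_upwards [h1, h2] with p hp hne
    simp only [SmoothFunctional.grad, gradProcess, blockProcess]
    refine Finset.sum_congr rfl fun k _ => ?_
    have e : fderiv ℝ F.f (fun i => U i p.1) = fderiv ℝ g (firstVars U (F.n + 1) p.1) :=
      ((hgf (firstVars U (F.n + 1) p.1) fun i => hp i).fderiv_eq).symm
    rw [e, grad_term_eq (hp k) k (by have := hne (k + 1); push_cast at this; intro h; apply this; linarith)]
    rfl

end

end UniformMalliavin

namespace UniformMalliavin

/-! ### Convergence of products in `L¹` -/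

section Products

variable {α : Type*} {mα : MeasurableSpace α} {μ : Measure α}

theorem eLpNorm_mul_le_two {f g : α → ℝ} (hf : AEStronglyMeasurable f μ)
    (hg : AEStronglyMeasurable g μ) :
    eLpNorm (fun x => f x * g x) 1 μ ≤ eLpNorm f 2 μ * eLpNorm g 2 μ :=
  (eLpNorm_le_eLpNorm_mul_eLpNorm_of_nnnorm (p := 2) (q := 2) (r := 1) hf hg
    (fun a b : ℝ => a * b) 1 (Eventually.of_forall fun x => by simp)).trans (by simp)

/-- Expand `us vs - u v` as `(us - u)(vs - v) + (us - u) v + u (vs - v)` and apply Cauchy–Schwarz to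
each term. -/
theorem tendsto_eLpNorm_mul_sub {ι : Type*} {l : Filter ι} {u v : α → ℝ} {us vs : ι → α → ℝ}
    (hu : MemLp u 2 μ) (hv : MemLp v 2 μ) (hus : ∀ i, MemLp (us i) 2 μ)
    (hvs : ∀ i, MemLp (vs i) 2 μ) (h1 : Tendsto (fun i => eLpNorm (us i - u) 2 μ) l (𝓝 0))
    (h2 : Tendsto (fun i => eLpNorm (vs i - v) 2 μ) l (𝓝 0)) :
    Tendsto (fun i => eLpNorm ((fun x => us i x * vs i x) - fun x => u x * v x) 1 μ) l (𝓝 0) := by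
  have hlim : Tendsto (fun i => eLpNorm (us i - u) 2 μ * eLpNorm (vs i - v) 2 μ
      + eLpNorm (us i - u) 2 μ * eLpNorm v 2 μ + eLpNorm u 2 μ * eLpNorm (vs i - v) 2 μ) l
      (𝓝 0) := by
    have t1 := ENNReal.Tendsto.mul h1 (Or.inr ENNReal.zero_ne_top) h2
      (Or.inr ENNReal.zero_ne_top)
    have t2 := ENNReal.Tendsto.mul_const h1 (Or.inr hv.2.ne)
    have t3 := ENNReal.Tendsto.const_mul h2 (Or.inr hu.2.ne)
    simpa using (t1.add t2).add t3
  refine tendsto_of_tendsto_of_tendsto_of_le_of_le tendsto_const_nhds hlim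
    (fun i => zero_le) fun i => ?_
  have m1 : AEStronglyMeasurable (us i - u) μ := (hus i).1.sub hu.1
  have m2 : AEStronglyMeasurable (vs i - v) μ := (hvs i).1.sub hv.1
  have e : ((fun x => us i x * vs i x) - fun x => u x * v x)
      = ((fun x => (us i - u) x * (vs i - v) x) + fun x => (us i - u) x * v x)
        + fun x => u x * (vs i - v) x := by
    funext x
    simp only [Pi.sub_apply, Pi.add_apply]
    ring
  rw [e]
  refine (eLpNorm_add_le ((m1.mul m2).add (m1.mul hv.1)) (hu.1.mul m2) le_rfl).trans ?_
  refine add_le_add ((eLpNorm_add_le (m1.mul m2) (m1.mul hv.1) le_rfl).trans ?_)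
    (eLpNorm_mul_le_two hu.1 m2)
  exact add_le_add (eLpNorm_mul_le_two m1 m2) (eLpNorm_mul_le_two m1 hv.1)

theorem tendsto_integral_mul {ι : Type*} {l : Filter ι} {u v : α → ℝ} {us vs : ι → α → ℝ}
    (hu : MemLp u 2 μ) (hv : MemLp v 2 μ) (hus : ∀ i, MemLp (us i) 2 μ)
    (hvs : ∀ i, MemLp (vs i) 2 μ) (h1 : Tendsto (fun i => eLpNorm (us i - u) 2 μ) l (𝓝 0))
    (h2 : Tendsto (fun i => eLpNorm (vs i - v) 2 μ) l (𝓝 0)) :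
    Tendsto (fun i => ∫ x, us i x * vs i x ∂μ) l (𝓝 (∫ x, u x * v x ∂μ)) :=
  tendsto_integral_of_L1' _ (hu.1.mul hv.1)
    (Eventually.of_forall fun i => (hus i).integrable_mul (hvs i))
    (tendsto_eLpNorm_mul_sub hu hv hus hvs h1 h2)

theorem abs_sub_le_of_hasDerivAt {φ φ' : ℝ → ℝ} (hφ : ∀ x, HasDerivAt φ (φ' x) x) {K : ℝ}
    (hK : ∀ x, |φ' x| ≤ K) (x y : ℝ) : |φ x - φ y| ≤ K * |x - y| :=
  Convex.norm_image_sub_le_of_norm_hasDerivWithin_le (s := Set.univ)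
    (fun x _ => (hφ x).hasDerivWithinAt) (fun x _ => hK x) convex_univ trivial trivial

theorem memLp_comp_of_deriv_le [IsFiniteMeasure μ] {φ φ' : ℝ → ℝ}
    (hφ : ∀ x, HasDerivAt φ (φ' x) x) {K : ℝ} (hK : ∀ x, |φ' x| ≤ K) {X : α → ℝ} {q : ℝ≥0∞}
    (hX : MemLp X q μ) : MemLp (fun ω => φ (X ω)) q μ := by
  have hφc : Continuous φ := continuous_iff_continuousAt.mpr fun x => (hφ x).continuousAt
  refine MemLp.mono' ((memLp_const |φ 0|).add (hX.norm.const_mul K))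
    (hφc.comp_aestronglyMeasurable hX.1) (Eventually.of_forall fun ω => ?_)
  have h1 := abs_sub_le_of_hasDerivAt hφ hK (X ω) 0
  have h2 := abs_add_le (φ (X ω) - φ 0) (φ 0)
  rw [sub_add_cancel] at h2
  rw [sub_zero] at h1
  simp only [Pi.add_apply, Real.norm_eq_abs]
  linarith

end Products

section Limits

set_option linter.unusedSectionVars false

variable {Ω : Type*} [mΩ : MeasurableSpace Ω] {P : Measure Ω} [IsProbabilityMeasure P]
  {U : ℕ → Ω → ℝ}

/-! ### Predictable projections in `L²` -/

theorem sq_eLpNorm_eq_lintegral {α : Type*} {mα : MeasurableSpace α} (μ : Measure α)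
    (f : α → ℝ) : eLpNorm f 2 μ ^ 2 = ∫⁻ x, ‖f x‖ₑ ^ 2 ∂μ := by
  have := eLpNorm_nnreal_pow_eq_lintegral (μ := μ) (f := f) (p := 2) two_ne_zero
  simpa using this

theorem sq_eLpNorm_prod {f : Ω × ℝ → ℝ} (hf : AEStronglyMeasurable f (P.prod halfLine)) :
    eLpNorm f 2 (P.prod halfLine) ^ 2
      = ∫⁻ t, eLpNorm (fun ω => f (ω, t)) 2 P ^ 2 ∂halfLine := by
  simp only [sq_eLpNorm_eq_lintegral]
  exact lintegral_prod_symm _ (hf.enorm.pow_const 2)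

theorem aemeasurable_sq_eLpNorm_slice {f : Ω × ℝ → ℝ}
    (hf : AEStronglyMeasurable f (P.prod halfLine)) :
    AEMeasurable (fun t => eLpNorm (fun ω => f (ω, t)) 2 P ^ 2) halfLine := by
  simp only [sq_eLpNorm_eq_lintegral]
  exact (hf.enorm.pow_const 2).lintegral_prod_left'

theorem ae_memLp_slice {f : Ω × ℝ → ℝ} (hf : MemLp f 2 (P.prod halfLine)) :
    ∀ᵐ t ∂halfLine, MemLp (fun ω => f (ω, t)) 2 P := by
  have h1 := sq_eLpNorm_prod hf.1
  have h2 : ∫⁻ t, eLpNorm (fun ω => f (ω, t)) 2 P ^ 2 ∂halfLine ≠ ∞ := by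
    rw [← h1]
    exact ENNReal.pow_ne_top hf.2.ne
  filter_upwards [ae_lt_top' (aemeasurable_sq_eLpNorm_slice hf.1) h2, hf.1.prodMk_right]
    with t ht hm
  refine ⟨hm, ?_⟩
  by_contra h
  rw [not_lt_top_iff] at h
  simp [h] at ht

/-- The `L²` contraction of conditional expectation, applied at almost every time and integrated. -/
theorem IsCondExpProcess.eLpNorm_le {Z V : Ω × ℝ → ℝ} (h : IsCondExpProcess U P Z V)
    (hZ : AEStronglyMeasurable Z (P.prod halfLine)) :
    eLpNorm V 2 (P.prod halfLine) ≤ eLpNorm Z 2 (P.prod halfLine) := by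
  have : eLpNorm V 2 (P.prod halfLine) ^ 2 ≤ eLpNorm Z 2 (P.prod halfLine) ^ 2 := by
    rw [sq_eLpNorm_prod hZ, sq_eLpNorm_prod h.aestronglyMeasurable]
    refine lintegral_mono_ae ?_
    filter_upwards [h.ae_eq_condExp] with t ht
    rw [eLpNorm_congr_ae ht]
    gcongr
    exact eLpNorm_condExp_le_eLpNorm _ one_le_two
  exact (ENNReal.pow_le_pow_left_iff two_ne_zero).mp this

theorem IsCondExpProcess.memLp {Z V : Ω × ℝ → ℝ} (h : IsCondExpProcess U P Z V)
    (hZ : MemLp Z 2 (P.prod halfLine)) : MemLp V 2 (P.prod halfLine) :=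
  ⟨h.aestronglyMeasurable, (h.eLpNorm_le hZ.1).trans_lt hZ.2⟩

theorem IsCondExpProcess.sub {Z V Z' V' : Ω × ℝ → ℝ} (h : IsCondExpProcess U P Z V)
    (h' : IsCondExpProcess U P Z' V') (hZ : MemLp Z 2 (P.prod halfLine))
    (hZ' : MemLp Z' 2 (P.prod halfLine)) : IsCondExpProcess U P (Z - Z') (V - V') := by
  refine ⟨h.aestronglyMeasurable.sub h'.aestronglyMeasurable, ?_⟩
  filter_upwards [h.ae_eq_condExp, h'.ae_eq_condExp, ae_memLp_slice hZ, ae_memLp_slice hZ']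
    with t e e' m m'
  have := condExp_sub (m.integrable one_le_two) (m'.integrable one_le_two) (blockSigma U t)
  exact (e.sub e').trans this.symm

/-- Limits of predictable projections. -/
theorem isCondExpProcess_of_tendsto {Z V : Ω × ℝ → ℝ} {Zs Vs : ℕ → Ω × ℝ → ℝ}
    (hZ : MemLp Z 2 (P.prod halfLine)) (hV : MemLp V 2 (P.prod halfLine))
    (hZs : ∀ n, MemLp (Zs n) 2 (P.prod halfLine))
    (h : ∀ n, IsCondExpProcess U P (Zs n) (Vs n))
    (h1 : Tendsto (fun n => eLpNorm (Zs n - Z) 2 (P.prod halfLine)) atTop (𝓝 0))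
    (h2 : Tendsto (fun n => eLpNorm (Vs n - V) 2 (P.prod halfLine)) atTop (𝓝 0)) :
    IsCondExpProcess U P Z V := by
  refine ⟨hV.1, ?_⟩
  have hVs : ∀ n, MemLp (Vs n) 2 (P.prod halfLine) := fun n => (h n).memLp (hZs n)
  set b : ℕ → ℝ → ℝ≥0∞ := fun n t => eLpNorm (fun ω => (Zs n - Z) (ω, t)) 2 P with hb
  set c : ℕ → ℝ → ℝ≥0∞ := fun n t => eLpNorm (fun ω => (Vs n - V) (ω, t)) 2 P with hc
  have mb : ∀ n, AEMeasurable (fun t => b n t ^ 2) halfLine := fun n =>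
    aemeasurable_sq_eLpNorm_slice ((hZs n).1.sub hZ.1)
  have mc : ∀ n, AEMeasurable (fun t => c n t ^ 2) halfLine := fun n =>
    aemeasurable_sq_eLpNorm_slice ((hVs n).1.sub hV.1)
  have hlim : Tendsto (fun n => ∫⁻ t, (b n t ^ 2 + c n t ^ 2) ∂halfLine) atTop (𝓝 0) := by
    have e : ∀ n, ∫⁻ t, (b n t ^ 2 + c n t ^ 2) ∂halfLine
        = eLpNorm (Zs n - Z) 2 (P.prod halfLine) ^ 2
          + eLpNorm (Vs n - V) 2 (P.prod halfLine) ^ 2 := fun n => by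
      rw [lintegral_add_left' (mb n), sq_eLpNorm_prod ((hZs n).1.sub hZ.1),
        sq_eLpNorm_prod ((hVs n).1.sub hV.1)]
    simp only [e]
    simpa using (ENNReal.Tendsto.pow (n := 2) h1).add (ENNReal.Tendsto.pow (n := 2) h2)
  -- Fatou: at almost every time, the slice errors of both sequences are simultaneously small for
  -- some `n`, which suffices and avoids extracting a subsequence.
  have hfat := lintegral_liminf_le' (u := atTop) fun n => (mb n).add (mc n)
  simp only [Pi.add_apply] at hfat
  have hmeas : AEMeasurable (fun t => liminf (fun n => b n t ^ 2 + c n t ^ 2) atTop) halfLine := by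
    simp only [liminf_eq_iSup_iInf_of_nat]
    exact AEMeasurable.iSup fun n => AEMeasurable.iInf fun i => AEMeasurable.iInf fun _ =>
      (mb i).add (mc i)
  rw [hlim.liminf_eq, nonpos_iff_eq_zero, lintegral_eq_zero_iff' hmeas] at hfat
  have hall : ∀ᵐ t ∂halfLine, ∀ n, (fun ω => Vs n (ω, t)) =ᵐ[P]
      P[fun ω => Zs n (ω, t) | blockSigma U t] := ae_all_iff.mpr fun n => (h n).ae_eq_condExp
  have hmem : ∀ᵐ t ∂halfLine, ∀ n, MemLp (fun ω => Zs n (ω, t)) 2 P :=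
    ae_all_iff.mpr fun n => ae_memLp_slice (hZs n)
  have hmemV : ∀ᵐ t ∂halfLine, ∀ n, MemLp (fun ω => Vs n (ω, t)) 2 P :=
    ae_all_iff.mpr fun n => ae_memLp_slice (hVs n)
  filter_upwards [hfat, hall, hmem, hmemV, ae_memLp_slice hZ, ae_memLp_slice hV]
    with t ht hcond hZst hVst hZt hVt
  set v : Ω → ℝ := fun ω => V (ω, t) with hv
  set z : Ω → ℝ := fun ω => Z (ω, t) with hz
  have hcm : AEStronglyMeasurable (P[z | blockSigma U t]) P := integrable_condExp.1
  have hD : ∀ n, eLpNorm (v - P[z | blockSigma U t]) 2 P ≤ c n t + b n t := by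
    intro n
    have hzs : eLpNorm ((fun ω => Vs n (ω, t)) - P[z | blockSigma U t]) 2 P ≤ b n t := by
      have e := condExp_sub ((hZst n).integrable one_le_two) (hZt.integrable one_le_two)
        (blockSigma U t)
      have e' : (fun ω => Vs n (ω, t)) - P[z | blockSigma U t] =ᵐ[P]
          P[(fun ω => Zs n (ω, t)) - z | blockSigma U t] :=
        ((hcond n).sub (EventuallyEq.refl _ _)).trans e.symm
      rw [eLpNorm_congr_ae e']
      exact eLpNorm_condExp_le_eLpNorm _ one_le_two
    have e : v - P[z | blockSigma U t] = (v - fun ω => Vs n (ω, t))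
        + ((fun ω => Vs n (ω, t)) - P[z | blockSigma U t]) := by abel
    rw [e]
    refine (eLpNorm_add_le (hVt.1.sub (hVst n).1) ((hVst n).1.sub hcm) one_le_two).trans ?_
    refine add_le_add ?_ hzs
    rw [eLpNorm_sub_comm]
    rfl
  have hD0 : eLpNorm (v - P[z | blockSigma U t]) 2 P = 0 := by
    refine le_antisymm (ENNReal.le_of_forall_pos_le_add fun ε hε _ => ?_) zero_le
    have hε2 : (0 : ℝ≥0∞) < ((ε / 2 : NNReal) : ℝ≥0∞) ^ 2 := by
      have : (0 : ℝ≥0∞) < ((ε / 2 : NNReal) : ℝ≥0∞) := by exact_mod_cast half_pos hε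
      positivity
    have ht' : liminf (fun n => b n t ^ 2 + c n t ^ 2) atTop
        < ((ε / 2 : NNReal) : ℝ≥0∞) ^ 2 := by
      have : liminf (fun n => b n t ^ 2 + c n t ^ 2) atTop = 0 := ht
      rw [this]
      exact hε2
    obtain ⟨n, hn⟩ := (frequently_lt_of_liminf_lt (by isBoundedDefault) ht').exists
    have hbn : b n t ≤ (ε / 2 : NNReal) :=
      (ENNReal.pow_le_pow_left_iff two_ne_zero).mp (le_self_add.trans hn.le)
    have hcn : c n t ≤ (ε / 2 : NNReal) :=
      (ENNReal.pow_le_pow_left_iff two_ne_zero).mp (le_add_self.trans hn.le)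
    refine (hD n).trans ((add_le_add hcn hbn).trans ?_)
    rw [zero_add, ← ENNReal.coe_add, add_halves]
  rw [eLpNorm_eq_zero_iff (hVt.1.sub hcm) two_ne_zero] at hD0
  filter_upwards [hD0] with ω hω
  exact sub_eq_zero.mp hω

/-- The predictable projection of an `L²` limit exists. -/
theorem exists_isCondExpProcess_of_tendsto {Z : Ω × ℝ → ℝ} {Zs Vs : ℕ → Ω × ℝ → ℝ}
    (hZ : MemLp Z 2 (P.prod halfLine)) (hZs : ∀ n, MemLp (Zs n) 2 (P.prod halfLine))
    (h : ∀ n, IsCondExpProcess U P (Zs n) (Vs n))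
    (h1 : Tendsto (fun n => eLpNorm (Zs n - Z) 2 (P.prod halfLine)) atTop (𝓝 0)) :
    ∃ V, IsCondExpProcess U P Z V := by
  have hVs : ∀ n, MemLp (Vs n) 2 (P.prod halfLine) := fun n => (h n).memLp (hZs n)
  have hcau : CauchySeq fun n => (hZs n).toLp (Zs n) :=
    ((Lp.tendsto_Lp_iff_tendsto_eLpNorm'' Zs hZs Z hZ).mpr h1).cauchySeq
  -- Contraction makes the projections Cauchy along with the processes; completeness then supplies a
  -- jointly measurable limit.
  have hcau' : CauchySeq fun n => (hVs n).toLp (Vs n) := by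
    rw [EMetric.cauchySeq_iff] at hcau ⊢
    intro ε hε
    obtain ⟨N, hN⟩ := hcau ε hε
    refine ⟨N, fun m hm n hn => ?_⟩
    have := hN m hm n hn
    rw [Lp.edist_toLp_toLp] at this ⊢
    exact (((h m).sub (h n) (hZs m) (hZs n)).eLpNorm_le ((hZs m).1.sub (hZs n).1)).trans_lt this
  obtain ⟨V, hV⟩ := cauchySeq_tendsto_of_complete hcau'
  have hVm : MemLp V 2 (P.prod halfLine) := Lp.memLp V
  rw [← Lp.toLp_coeFn V hVm, Lp.tendsto_Lp_iff_tendsto_eLpNorm'' Vs hVs V hVm] at hV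
  exact ⟨V, isCondExpProcess_of_tendsto hZ hVm hZs h h1 hV⟩

/-! ### The Stein kernel identity -/

/-- Approximation by bounded cylindrical functionals, almost surely and in `L²`. -/
theorem HasGradient.exists_bounded_approx (hU : ∀ k, Measurable (U k))
    (hu : ∀ k, pdf.IsUniform (U k) (Set.Icc (-1) 1) P volume) {X : Ω → ℝ} {DX : Ω × ℝ → ℝ}
    (hX : HasGradient U P X DX) :
    ∃ (N : ℕ → ℕ) (g : ∀ n, (Fin (N n) → ℝ) → ℝ), (∀ n, IsBoundedSmooth (g n)) ∧
      Tendsto (fun n => eLpNorm ((fun ω => g n (firstVars U (N n) ω)) - X) 2 P) atTop (𝓝 0) ∧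
      Tendsto (fun n => eLpNorm (gradProcess U (g n) - DX) 2 (P.prod halfLine)) atTop (𝓝 0) ∧
      ∀ᵐ ω ∂P, Tendsto (fun n => g n (firstVars U (N n) ω)) atTop (𝓝 (X ω)) := by
  obtain ⟨F, h1, h2⟩ := hX.exists_approx
  choose g hg e1 e2 using fun n => (F n).exists_bounded (P := P) hU hu
  have t1 : Tendsto (fun n => eLpNorm ((fun ω => g n (firstVars U ((F n).n + 1) ω)) - X) 2 P)
      atTop (𝓝 0) := by
    refine h1.congr fun n => eLpNorm_congr_ae ?_
    filter_upwards [e1 n] with ω h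
    simp only [h, Pi.sub_apply]
  have t2 : Tendsto (fun n => eLpNorm (gradProcess U (g n) - DX) 2 (P.prod halfLine))
      atTop (𝓝 0) := by
    refine h2.congr fun n => eLpNorm_congr_ae ?_
    filter_upwards [e2 n] with ω h
    simp only [h, Pi.sub_apply]
  have hmeas : ∀ n, AEStronglyMeasurable (fun ω => g n (firstVars U ((F n).n + 1) ω)) P :=
    fun n => ((hg n).smooth.continuous.measurable.comp
      (measurable_firstVars hU _)).aestronglyMeasurable
  obtain ⟨ns, hns, hae⟩ := (tendstoInMeasure_of_tendsto_eLpNorm two_ne_zero hmeas hX.memLp.1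
    t1).exists_seq_tendsto_ae
  exact ⟨fun n => (F (ns n)).n + 1, fun n => g (ns n), fun n => hg _,
    t1.comp hns.tendsto_atTop, t2.comp hns.tendsto_atTop, hae⟩

theorem HasGradient.exists_isCondExpProcess (hU : ∀ k, Measurable (U k)) (hi : iIndepFun U P)
    (hu : ∀ k, pdf.IsUniform (U k) (Set.Icc (-1) 1) P volume) {X : Ω → ℝ} {DX : Ω × ℝ → ℝ}
    (hX : HasGradient U P X DX) : ∃ V, IsCondExpProcess U P DX V := by
  obtain ⟨N, g, hg, -, h2, -⟩ := hX.exists_bounded_approx hU hu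
  exact exists_isCondExpProcess_of_tendsto hX.memLp_grad (fun n => memLp_gradProcess hU (hg n) 2)
    (fun n => isCondExpProcess_gradProcess hU hi hu (hg n)) h2

/-- The covariance formula passes to the limit along bounded cylindrical approximations. On the
right, `φ` is Lipschitz and `L²` convergence suffices. On the left, `φ'` is only bounded and
continuous, hence the need for an almost surely convergent subsequence. -/
theorem HasGradient.integral_deriv_mul (hU : ∀ k, Measurable (U k)) (hi : iIndepFun U P)
    (hu : ∀ k, pdf.IsUniform (U k) (Set.Icc (-1) 1) P volume) {X : Ω → ℝ} {DX V : Ω × ℝ → ℝ}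
    (hX : HasGradient U P X DX) (hV : IsCondExpProcess U P DX V) {φ φ' : ℝ → ℝ}
    (hφ : ∀ x, HasDerivAt φ (φ' x) x) (hc : Continuous φ') {K : ℝ} (hK : ∀ x, |φ' x| ≤ K) :
    ∫ p, φ' (X p.1) * (DX p * V p) ∂(P.prod halfLine)
      = 2 * ((∫ ω, φ (X ω) * X ω ∂P) - (∫ ω, φ (X ω) ∂P) * ∫ ω, X ω ∂P) := by
  obtain ⟨N, g, hg, h1, h2, hae⟩ := hX.exists_bounded_approx hU hu
  have hVm := hV.memLp hX.memLp_grad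
  set Xs : ℕ → Ω → ℝ := fun n ω => g n (firstVars U (N n) ω) with hXs
  have hXsm : ∀ n, MemLp (Xs n) 2 P := fun n => by
    obtain ⟨C, hC⟩ := (hg n).exists_bound
    exact MemLp.of_bound ((hg n).smooth.continuous.measurable.comp
      (measurable_firstVars hU _)).aestronglyMeasurable C (Eventually.of_forall fun ω => hC _)
  have hproj : ∀ n, IsCondExpProcess U P (gradProcess U (g n)) (projProcess U (g n)) := fun n =>
    isCondExpProcess_gradProcess hU hi hu (hg n)
  have hgm : ∀ n, MemLp (gradProcess U (g n)) 2 (P.prod halfLine) := fun n =>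
    memLp_gradProcess hU (hg n) 2
  have hpm : ∀ n, MemLp (projProcess U (g n)) 2 (P.prod halfLine) := fun n =>
    memLp_projProcess hU (hg n) 2
  have h3 : Tendsto (fun n => eLpNorm (projProcess U (g n) - V) 2 (P.prod halfLine)) atTop
      (𝓝 0) :=
    tendsto_of_tendsto_of_tendsto_of_le_of_le tendsto_const_nhds h2 (fun n => zero_le)
      fun n => ((hproj n).sub hV (hgm n) hX.memLp_grad).eLpNorm_le
        ((hgm n).1.sub hX.memLp_grad.1)
  have hφXs : ∀ n, MemLp (fun ω => φ (Xs n ω)) 2 P := fun n =>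
    memLp_comp_of_deriv_le hφ hK (hXsm n)
  have hφX : MemLp (fun ω => φ (X ω)) 2 P := memLp_comp_of_deriv_le hφ hK hX.memLp
  have h4 : Tendsto (fun n => eLpNorm ((fun ω => φ (Xs n ω)) - fun ω => φ (X ω)) 2 P) atTop
      (𝓝 0) := by
    have lim := ENNReal.Tendsto.const_mul (a := ENNReal.ofReal K) h1
      (Or.inr ENNReal.ofReal_ne_top)
    rw [mul_zero] at lim
    exact tendsto_of_tendsto_of_tendsto_of_le_of_le tendsto_const_nhds lim (fun n => zero_le)
      fun n => eLpNorm_le_mul_eLpNorm_of_ae_le_mul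
        (Eventually.of_forall fun ω => abs_sub_le_of_hasDerivAt hφ hK _ _) 2
  have h1c : Tendsto (fun _ : ℕ => eLpNorm ((fun _ : Ω => (1 : ℝ)) - fun _ => 1) 2 P) atTop
      (𝓝 0) := by simp
  have m1 : MemLp (fun _ : Ω => (1 : ℝ)) 2 P := memLp_const 1
  have r1 := tendsto_integral_mul hφX hX.memLp hφXs hXsm h4 h1
  have r2 := tendsto_integral_mul hφX m1 hφXs (fun _ => m1) h4 h1c
  have r3 := tendsto_integral_mul hX.memLp m1 hXsm (fun _ => m1) h1 h1c
  simp only [mul_one] at r2 r3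
  have rhs := (r1.sub (r2.mul r3)).const_mul 2
  refine tendsto_nhds_unique ?_ (rhs.congr fun n =>
    (integral_deriv_mul_gradProcess_mul_projProcess hU hi hu (hg n) hφ hc).symm)
  have hZV : Integrable (fun p => DX p * V p) (P.prod halfLine) := hX.memLp_grad.integrable_mul hVm
  have hZVs : ∀ n, Integrable (fun p => gradProcess U (g n) p * projProcess U (g n) p)
    (P.prod halfLine) := fun n => (hgm n).integrable_mul (hpm n)
  have mφ : ∀ n, AEStronglyMeasurable (fun p : Ω × ℝ => φ' (Xs n p.1)) (P.prod halfLine) :=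
    fun n => (hc.comp_aestronglyMeasurable (hXsm n).1).comp_fst
  have hcut : ∀ n {f : Ω × ℝ → ℝ}, Integrable f (P.prod halfLine) →
      Integrable (fun p => φ' (Xs n p.1) * f p) (P.prod halfLine) := fun n f hf =>
    hf.bdd_mul (mφ n) (Eventually.of_forall fun p => hK _)
  -- The argument of `φ'` is moved first, by dominated convergence against the fixed integrable `DX
  -- * V`; `b2` then treats the change of the product, which is small in `L¹`.
  have b1 : Tendsto (fun n => ∫ p, φ' (Xs n p.1) * (DX p * V p) ∂(P.prod halfLine)) atTop
      (𝓝 (∫ p, φ' (X p.1) * (DX p * V p) ∂(P.prod halfLine))) := by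
    refine tendsto_integral_of_dominated_convergence (fun p => K * ‖DX p * V p‖)
      (fun n => (hcut n hZV).1) (hZV.norm.const_mul K) (fun n => Eventually.of_forall fun p => ?_)
      ?_
    · rw [norm_mul]
      exact mul_le_mul_of_nonneg_right (hK _) (norm_nonneg _)
    · have : ∀ᵐ p ∂(P.prod halfLine), Tendsto (fun n => Xs n p.1) atTop (𝓝 (X p.1)) :=
        Measure.quasiMeasurePreserving_fst.ae hae
      filter_upwards [this] with p hp
      exact ((hc.tendsto _).comp hp).mul_const _
  have b2 : Tendsto (fun n => ∫ p, φ' (Xs n p.1) *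
      (gradProcess U (g n) p * projProcess U (g n) p - DX p * V p) ∂(P.prod halfLine)) atTop
      (𝓝 0) := by
    have l1 := tendsto_eLpNorm_mul_sub hX.memLp_grad hVm hgm hpm h2 h3
    have lim := ENNReal.Tendsto.const_mul (a := ENNReal.ofReal K) l1
      (Or.inr ENNReal.ofReal_ne_top)
    rw [mul_zero] at lim
    have := tendsto_integral_of_L1' (μ := P.prod halfLine) (l := atTop) (fun _ => (0 : ℝ))
      aestronglyMeasurable_const
      (F := fun n p => φ' (Xs n p.1) *
        (gradProcess U (g n) p * projProcess U (g n) p - DX p * V p))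
      (Eventually.of_forall fun n => hcut n ((hZVs n).sub hZV)) ?_
    · simpa using this
    · refine tendsto_of_tendsto_of_tendsto_of_le_of_le tendsto_const_nhds lim (fun n => zero_le)
        fun n => eLpNorm_le_mul_eLpNorm_of_ae_le_mul (Eventually.of_forall fun p => ?_) 1
      simp only [Pi.sub_apply, sub_zero, norm_mul]
      exact mul_le_mul_of_nonneg_right (hK _) (norm_nonneg _)
  have b3 := b2.add b1
  rw [zero_add] at b3
  refine b3.congr fun n => ?_
  have hcutn : Integrable (fun p => φ' (Xs n p.1) *
      (gradProcess U (g n) p * projProcess U (g n) p - DX p * V p)) (P.prod halfLine) :=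
    hcut n ((hZVs n).sub hZV)
  rw [← integral_add hcutn (hcut n hZV)]
  refine integral_congr_ae (Eventually.of_forall fun p => ?_)
  simp only [Xs]
  ring

theorem HasGradient.integrable_mul {X : Ω → ℝ} {DX V : Ω × ℝ → ℝ}
    (hX : HasGradient U P X DX) (hV : IsCondExpProcess U P DX V) :
    Integrable (fun p => DX p * V p) (P.prod halfLine) :=
  hX.memLp_grad.integrable_mul (hV.memLp hX.memLp_grad)

theorem HasGradient.integrable_pairing {X : Ω → ℝ} {DX V : Ω × ℝ → ℝ}
    (hX : HasGradient U P X DX) (hV : IsCondExpProcess U P DX V) :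
    Integrable (pairing DX V) P := (hX.integrable_mul hV).integral_prod_left

/-- Half of the pairing is a Stein kernel of `X`. -/
theorem HasGradient.integral_deriv_mul_pairing (hU : ∀ k, Measurable (U k)) (hi : iIndepFun U P)
    (hu : ∀ k, pdf.IsUniform (U k) (Set.Icc (-1) 1) P volume) {X : Ω → ℝ} {DX V : Ω × ℝ → ℝ}
    (hX : HasGradient U P X DX) (hX0 : ∫ ω, X ω ∂P = 0) (hV : IsCondExpProcess U P DX V)
    {φ φ' : ℝ → ℝ} (hφ : ∀ x, HasDerivAt φ (φ' x) x) (hc : Continuous φ') {K : ℝ}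
    (hK : ∀ x, |φ' x| ≤ K) :
    ∫ ω, φ' (X ω) * pairing DX V ω ∂P = 2 * ∫ ω, φ (X ω) * X ω ∂P := by
  have h := hX.integral_deriv_mul hU hi hu hV hφ hc hK
  rw [hX0, mul_zero, sub_zero] at h
  rw [← h, integral_prod]
  · refine integral_congr_ae (Eventually.of_forall fun ω => ?_)
    simp only [pairing]
    rw [integral_const_mul]
  · refine (hX.integrable_mul hV).bdd_mul (c := K) ?_ (Eventually.of_forall fun p => hK _)
    exact (hc.comp_aestronglyMeasurable hX.memLp.1).comp_fst

end Limits

end UniformMalliavin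

namespace UniformMalliavin

/-! ### The Stein bounds -/

section Bounds

set_option linter.unusedSectionVars false

variable {Ω : Type*} [mΩ : MeasurableSpace Ω] {P : Measure Ω} [IsProbabilityMeasure P]

theorem ofReal_abs_integral_mul_le {ψ R : Ω → ℝ} {K : ℝ} (hK : ∀ ω, |ψ ω| ≤ K)
    (hR : AEStronglyMeasurable R P) :
    ENNReal.ofReal |∫ ω, ψ ω * R ω ∂P| ≤ ENNReal.ofReal K * eLpNorm R 2 P := by
  rw [← Real.enorm_eq_ofReal_abs]
  refine (enorm_integral_le_lintegral_enorm _).trans ?_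
  rw [← eLpNorm_one_eq_lintegral_enorm]
  refine (eLpNorm_le_mul_eLpNorm_of_ae_le_mul (g := R) (c := K)
    (Eventually.of_forall fun ω => ?_) 1).trans ?_
  · rw [norm_mul]
    exact mul_le_mul_of_nonneg_right (hK ω) (norm_nonneg _)
  · gcongr
    exact eLpNorm_le_eLpNorm_of_exponent_le one_le_two hR

/-- `τ` is a Stein kernel of `X`. -/
structure IsSteinKernel (P : Measure Ω) (X τ : Ω → ℝ) : Prop where
  memLp : MemLp X 2 P
  integrable : Integrable τ P
  integral_deriv_mul : ∀ {φ φ' : ℝ → ℝ} {K : ℝ}, (∀ x, HasDerivAt φ (φ' x) x) → Continuous φ' →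
    (∀ x, |φ' x| ≤ K) → ∫ ω, φ' (X ω) * τ ω ∂P = ∫ ω, φ (X ω) * X ω ∂P

variable {X τ : Ω → ℝ}

theorem IsSteinKernel.integral_eq (h : IsSteinKernel P X τ) : ∫ ω, τ ω ∂P = ∫ ω, X ω ^ 2 ∂P := by
  have := h.integral_deriv_mul (φ := fun x => x) (φ' := fun _ => 1) (K := 1)
    (fun x => hasDerivAt_id x) continuous_const (fun x => by simp)
  simpa [pow_two] using this

/-- Inserting `X` in Stein's equation and trading `X f(X)` for `τ f'(X)` leaves the expectation of
`f'(X)(1 - τ)`. -/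
theorem IsSteinKernel.ofReal_normal_le (hτ : IsSteinKernel P X τ) {h f f' : ℝ → ℝ}
    (hh : Continuous h) {K : ℝ} (hf : ∀ x, HasDerivAt f (f' x) x) (hc : Continuous f')
    (hK : ∀ x, |f' x| ≤ K)
    (heq : ∀ x, f' x - x * f x = h x - ∫ y, h y ∂(gaussianReal 0 1)) :
    ENNReal.ofReal |(∫ x, h x ∂(P.map X)) - ∫ x, h x ∂(gaussianReal 0 1)|
      ≤ ENNReal.ofReal K * eLpNorm (fun ω => 1 - τ ω) 2 P := by
  set m := ∫ y, h y ∂(gaussianReal 0 1)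
  have hf'X : Integrable (fun ω => f' (X ω)) P :=
    Integrable.of_bound (hc.comp_aestronglyMeasurable hτ.memLp.1) K
      (Eventually.of_forall fun ω => hK _)
  have hfX : Integrable (fun ω => f (X ω) * X ω) P :=
    (memLp_comp_of_deriv_le hf hK hτ.memLp).integrable_mul hτ.memLp
  have hf'τ : Integrable (fun ω => f' (X ω) * τ ω) P :=
    hτ.integrable.bdd_mul hf'X.1 (Eventually.of_forall fun ω => hK _)
  have e : (∫ x, h x ∂(P.map X)) - m = ∫ ω, f' (X ω) * (1 - τ ω) ∂P := by
    rw [integral_map hτ.memLp.1.aemeasurable hh.aestronglyMeasurable]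
    have e1 : ∀ ω, h (X ω) = f' (X ω) - f (X ω) * X ω + m := fun ω => by
      linarith [heq (X ω), mul_comm (f (X ω)) (X ω)]
    simp only [e1, mul_sub, mul_one]
    have hsub : Integrable (fun ω => f' (X ω) - f (X ω) * X ω) P := hf'X.sub hfX
    rw [integral_add hsub (integrable_const _), integral_sub hf'X hfX,
      integral_sub hf'X hf'τ, hτ.integral_deriv_mul hf hc hK]
    simp
  rw [e]
  exact ofReal_abs_integral_mul_le (fun ω => hK _) (aestronglyMeasurable_const.sub hτ.integrable.1)

theorem IsSteinKernel.dTV_le (hτ : IsSteinKernel P X τ) :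
    dTV (P.map X) (gaussianReal 0 1) ≤ 2 * eLpNorm (fun ω => 1 - τ ω) 2 P := by
  have : IsProbabilityMeasure (P.map X) := Measure.isProbabilityMeasure_map hτ.memLp.1.aemeasurable
  by_cases htop : eLpNorm (fun ω => 1 - τ ω) 2 P = ∞
  · simp [htop]
  have htop' : 2 * eLpNorm (fun ω => 1 - τ ω) 2 P ≠ ∞ := ENNReal.mul_ne_top (by simp) htop
  rw [← ENNReal.ofReal_toReal htop']
  refine dTV_le_of_continuous fun h hh h0 h1 => ?_
  obtain ⟨f, f', hf, hc, hK, heq⟩ := exists_stein_solution_of_bounded hh h0 h1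
  have := hτ.ofReal_normal_le hh hf hc hK heq
  rw [ENNReal.ofReal_ofNat] at this
  exact (ENNReal.ofReal_le_iff_le_toReal htop').mp this

theorem IsSteinKernel.dW_le (hτ : IsSteinKernel P X τ) :
    dW (P.map X) (gaussianReal 0 1) ≤ eLpNorm (fun ω => 1 - τ ω) 2 P := by
  have : IsProbabilityMeasure (P.map X) := Measure.isProbabilityMeasure_map hτ.memLp.1.aemeasurable
  have hidX : MemLp (fun x : ℝ => x) 1 (P.map X) :=
    (memLp_map_measure_iff aestronglyMeasurable_id hτ.memLp.1.aemeasurable).mpr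
      (hτ.memLp.mono_exponent one_le_two)
  have hidN : MemLp (fun x : ℝ => x) 1 (gaussianReal 0 1) := memLp_id_gaussianReal' 1 (by simp)
  refine iSup₂_le fun h hh => ENNReal.le_of_forall_pos_le_add fun ε hε _ => ?_
  -- Smoothing at scale `ε/4` costs at most `ε/2` under each of the two laws.
  have hε' : (0 : ℝ) < (ε : ℝ) / 4 := by positivity
  obtain ⟨g, g', g'', B, hg, hg', hc, h1, hB, hgh⟩ := exists_smooth_approx_of_lipschitz hh hε'
  obtain ⟨f, f', hf, hfc, hK, heq⟩ := exists_stein_solution_of_deriv_le hg hg' hc h1 hB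
  have hgc : Continuous g := continuous_iff_continuousAt.mpr fun x => (hg x).continuousAt
  have close : ∀ ρ : Measure ℝ, IsProbabilityMeasure ρ → MemLp (fun x : ℝ => x) 1 ρ →
      |(∫ x, h x ∂ρ) - ∫ x, g x ∂ρ| ≤ 2 * (ε / 4) := by
    intro ρ _ hρ
    have ig : Integrable g ρ := (memLp_comp_of_deriv_le hg h1 hρ).integrable le_rfl
    have id : Integrable (fun x => h x - g x) ρ :=
      Integrable.of_bound (hh.continuous.sub hgc).aestronglyMeasurable (2 * (ε / 4))
        (Eventually.of_forall fun x => by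
          rw [Real.norm_eq_abs, abs_sub_comm]; exact hgh x)
    have ih : Integrable h ρ := (id.add ig).congr (Eventually.of_forall fun x => by simp)
    rw [← integral_sub ih ig]
    have := norm_integral_le_of_norm_le_const (μ := ρ) (f := fun x => h x - g x)
      (C := 2 * (ε / 4)) (Eventually.of_forall fun x => by
          rw [Real.norm_eq_abs, abs_sub_comm]; exact hgh x)
    simpa using this
  have c1 := close (P.map X) inferInstance hidX
  have c2 := close (gaussianReal 0 1) inferInstance hidN
  have key := hτ.ofReal_normal_le hgc hf hfc hK heq
  rw [ENNReal.ofReal_one, one_mul] at key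
  have tri : |(∫ x, h x ∂(P.map X)) - ∫ x, h x ∂(gaussianReal 0 1)|
      ≤ |(∫ x, g x ∂(P.map X)) - ∫ x, g x ∂(gaussianReal 0 1)| + ε := by
    rw [abs_le] at c1 c2
    rw [abs_le]
    have := neg_abs_le ((∫ x, g x ∂(P.map X)) - ∫ x, g x ∂(gaussianReal 0 1))
    have := le_abs_self ((∫ x, g x ∂(P.map X)) - ∫ x, g x ∂(gaussianReal 0 1))
    constructor <;> linarith
  refine (ENNReal.ofReal_le_ofReal tri).trans ?_
  rw [ENNReal.ofReal_add (abs_nonneg _) ε.coe_nonneg, ENNReal.ofReal_coe_nnreal]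
  gcongr

theorem integral_centeredGamma {h : ℝ → ℝ} (hh : Continuous h) (ν : ℝ) :
    ∫ x, h x ∂(centeredGamma ν) = ∫ x, h (2 * x - ν) ∂(gammaMeasure (ν / 2) 1) :=
  integral_map (by fun_prop) hh.aestronglyMeasurable

/-- The gamma Stein solution lives on the open half line, whereas the kernel identity needs a `C¹`
function on `ℝ`. The solution is therefore shifted by `ε` and continued affinely to the left of
`-ν`, a region that `X` avoids. The shift costs `O(ε)`. -/
theorem IsSteinKernel.abs_gamma_le (hτ : IsSteinKernel P X τ) {ν : ℝ}
    (hX : ∀ᵐ ω ∂P, -ν < X ω) {h h' : ℝ → ℝ} (hh : ∀ x, HasDerivAt h (h' x) x)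
    (h1 : ∀ x, |h' x| ≤ 1) {φ φ' : ℝ → ℝ} (hφ : ∀ x, 0 < x → HasDerivAt φ (φ' x) x)
    (hφc : ContinuousOn φ' (Set.Ioi 0)) (hφ' : ∀ x, 0 < x → |φ' x| ≤ 2) {m : ℝ}
    (heq : ∀ x, 0 < x → x * φ' x + (ν / 2 - x) * φ x = h (2 * x - ν) - m)
    {ε : ℝ} (hε : 0 < ε) (hε1 : ε ≤ 1) :
    ∃ ψ : ℝ → ℝ, (∀ x, |ψ x| ≤ 1 / 2) ∧ |(∫ ω, h (X ω) ∂P) - m|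
      ≤ |∫ ω, ψ (X ω) * (2 * (X ω + ν) - τ ω) ∂P|
        + ε * (|φ 1| + (∫ ω, |X ω| ∂P) + ν + 8) := by
  have hhc : Continuous h := continuous_iff_continuousAt.mpr fun x => (hh x).continuousAt
  set θ : ℝ → ℝ := fun y => φ' (max (y + ν) 0 / 2 + ε) / 4 with hθ
  have hpos : ∀ y : ℝ, 0 < max (y + ν) 0 / 2 + ε := fun y => by
    have := le_max_right (y + ν) 0
    positivity
  have hθb : ∀ y, |θ y| ≤ 1 / 2 := fun y => by
    simp only [hθ, abs_div]
    rw [abs_of_pos (by norm_num : (0 : ℝ) < 4)]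
    linarith [hφ' _ (hpos y)]
  have hθc : Continuous θ :=
    (hφc.comp_continuous (by fun_prop) fun y => hpos y).div_const 4
  -- The constant makes `Φ y` equal to `φ ((y + ν) / 2 + ε) / 2` for `y > -ν`; the two halvings
  -- account for the factor `1/4` in `θ`.
  set Φ : ℝ → ℝ := fun y => φ ε / 2 + ∫ t in (-ν)..y, θ t with hΦ
  have hΦd : ∀ y, HasDerivAt Φ (θ y) y := fun y =>
    (intervalIntegral.integral_hasDerivAt_right (hθc.intervalIntegrable _ _)
      (hθc.stronglyMeasurableAtFilter _ _) hθc.continuousAt).const_add _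
  have hΦeq : ∀ y, -ν < y → Φ y = φ ((y + ν) / 2 + ε) / 2 := by
    intro y hy
    have := intervalIntegral.integral_eq_sub_of_hasDerivAt (a := -ν) (b := y)
      (f := fun y => φ ((y + ν) / 2 + ε) / 2) (f' := θ) (fun t ht => by
        rw [Set.uIcc_of_le hy.le] at ht
        have ht0 : 0 ≤ t + ν := by linarith [ht.1]
        have hi : HasDerivAt (fun y : ℝ => (y + ν) / 2 + ε) (1 / 2) t :=
          (((hasDerivAt_id t).add_const ν).div_const 2).add_const ε
        have hp : 0 < (t + ν) / 2 + ε := by positivity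
        refine (((hφ _ hp).comp t hi).div_const 2).congr_deriv ?_
        simp only [hθ, max_eq_left ht0]
        ring) (hθc.intervalIntegrable _ _)
    simp only [hΦ, this]
    simp
  have hXi : Integrable X P := hτ.memLp.integrable one_le_two
  have hθX : Integrable (fun ω => θ (X ω)) P :=
    Integrable.of_bound (hθc.comp_aestronglyMeasurable hτ.memLp.1) (1 / 2)
      (Eventually.of_forall fun ω => hθb _)
  have hΦ2 : MemLp (fun ω => Φ (X ω)) 2 P := memLp_comp_of_deriv_le hΦd hθb hτ.memLp
  have hΦX : Integrable (fun ω => Φ (X ω)) P := hΦ2.integrable one_le_two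
  have hΦXX : Integrable (fun ω => Φ (X ω) * X ω) P := hΦ2.integrable_mul hτ.memLp
  have hθτ : Integrable (fun ω => θ (X ω) * τ ω) P :=
    hτ.integrable.bdd_mul hθX.1 (Eventually.of_forall fun ω => hθb _)
  have hθl : Integrable (fun ω => θ (X ω) * (2 * (X ω + ν))) P :=
    ((hXi.add (integrable_const ν)).const_mul 2).bdd_mul hθX.1
      (Eventually.of_forall fun ω => hθb _)
  have hpt : ∀ᵐ ω ∂P, h (X ω + 2 * ε) - m
      = θ (X ω) * (2 * (X ω + ν)) - Φ (X ω) * X ω + (4 * ε * θ (X ω) - 2 * ε * Φ (X ω)) := by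
    filter_upwards [hX] with ω hω
    have hp : 0 < (X ω + ν) / 2 + ε := by
      have : 0 < X ω + ν := by linarith
      positivity
    have e := heq _ hp
    rw [show 2 * ((X ω + ν) / 2 + ε) - ν = X ω + 2 * ε by ring] at e
    have e1 : θ (X ω) = φ' ((X ω + ν) / 2 + ε) / 4 := by
      simp only [hθ]
      rw [max_eq_left (by linarith)]
    rw [← e, e1, hΦeq _ hω]
    ring
  have hlip : ∀ ω, |h (X ω + 2 * ε) - h (X ω)| ≤ 2 * ε := fun ω => by
    have := abs_sub_le_of_hasDerivAt hh h1 (X ω + 2 * ε) (X ω)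
    rwa [add_sub_cancel_left, one_mul, abs_of_pos (by positivity : (0 : ℝ) < 2 * ε)] at this
  have hhX : Integrable (fun ω => h (X ω)) P :=
    (memLp_comp_of_deriv_le hh h1 hτ.memLp).integrable one_le_two
  have hd : Integrable (fun ω => h (X ω + 2 * ε) - h (X ω)) P :=
    Integrable.of_bound ((hhc.comp_aestronglyMeasurable
      (hτ.memLp.1.add aestronglyMeasurable_const)).sub hhX.1) (2 * ε)
      (Eventually.of_forall hlip)
  have hrem : Integrable (fun ω => 4 * ε * θ (X ω) - 2 * ε * Φ (X ω)) P :=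
    (hθX.const_mul _).sub (hΦX.const_mul _)
  have e1 : (∫ ω, h (X ω) ∂P) - m = (∫ ω, (h (X ω + 2 * ε) - m) ∂P)
      - ∫ ω, (h (X ω + 2 * ε) - h (X ω)) ∂P := by
    have hh2 : Integrable (fun ω => h (X ω + 2 * ε)) P :=
      (hd.add hhX).congr (Eventually.of_forall fun ω => by simp)
    rw [integral_sub hh2 (integrable_const _), integral_sub hh2 hhX]
    simp
  have e2 : ∫ ω, (h (X ω + 2 * ε) - m) ∂P
      = (∫ ω, θ (X ω) * (2 * (X ω + ν) - τ ω) ∂P)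
        + ∫ ω, (4 * ε * θ (X ω) - 2 * ε * Φ (X ω)) ∂P := by
    have hsub : Integrable (fun ω => θ (X ω) * (2 * (X ω + ν)) - Φ (X ω) * X ω) P :=
      hθl.sub hΦXX
    rw [integral_congr_ae hpt, integral_add hsub hrem, integral_sub hθl hΦXX,
      ← hτ.integral_deriv_mul hΦd hθc hθb, ← integral_sub hθl hθτ]
    simp only [mul_sub]
  have b1 : |∫ ω, (h (X ω + 2 * ε) - h (X ω)) ∂P| ≤ 2 * ε := by
    have := norm_integral_le_of_norm_le_const (μ := P) (C := 2 * ε)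
      (f := fun ω => h (X ω + 2 * ε) - h (X ω)) (Eventually.of_forall hlip)
    simpa using this
  -- Growth is measured from the base point `1`, so the bound does not involve `φ ε` and is uniform
  -- in `ε ≤ 1`.
  have hΦb : ∀ᵐ ω ∂P, |Φ (X ω)| ≤ |φ 1| / 2 + (|X ω| + ν) / 2 + 2 := by
    filter_upwards [hX] with ω hω
    rw [hΦeq _ hω]
    set x := (X ω + ν) / 2 + ε with hx
    have hx0 : 0 < x := by
      have : 0 < X ω + ν := by linarith
      positivity
    have lip := Convex.norm_image_sub_le_of_norm_hasDerivWithin_le (f := φ) (f' := φ')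
      (s := Set.Ioi 0) (C := 2) (x := 1) (y := x) (fun y hy => (hφ y hy).hasDerivWithinAt)
      (fun y hy => hφ' y hy) (convex_Ioi 0) (by simp) hx0
    simp only [Real.norm_eq_abs] at lip
    have t1 := abs_add_le (φ x - φ 1) (φ 1)
    rw [sub_add_cancel] at t1
    have t2 : |x - 1| ≤ (|X ω| + ν) / 2 + 2 := by
      rw [abs_le, hx]
      constructor <;> linarith [le_abs_self (X ω), neg_abs_le (X ω)]
    rw [abs_div, abs_of_pos (by norm_num : (0 : ℝ) < 2)]
    linarith
  have b2 : |∫ ω, (4 * ε * θ (X ω) - 2 * ε * Φ (X ω)) ∂P|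
      ≤ ε * (|φ 1| + (∫ ω, |X ω| ∂P) + ν + 6) := by
    have hbi : Integrable (fun ω => ε * (|X ω| + (|φ 1| + ν + 6))) P :=
      (hXi.abs.add (integrable_const _)).const_mul ε
    have := norm_integral_le_of_norm_le (μ := P) hbi
      (f := fun ω => 4 * ε * θ (X ω) - 2 * ε * Φ (X ω)) (by
        filter_upwards [hΦb] with ω hω
        refine (abs_sub _ _).trans ?_
        rw [abs_mul (4 * ε), abs_mul (2 * ε), abs_of_pos (by positivity : 0 < 4 * ε),
          abs_of_pos (by positivity : 0 < 2 * ε)]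
        nlinarith [hθb (X ω)])
    refine this.trans (le_of_eq ?_)
    rw [integral_const_mul, integral_add hXi.abs (integrable_const _)]
    simp only [integral_const, probReal_univ, one_smul]
    ring
  refine ⟨θ, hθb, ?_⟩
  rw [e1, e2]
  refine (abs_sub _ _).trans ?_
  refine (add_le_add (abs_add_le _ _) b1).trans ?_
  linarith

theorem IsSteinKernel.dH_le (hτ : IsSteinKernel P X τ) {ν : ℝ} (hν : 0 < ν)
    (hX : ∀ᵐ ω ∂P, -ν < X ω) :
    dH (P.map X) (centeredGamma ν) ≤ eLpNorm (fun ω => 2 * (X ω + ν) - τ ω) 2 P := by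
  refine iSup₂_le fun h hh => ?_
  obtain ⟨hs, hb⟩ := hh
  have hd : ∀ x, HasDerivAt h (deriv h x) x := fun x =>
    (hs.differentiable two_ne_zero x).hasDerivAt
  have hd' : ∀ x, HasDerivAt (deriv h) (iteratedDeriv 2 h x) x := fun x => by
    have e : iteratedDeriv 2 h = deriv (deriv h) := by
      rw [iteratedDeriv_succ, iteratedDeriv_one]
    rw [e]
    have : ContDiff ℝ 1 (deriv h) := ((contDiff_succ_iff_deriv (n := 1)).mp hs).2.2
    exact (this.differentiable one_ne_zero x).hasDerivAt
  have hi : ∀ x : ℝ, HasDerivAt (fun x : ℝ => 2 * x - ν) 2 x := fun x =>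
    (((hasDerivAt_id x).const_mul 2).sub_const ν).congr_deriv (by simp)
  -- The substitution `2x - ν` multiplies the second derivative by 4, so `M = 4` and `|φ'| ≤ 2`.
  obtain ⟨φ, φ', hφ, hφc, hφ', heq⟩ := exists_gamma_stein_solution (r := ν / 2) (by positivity)
    (g := fun x => h (2 * x - ν)) (g' := fun x => deriv h (2 * x - ν) * 2)
    (g'' := fun x => iteratedDeriv 2 h (2 * x - ν) * 2 * 2) (M := 4) (C := 1)
    (fun x => (hd _).comp x (hi x)) (fun x => ((hd' _).comp x (hi x)).mul_const 2)
    (fun x => (hb _).1) (fun x => by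
      rw [abs_mul, abs_mul, abs_of_pos (by norm_num : (0 : ℝ) < 2)]
      linarith [(hb (2 * x - ν)).2.2])
  rw [integral_map hτ.memLp.1.aemeasurable hs.continuous.aestronglyMeasurable,
    integral_centeredGamma hs.continuous]
  set m := ∫ x, h (2 * x - ν) ∂(gammaMeasure (ν / 2) 1)
  set C := |φ 1| + (∫ ω, |X ω| ∂P) + ν + 8 with hC
  have hC0 : 0 < C := by
    have : 0 ≤ ∫ ω, |X ω| ∂P := integral_nonneg fun ω => abs_nonneg _
    positivity
  refine ENNReal.le_of_forall_pos_le_add fun δ hδ _ => ?_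
  have hε : 0 < min 1 ((δ : ℝ) / C) := by positivity
  obtain ⟨ψ, hψ, hle⟩ := hτ.abs_gamma_le hX hd (fun x => (hb x).2.1) hφ hφc
    (fun x hx => (hφ' x hx).trans (by norm_num)) heq hε (min_le_left _ _)
  have hle' : |(∫ ω, h (X ω) ∂P) - m|
      ≤ |∫ ω, ψ (X ω) * (2 * (X ω + ν) - τ ω) ∂P| + δ := by
    refine hle.trans (add_le_add le_rfl ?_)
    calc min 1 ((δ : ℝ) / C) * C ≤ (δ : ℝ) / C * C := by
          gcongr
          exact min_le_right _ _
      _ = δ := by field_simp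
  refine (ENNReal.ofReal_le_ofReal hle').trans ?_
  rw [ENNReal.ofReal_add (abs_nonneg _) δ.coe_nonneg, ENNReal.ofReal_coe_nnreal]
  gcongr
  refine (ofReal_abs_integral_mul_le (fun ω => hψ _) ?_).trans ?_
  · exact ((hτ.memLp.1.add aestronglyMeasurable_const).const_mul 2).sub hτ.integrable.1
  · refine mul_le_of_le_one_left zero_le ?_
    rw [ENNReal.ofReal_le_one]
    norm_num

end Bounds

end UniformMalliavin

/-! ### The bounds for `G_X` -/

theorem proposition3p2 {Ω : Type*} [MeasurableSpace Ω] (P : Measure Ω) [IsProbabilityMeasure P]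
    (U : ℕ → Ω → ℝ) (hU_meas : ∀ k, Measurable (U k)) (hU_indep : iIndepFun U P)
    (hU_unif : ∀ k, pdf.IsUniform (U k) (Set.Icc (-1) 1) P volume)
    (X : Ω → ℝ) (DX : Ω × ℝ → ℝ) (hX : UniformMalliavin.HasGradient U P X DX)
    (hX_centered : ∫ ω, X ω ∂P = 0) :
    -- the process `t ↦ E[D_t X | ℱ̃_t]` has a jointly measurable version
    (∃ V, UniformMalliavin.IsCondExpProcess U P DX V) ∧
    ∀ V, UniformMalliavin.IsCondExpProcess U P DX V →
      -- the inner product `⟨DX, E[DX | ℱ̃]⟩` is well defined and integrable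
      (∀ᵐ ω ∂P, Integrable (fun t => DX (ω, t) * V (ω, t)) UniformMalliavin.halfLine) ∧
      Integrable (UniformMalliavin.pairing DX V) P ∧
      -- Wasserstein distance to the standard normal law
      UniformMalliavin.dW (P.map X) (gaussianReal 0 1)
        ≤ (1 / 2) * eLpNorm (fun ω => 2 - UniformMalliavin.pairing DX V ω) 2 P ∧
      (1 / 2) * eLpNorm (fun ω => 2 - UniformMalliavin.pairing DX V ω) 2 P
        ≤ ENNReal.ofReal |1 - ∫ ω, X ω ^ 2 ∂P|
          + (1 / 2) * eLpNorm (fun ω => UniformMalliavin.pairing DX V ω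
              - ∫ ω', UniformMalliavin.pairing DX V ω' ∂P) 2 P ∧
      -- total variation distance to the standard normal law
      UniformMalliavin.dTV (P.map X) (gaussianReal 0 1)
        ≤ eLpNorm (fun ω => 2 - UniformMalliavin.pairing DX V ω) 2 P ∧
      eLpNorm (fun ω => 2 - UniformMalliavin.pairing DX V ω) 2 P
        ≤ 2 * ENNReal.ofReal |1 - ∫ ω, X ω ^ 2 ∂P|
          + eLpNorm (fun ω => UniformMalliavin.pairing DX V ω
              - ∫ ω', UniformMalliavin.pairing DX V ω' ∂P) 2 P ∧
      -- distance to the centered gamma law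
      ∀ ν : ℝ, 0 < ν → (∀ᵐ ω ∂P, -ν < X ω) →
        UniformMalliavin.dH (P.map X) (UniformMalliavin.centeredGamma ν)
          ≤ eLpNorm (fun ω => 2 * (X ω + ν) - (1 / 2) * UniformMalliavin.pairing DX V ω) 2 P ∧
        eLpNorm (fun ω => 2 * (X ω + ν) - (1 / 2) * UniformMalliavin.pairing DX V ω) 2 P
          ≤ eLpNorm (fun ω => 2 * (X ω + ν) - ∫ ω', X ω' ^ 2 ∂P) 2 P
            + (1 / 2) * eLpNorm (fun ω => UniformMalliavin.pairing DX V ω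
                - ∫ ω', UniformMalliavin.pairing DX V ω' ∂P) 2 P := by
  refine ⟨hX.exists_isCondExpProcess hU_meas hU_indep hU_unif, fun V hV => ?_⟩
  set G := UniformMalliavin.pairing DX V with hG
  have hGi : Integrable G P := hX.integrable_pairing hV
  have hker : UniformMalliavin.IsSteinKernel P X fun ω => 2⁻¹ * G ω :=
    ⟨hX.memLp, hGi.const_mul _, fun {φ φ' K} hφ hc hK => by
      have := hX.integral_deriv_mul_pairing hU_meas hU_indep hU_unif hX_centered hV hφ hc hK
      simp only [mul_left_comm _ (2⁻¹ : ℝ)]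
      rw [integral_const_mul, this]
      ring⟩
  have hmean : ∫ ω, G ω ∂P = 2 * ∫ ω, X ω ^ 2 ∂P := by
    rw [← hker.integral_eq, integral_const_mul]
    ring
  have hscale : eLpNorm (fun ω => 2 - G ω) 2 P
      = 2 * eLpNorm (fun ω => 1 - 2⁻¹ * G ω) 2 P := by
    have e : (fun ω => 2 - G ω) = (2 : ℝ) • fun ω => 1 - 2⁻¹ * G ω := by
      funext ω
      simp only [Pi.smul_apply, smul_eq_mul]
      ring
    rw [e, eLpNorm_const_smul, Real.enorm_eq_ofReal zero_le_two, ENNReal.ofReal_ofNat]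
  have hhalf : (1 / 2 : ℝ≥0∞) * 2 = 1 := by
    rw [one_div]
    exact ENNReal.inv_mul_cancel (by simp) (by simp)
  set a := ∫ ω, X ω ^ 2 ∂P with ha
  set g := ∫ ω, G ω ∂P with hg
  have hGm : AEStronglyMeasurable (fun ω => G ω - g) P := hGi.1.sub aestronglyMeasurable_const
  have hcentered : eLpNorm (fun ω => 2 - G ω) 2 P
      ≤ 2 * ENNReal.ofReal |1 - a| + eLpNorm (fun ω => G ω - g) 2 P := by
    -- Centring uses `g = 2 a`: the deterministic part of `2 - G` is `2 (1 - a)`.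
    have e : (fun ω => 2 - G ω) = (fun _ => 2 * (1 - a)) - fun ω => G ω - g := by
      funext ω
      simp only [Pi.sub_apply, hmean]
      ring
    rw [e]
    refine (eLpNorm_sub_le aestronglyMeasurable_const hGm one_le_two).trans ?_
    refine add_le_add (le_of_eq ?_) le_rfl
    rw [eLpNorm_const _ two_ne_zero (IsProbabilityMeasure.ne_zero P), measure_univ,
      ENNReal.one_rpow, mul_one, Real.enorm_eq_ofReal_abs, abs_mul, abs_two,
      ENNReal.ofReal_mul zero_le_two, ENNReal.ofReal_ofNat]
  refine ⟨(hX.integrable_mul hV).prod_right_ae, hGi, ?_, ?_, ?_, hcentered, fun ν hν hXν =>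
    ⟨?_, ?_⟩⟩
  · rw [hscale, ← mul_assoc, hhalf, one_mul]
    exact hker.dW_le
  · calc (1 / 2 : ℝ≥0∞) * eLpNorm (fun ω => 2 - G ω) 2 P
        ≤ (1 / 2) * (2 * ENNReal.ofReal |1 - a| + eLpNorm (fun ω => G ω - g) 2 P) := by gcongr
      _ = _ := by rw [mul_add, ← mul_assoc, hhalf, one_mul]
  · rw [hscale]
    exact hker.dTV_le
  · simpa only [one_div] using hker.dH_le hν hXν
  · have e : (fun ω => 2 * (X ω + ν) - 1 / 2 * G ω)
        = (fun ω => 2 * (X ω + ν) - a) - (2⁻¹ : ℝ) • fun ω => G ω - g := by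
      funext ω
      simp only [Pi.sub_apply, Pi.smul_apply, smul_eq_mul, hmean]
      ring
    rw [e]
    have hXm : AEStronglyMeasurable (fun ω => 2 * (X ω + ν) - a) P :=
      ((hX.memLp.1.add aestronglyMeasurable_const).const_mul 2).sub aestronglyMeasurable_const
    refine (eLpNorm_sub_le hXm (hGm.const_smul _) one_le_two).trans ?_
    rw [eLpNorm_const_smul, Real.enorm_eq_ofReal (by norm_num), ENNReal.ofReal_inv_of_pos two_pos,
      ENNReal.ofReal_ofNat, one_div]
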